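/- Let $0<\alpha<1$ and $r,\lambda,k,a>0$, let $u(c)=c^\alpha/\alpha$, $u^*(q)=\sup_{c>0}\{u(c)-cq\}\in(-\infty,+\infty]$ and $\mathcal U(R)=\left(\frac{1-\alpha}{r}\right)^{1-\alpha}\frac{R^\alpha}{\alpha}$, and assume $\mathcal U(a)\ge k/\lambda$. Let $N$ be a Poisson process of intensity $\lambda$ with natural filtration $(\mathcal F_v)_{v\ge0}$ and jump times $0=\xi_0<\xi_1<\xi_2<\cdots$, and for $x\ge0$ put $X_n=\xi_n\wedge x$. A bang-bang strategy for initial data $(x,R)\in[0,\infty)^2$ consists of dates $0\le\theta_0\le\theta_1\le\cdots\le+\infty$ and random maps $c^n:\Omega\times\mathbb R_+\to\mathbb R_+$, with consumption rate $$c_t=c^0(t)\mathbf 1_{t<\theta_0}+\sum_{n=1}^{N_x}c^n(t)\mathbf 1_{\theta_{n-1}\le t<\theta_n}+c^{N_x+1}(t)\mathbf 1_{\theta_{N_x}\le t}.$$ It is admissible, written $(\theta,c)\in\mathcal A(x,R)$, if for every $n$ the variable $\theta_n$ is $\mathcal F_{X_n}$-measurable and $c^n$ is $\mathcal F_{X_n}\otimes\mathcal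 B(\mathbb R_+)$-measurable, and if almost surely $R-\int_0^tc_s\,ds+a\sum_{n=0}^{N_x-1}\mathbf 1_{\theta_n\le t}\ge0$ for all $t\ge0$. The value function is $$V(x,R)=\sup_{(\theta,c)\in\mathcal A(x,R)}\mathbb E\Big[\int_0^\infty e^{-rt}u(c_t)\,dt-k\sum_{n=0}^{N_x}e^{-r\theta_n}(X_{n+1}-X_n)\Big],\qquad x,R\ge0,$$ and the exploration operator is $$MW(x,R)=\int_0^xW(x-s,R+a)\,\lambda e^{-\lambda s}ds+\mathcal U(R)e^{-\lambda x}-k\,\frac{1-e^{-\lambda x}}{\lambda}.$$ Consider the HJB equation $$\max\Big\{u^*\Big(\frac{\partial W}{\partial R}\Big)-rW,\;MW-W\Big\}=0\ \text{ on }[0,\infty)^2,\qquad W(0,R)=\mathcal U(R)\ \text{ for }R\ge0.$$ A solution is a function $W:[0,\infty)^2\to\mathbb R$ that is continuous in $R$ on $[0,\infty)$ and differentiable in $R$ on $(0,\infty)$ for every $x\ge0$, for which the integral in $MW$ converges absolutely, and which satisfies the equation, where at $R=0$ (no reserves, hence no consumption) the term $u^*(\partial W/\partial R)$ is read as $u^*(+\infty)=0$,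 that is, $\max\{-rW(x,0),MW(x,0)-W(x,0)\}=0$. Then: 1. $V$ is finite on $[0,\infty)^2$. For every $x\ge0$ it is concave in $R$ on $[0,\infty)$; $\partial V/\partial R$ exists and is continuous on $[0,\infty)\times(0,\infty)$. For every $R\ge0$ it is nondecreasing in $x$ on $[0,\infty)$; $\partial V/\partial x$ (one-sided at $x=0$) exists and is continuous on $[0,\infty)^2$. 2. $V$ is a solution of the HJB equation. 3. Conversely, let $\widetilde V:[0,\infty)^2\to[0,\infty)$ be continuously differentiable in $R$ on $(0,\infty)$ for every $x\ge0$, be a solution of the HJB equation, and be such that for every $x\ge0$ there is $C<\infty$ with $\widetilde V(y,R)\le C(1+\mathcal U(R))$ for all $y\in[0,x]$ and $R\ge0$. Then $\widetilde V=V$ on $[0,\infty)^2$. -/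

import Mathlib

open MeasureTheory ProbabilityTheory Set
open scoped ENNReal NNReal

noncomputable section

namespace Exploration

/-- Data of the model: the utility exponent `α` (utility `u c = c ^ α / α`), the interest rate `r`,
the intensity `lam` of the deposits, the cost `k` of exploring a unit of area, the size `a` of a
deposit. -/
structure Params where
  α : ℝ
  r : ℝ
  lam : ℝ
  k : ℝ
  a : ℝ

/-- Instantaneous utility `u c = c ^ α / α`. -/
def Params.u (p : Params) (c : ℝ) : ℝ := c ^ p.α / p.α

/-- Convex conjugate `u* q = sup_{c > 0} (u c - c q)`, possibly `+∞`. -/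
def Params.uStar (p : Params) (q : ℝ) : EReal :=
  ⨆ (c : ℝ) (_ : 0 < c), ((p.u c - c * q : ℝ) : EReal)

/-- The value `𝒰 R = ((1 - α) / r) ^ (1 - α) R ^ α / α` of reserves without exploration. -/
def Params.hotelling (p : Params) (R : ℝ) : ℝ :=
  ((1 - p.α) / p.r) ^ (1 - p.α) * (R ^ p.α / p.α)

variable {Ω : Type*}

/-- `ξ 0 = 0 < ξ 1 < ξ 2 < ⋯` are the jump times of a Poisson process of intensity `lam`:
they increase to infinity and the spacings are independent and exponential of rate `lam`. -/
structure IsPoissonArrivals [MeasurableSpace Ω] (P : Measure Ω) (lam : ℝ) (ξ : ℕ → Ω → ℝ) :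
    Prop where
  zero : ∀ ω, ξ 0 ω = 0
  strictMono : ∀ ω, StrictMono fun n => ξ n ω
  tendsto : ∀ ω, Filter.Tendsto (fun n => ξ n ω) Filter.atTop Filter.atTop
  measurable : ∀ n, Measurable (ξ n)
  law : ∀ n, P.map (fun ω => ξ (n + 1) ω - ξ n ω) = expMeasure lam
  indep : iIndepFun (fun (n : ℕ) ω => ξ (n + 1) ω - ξ n ω) P

/-- The Poisson process `N_v`: the number of jump times `ξ n`, `n ≥ 1`, in `[0, v]`. -/
def count (ξ : ℕ → Ω → ℝ) (v : ℝ) (ω : Ω) : ℕ := {n : ℕ | 1 ≤ n ∧ ξ n ω ≤ v}.ncard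

/-- `X_n = ξ_n ∧ x`, the area explored after `n` exploration episodes. -/
def explored (ξ : ℕ → Ω → ℝ) (x : ℝ) (n : ℕ) (ω : Ω) : ℝ := min (ξ n ω) x

/-- The natural filtration `ℱ_v = σ(N_w, 0 ≤ w ≤ v)`. -/
@[reducible] def natFiltration (ξ : ℕ → Ω → ℝ) (v : ℝ) : MeasurableSpace Ω :=
  ⨆ w ∈ Icc 0 v, MeasurableSpace.comap (count ξ w) ⊤

/-- The events `A` with `A ∩ {X_n ≤ v} ∈ ℱ_v` for all `v ≥ 0`. -/
def stoppedEvents (ξ : ℕ → Ω → ℝ) (x : ℝ) (n : ℕ) : Set (Set Ω) :=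
  {A | ∀ v : ℝ, 0 ≤ v → MeasurableSet[natFiltration ξ v] (A ∩ {ω | explored ξ x n ω ≤ v})}

/-- The σ-field `ℱ_{X_n}` of the events known after `n` exploration episodes. Its members are
exactly the `stoppedEvents`, see `measurableSet_stopped_iff`. -/
@[reducible] def stopped (ξ : ℕ → Ω → ℝ) (x : ℝ) (n : ℕ) : MeasurableSpace Ω :=
  MeasurableSpace.generateFrom (stoppedEvents ξ x n)

lemma le_count_iff [MeasurableSpace Ω] {P : Measure Ω} {lam : ℝ} {ξ : ℕ → Ω → ℝ}
    (h : IsPoissonArrivals P lam ξ) {v : ℝ} (hv : 0 ≤ v) (n : ℕ) (ω : Ω) :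
    n ≤ count ξ v ω ↔ ξ n ω ≤ v := by
  have hm := h.strictMono ω
  obtain ⟨m, hlo, hhi⟩ : ∃ m, ξ m ω ≤ v ∧ v < ξ (m + 1) ω := by
    by_contra! hc
    have hall : ∀ m, ξ m ω ≤ v := by
      intro m
      induction m with
      | zero => rw [h.zero]; exact hv
      | succ m ih => exact hc m ih
    obtain ⟨m, hm'⟩ := ((h.tendsto ω).eventually_gt_atTop v).exists
    exact absurd (hall m) (not_le.2 hm')
  have key : ∀ j, ξ j ω ≤ v ↔ j ≤ m := by
    intro j
    constructor
    · intro hj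
      exact Nat.lt_succ_iff.1 (hm.lt_iff_lt.1 (lt_of_le_of_lt hj hhi))
    · intro hj
      exact (hm.le_iff_le.2 hj).trans hlo
  have hs : {n : ℕ | 1 ≤ n ∧ ξ n ω ≤ v} = ((Finset.Icc 1 m : Finset ℕ) : Set ℕ) := by
    ext j; simp [key]
  have hcount : count ξ v ω = m := by
    unfold count; rw [hs, Set.ncard_coe_finset]; simp
  rw [hcount, key]

/-- `X_n` is a stopping time. -/
lemma measurableSet_explored_le [MeasurableSpace Ω] {P : Measure Ω} {lam : ℝ} {ξ : ℕ → Ω → ℝ}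
    (h : IsPoissonArrivals P lam ξ) (x : ℝ) (n : ℕ) {v : ℝ} (hv : 0 ≤ v) :
    MeasurableSet[natFiltration ξ v] {ω | explored ξ x n ω ≤ v} := by
  by_cases hx : x ≤ v
  · have : {ω | explored ξ x n ω ≤ v} = univ := by
      ext ω; simp [explored, hx]
    rw [this]; exact MeasurableSet.univ
  · have : {ω | explored ξ x n ω ≤ v} = count ξ v ⁻¹' {j | n ≤ j} := by
      ext ω; simp [explored, hx, le_count_iff h hv]
    rw [this]
    have hle : MeasurableSpace.comap (count ξ v) ⊤ ≤ natFiltration ξ v :=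
      le_iSup₂_of_le v ⟨hv, le_rfl⟩ le_rfl
    exact hle _ ⟨_, trivial, rfl⟩

lemma measurableSet_stopped_iff [MeasurableSpace Ω] {P : Measure Ω} {lam : ℝ} {ξ : ℕ → Ω → ℝ}
    (h : IsPoissonArrivals P lam ξ) (x : ℝ) (n : ℕ) (A : Set Ω) :
    MeasurableSet[stopped ξ x n] A ↔ ∀ v : ℝ, 0 ≤ v →
      MeasurableSet[natFiltration ξ v] (A ∩ {ω | explored ξ x n ω ≤ v}) := by
  constructor
  · intro hA
    induction A, hA using MeasurableSpace.generateFrom_induction with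
    | hC t ht _ => exact ht
    | empty => intro v _; simp
    | compl t _ ih =>
      intro v hv
      have : tᶜ ∩ {ω | explored ξ x n ω ≤ v}
          = {ω | explored ξ x n ω ≤ v} \ (t ∩ {ω | explored ξ x n ω ≤ v}) := by
        ext ω; simp only [mem_inter_iff, mem_compl_iff, mem_sdiff]; tauto
      rw [this]
      exact @MeasurableSet.diff _ (natFiltration ξ v) _ _ (measurableSet_explored_le h x n hv)
        (ih v hv)
    | iUnion s _ ih =>
      intro v hv
      rw [iUnion_inter]
      exact @MeasurableSet.iUnion _ _ (natFiltration ξ v) _ _ fun i => ih i v hv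
  · intro hA
    exact MeasurableSpace.measurableSet_generateFrom hA

/-- The consumption rate `c_t` built from the exploration dates `θ` and the rates `c n`
planned for the successive consumption episodes, for unexplored area `x`. -/
def consumption (ξ : ℕ → Ω → ℝ) (x : ℝ) (θ : ℕ → Ω → ℝ≥0∞) (c : ℕ → Ω → ℝ → ℝ≥0)
    (ω : Ω) (t : ℝ) : ℝ≥0 :=
  (if ENNReal.ofReal t < θ 0 ω then c 0 ω t else 0)
    + (∑ n ∈ Finset.Icc 1 (count ξ x ω),
        if θ (n - 1) ω ≤ ENNReal.ofReal t ∧ ENNReal.ofReal t < θ n ω then c n ω t else 0)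
    + (if θ (count ξ x ω) ω ≤ ENNReal.ofReal t then c (count ξ x ω + 1) ω t else 0)

/-- Admissible bang-bang strategies for the initial data `(x, R)`. The exploration dates may be
infinite (no exploration) and may coincide. -/
structure IsAdmissible [MeasurableSpace Ω] (P : Measure Ω) (ξ : ℕ → Ω → ℝ) (p : Params)
    (x R : ℝ) (θ : ℕ → Ω → ℝ≥0∞) (c : ℕ → Ω → ℝ → ℝ≥0) : Prop where
  mono : ∀ ω, Monotone fun n => θ n ω
  measurable_θ : ∀ n, Measurable[stopped ξ x n] (θ n)
  measurable_c : ∀ n,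
    Measurable[(stopped ξ x n).prod (borel ℝ)] (fun q : Ω × ℝ => c n q.1 q.2)
  budget : ∀ᵐ ω ∂P, ∀ t : ℝ, 0 ≤ t →
    ∫⁻ s in Ioc 0 t, (consumption ξ x θ c ω s : ℝ≥0∞) ≤
      ENNReal.ofReal (R + p.a * ∑ n ∈ Finset.range (count ξ x ω),
        if θ n ω ≤ ENNReal.ofReal t then (1 : ℝ) else 0)

/-- The discount factor `e^{-r t}`, equal to `0` at `t = ∞`. -/
def Params.discount (p : Params) (t : ℝ≥0∞) : ℝ :=
  if t = ∞ then 0 else Real.exp (-p.r * t.toReal)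

/-- The gain `E[∫₀^∞ e^{-rt} u(c_t) dt - k ∑_{n ≤ N_x} e^{-r θ_n} (X_{n+1} - X_n)]`. The cost is
between `0` and `k x`, so the expectation makes sense in `(-∞, ∞]`. -/
def gain [MeasurableSpace Ω] (P : Measure Ω) (ξ : ℕ → Ω → ℝ) (p : Params) (x : ℝ)
    (θ : ℕ → Ω → ℝ≥0∞) (c : ℕ → Ω → ℝ → ℝ≥0) : EReal :=
  ((∫⁻ ω, (∫⁻ t in Ioi (0 : ℝ),
      ENNReal.ofReal (Real.exp (-p.r * t) * p.u (consumption ξ x θ c ω t))) ∂P : ℝ≥0∞) : EReal)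
    - ((∫⁻ ω, ENNReal.ofReal (p.k * ∑ n ∈ Finset.range (count ξ x ω + 1),
        p.discount (θ n ω) * (explored ξ x (n + 1) ω - explored ξ x n ω)) ∂P : ℝ≥0∞) : EReal)

/-- The value function as an extended real number. -/
def valueE [MeasurableSpace Ω] (P : Measure Ω) (ξ : ℕ → Ω → ℝ) (p : Params) (x R : ℝ) : EReal :=
  ⨆ (θ : ℕ → Ω → ℝ≥0∞) (c : ℕ → Ω → ℝ → ℝ≥0) (_ : IsAdmissible P ξ p x R θ c), gain P ξ p x θ c

/-- The value function `V(x, R)`. -/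
def value [MeasurableSpace Ω] (P : Measure Ω) (ξ : ℕ → Ω → ℝ) (p : Params) (x R : ℝ) : ℝ :=
  (valueE P ξ p x R).toReal

/-- The exploration operator `M`. -/
def Params.M (p : Params) (W : ℝ → ℝ → ℝ) (x R : ℝ) : ℝ :=
  (∫ s in (0 : ℝ)..x, W (x - s) (R + p.a) * (p.lam * Real.exp (-p.lam * s)))
    + p.hotelling R * Real.exp (-p.lam * x)
    - p.k * ((1 - Real.exp (-p.lam * x)) / p.lam)

/-- `W` solves `max {u*(∂W/∂R) - r W, M W - W} = 0`, `W(0, R) = 𝒰 R`, on `[0, ∞) × [0, ∞)`.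
At `R > 0` the derivative is required to exist; at `R = 0`, where nothing can be consumed, the
function is continuous and `u*(∂W/∂R)` is read as `u*(+∞) = 0`. -/
structure SolvesHJB (p : Params) (W : ℝ → ℝ → ℝ) : Prop where
  continuousOn : ∀ x, 0 ≤ x → ContinuousOn (W x) (Ici 0)
  differentiableAt : ∀ x R, 0 ≤ x → 0 < R → DifferentiableAt ℝ (W x) R
  integrable : ∀ x R, 0 ≤ x → 0 ≤ R → IntervalIntegrable
    (fun s => W (x - s) (R + p.a) * (p.lam * Real.exp (-p.lam * s))) volume 0 x
  interior : ∀ x R, 0 ≤ x → 0 < R →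
    max (p.uStar (deriv (W x) R) - ((p.r * W x R : ℝ) : EReal))
      ((p.M W x R - W x R : ℝ) : EReal) = 0
  boundary : ∀ x, 0 ≤ x → max (0 - p.r * W x 0) (p.M W x 0 - W x 0) = 0
  initial : ∀ R, 0 ≤ R → W 0 R = p.hotelling R

end Exploration

end

noncomputable section

namespace Exploration

/-! Write 𝒰 for `p.hotelling`. The problem becomes tractable when values are measured by the certain
reserves of the same worth, through 𝒰⁻¹ = `p.certain`. Suppose that reserves R may be depleted down
to a chosen level R' before a reward G(R') is collected. The reward is worth as much as certain
reserves 𝒰⁻¹(G(R')), and, by Hotelling's rule, consuming R − R' and then owning certain reserves z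
yields at most 𝒰(R − R' + z) (`stage_le`). Equality holds for depletion at the proportional rate
r/(1 − α), stopped at the right date. Hence the optimal value is 𝒰(R + m(R)), where m is the running
maximum over R' ≤ R of the surplus 𝒰⁻¹(G(R')) − R'; this is `Params.stopValue`. As the reward of an
exploration is M V, the value function must satisfy V = stopValue (M V).

Fixed point. `stopValue` is nonexpansive for the uniform norm (`stopValue_le_add`) and M is a
Volterra operator in x, so successive iterates differ by a multiple of (λx)ⁿ/n!. They converge to
`limitValue`, and the same estimate gives uniqueness under the growth bound.

Regularity in R. The iterates stay in the class `Profile`: (𝒰')⁻¹(G'(R)) − R is nondecreasing, a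
quantitative form of concavity that 𝒰 satisfies with equality. Averaging preserves it because 𝒰'(Z)
↦ 𝒰'(Z + δ) is concave (`marginalM_add_le`), and so does `stopValue`. It makes the surplus rise and
then fall, whence smooth fit.

Regularity in x. For x > 0 the shape inequality of M V is strict, so the optimal exploration level
is unique and an envelope theorem applies (`hasDerivWithinAt_maxSurplus`). Near R = 0, where 𝒰' is
infinite, immediate exploration is optimal and V = M V is smooth in x; if k/λ = 𝒰(a), then V = 𝒰.
Monotonicity in x rests on `M_le_M`.

HJB equation. Since u*(q) = r 𝒰((𝒰')⁻¹(q)) for q > 0, the inequality u*(∂W/∂R) ≤ rW says that 𝒰⁻¹(W)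
− R is nondecreasing, and equality that it is stationary. So a solution has as surplus the running
maximum of the surplus of M W, which is the fixed point equation (`SolvesHJB.eq_stopValue`).

Control problem. On {ξ_n ≤ x} the information after n explorations is that of the first n spacings,
and the next spacing is an independent exponential variable, so the expected outcome of an
exploration is M (`lintegral_exploration`). Summing over episodes, the expected continuation values
telescope: any strategy gains at most `limitValue` (`gain_le`), and the strategy that depletes to
the first maximizer of the surplus gains exactly that (`gain_optimal`), the remainder being killed
by P(ξ_n ≤ x) ≤ (λx)ⁿ/n!. -/

/-- The standing assumptions on the parameters. -/
structure Params.Regular (p : Params) : Prop where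
  α_pos : 0 < p.α
  α_lt_one : p.α < 1
  r_pos : 0 < p.r
  lam_pos : 0 < p.lam
  k_pos : 0 < p.k
  a_pos : 0 < p.a
  cost_le : p.k / p.lam ≤ p.hotelling p.a

/-! ### The Hotelling problem: value, marginal value and conjugate utility -/

/-- The extraction rate per unit of reserves in the Hotelling problem. -/
def Params.rate (p : Params) : ℝ := p.r / (1 - p.α)

/-- Marginal value of reserves in the Hotelling problem. -/
def Params.marginal (p : Params) (R : ℝ) : ℝ := (p.rate * R) ^ (p.α - 1)

/-- Inverse function of `Params.hotelling`. -/
def Params.certain (p : Params) (w : ℝ) : ℝ := (w / p.hotelling 1) ^ (1 / p.α)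

/-- Inverse function of `Params.marginal`. -/
def Params.marginalInv (p : Params) (q : ℝ) : ℝ := q ^ (-(1 / (1 - p.α))) / p.rate

namespace Params.Regular

variable {p : Params}

lemma one_sub_pos (h : p.Regular) : 0 < 1 - p.α := by linarith [h.α_lt_one]

lemma rate_pos (h : p.Regular) : 0 < p.rate := div_pos h.r_pos h.one_sub_pos

lemma hotelling_one_pos (h : p.Regular) : 0 < p.hotelling 1 := by
  have := h.one_sub_pos; have := h.r_pos; have := h.α_pos
  unfold Params.hotelling; positivity

lemma hotelling_eq (R : ℝ) : p.hotelling R = p.hotelling 1 * R ^ p.α := by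
  unfold Params.hotelling; rw [Real.one_rpow]; ring

lemma hotelling_one_eq (h : p.Regular) : p.hotelling 1 = p.rate ^ (p.α - 1) / p.α := by
  unfold Params.hotelling Params.rate
  rw [Real.one_rpow, show (1 - p.α) / p.r = (p.r / (1 - p.α))⁻¹ by rw [inv_div],
    Real.inv_rpow (div_pos h.r_pos h.one_sub_pos).le, ← Real.rpow_neg
      (div_pos h.r_pos h.one_sub_pos).le, neg_sub]
  ring

lemma continuous_hotelling (h : p.Regular) : Continuous p.hotelling := by
  have : p.hotelling = fun R => p.hotelling 1 * R ^ p.α := funext hotelling_eq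
  rw [this]
  exact continuous_const.mul (Real.continuous_rpow_const h.α_pos.le)

lemma hotelling_zero (h : p.Regular) : p.hotelling 0 = 0 := by
  rw [hotelling_eq, Real.zero_rpow h.α_pos.ne', mul_zero]

lemma hotelling_nonneg (h : p.Regular) {R : ℝ} (hR : 0 ≤ R) : 0 ≤ p.hotelling R := by
  rw [hotelling_eq]; exact mul_nonneg h.hotelling_one_pos.le (Real.rpow_nonneg hR _)

lemma hotelling_pos (h : p.Regular) {R : ℝ} (hR : 0 < R) : 0 < p.hotelling R := by
  rw [hotelling_eq]; exact mul_pos h.hotelling_one_pos (Real.rpow_pos_of_pos hR _)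

lemma hotelling_strictMono (h : p.Regular) : StrictMonoOn p.hotelling (Ici 0) := by
  intro x hx y _ hxy
  rw [hotelling_eq x, hotelling_eq y]
  exact mul_lt_mul_of_pos_left (Real.rpow_lt_rpow hx hxy h.α_pos) h.hotelling_one_pos

lemma hotelling_mono (h : p.Regular) {x y : ℝ} (hx : 0 ≤ x) (hxy : x ≤ y) :
    p.hotelling x ≤ p.hotelling y :=
  h.hotelling_strictMono.monotoneOn hx (mem_Ici.2 (hx.trans hxy)) hxy

lemma hotelling_concave (h : p.Regular) : ConcaveOn ℝ (Ici 0) p.hotelling := by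
  have := (Real.concaveOn_rpow h.α_pos.le h.α_lt_one.le).smul h.hotelling_one_pos.le
  refine this.congr fun x _ => ?_
  rw [hotelling_eq x]; simp

lemma hotelling_mul {x y : ℝ} (hx : 0 ≤ x) (hy : 0 ≤ y) :
    p.hotelling (x * y) = x ^ p.α * p.hotelling y := by
  rw [hotelling_eq, hotelling_eq y, Real.mul_rpow hx hy]; ring

lemma hotelling_add_le (h : p.Regular) {x y : ℝ} (hx : 0 ≤ x) (hy : 0 ≤ y) :
    p.hotelling (x + y) ≤ p.hotelling x + p.hotelling y := by
  rw [hotelling_eq, hotelling_eq x, hotelling_eq y, ← mul_add]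
  exact mul_le_mul_of_nonneg_left
    (Real.rpow_add_le_add_rpow hx hy h.α_pos.le h.α_lt_one.le) h.hotelling_one_pos.le

lemma certain_nonneg (h : p.Regular) {w : ℝ} (hw : 0 ≤ w) : 0 ≤ p.certain w :=
  Real.rpow_nonneg (div_nonneg hw h.hotelling_one_pos.le) _

lemma certain_pos (h : p.Regular) {w : ℝ} (hw : 0 < w) : 0 < p.certain w :=
  Real.rpow_pos_of_pos (div_pos hw h.hotelling_one_pos) _

lemma certain_hotelling (h : p.Regular) {R : ℝ} (hR : 0 ≤ R) : p.certain (p.hotelling R) = R := by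
  unfold Params.certain
  rw [hotelling_eq, mul_div_cancel_left₀ _ h.hotelling_one_pos.ne', ← Real.rpow_mul hR,
    mul_one_div_cancel h.α_pos.ne', Real.rpow_one]

lemma hotelling_certain (h : p.Regular) {w : ℝ} (hw : 0 ≤ w) : p.hotelling (p.certain w) = w := by
  unfold Params.certain
  rw [hotelling_eq, ← Real.rpow_mul (div_nonneg hw h.hotelling_one_pos.le),
    one_div_mul_cancel h.α_pos.ne', Real.rpow_one, mul_div_cancel₀ _ h.hotelling_one_pos.ne']

lemma certain_mono (h : p.Regular) {v w : ℝ} (hv : 0 ≤ v) (hvw : v ≤ w) :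
    p.certain v ≤ p.certain w := by
  have := h.hotelling_one_pos; have := h.α_pos
  unfold Params.certain; gcongr

lemma continuous_certain (h : p.Regular) : Continuous p.certain := by
  have := h.α_pos
  unfold Params.certain
  exact (Real.continuous_rpow_const (by positivity)).comp (continuous_id.div_const _)

lemma marginal_pos (h : p.Regular) {R : ℝ} (hR : 0 < R) : 0 < p.marginal R :=
  Real.rpow_pos_of_pos (mul_pos h.rate_pos hR) _

lemma hasDerivAt_hotelling (h : p.Regular) {R : ℝ} (hR : 0 < R) :
    HasDerivAt p.hotelling (p.marginal R) R := by
  have : p.hotelling = fun R => p.hotelling 1 * R ^ p.α := funext hotelling_eq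
  rw [this]
  have hα := h.α_pos.ne'
  have e : p.marginal R = p.hotelling 1 * (p.α * R ^ (p.α - 1)) := by
    rw [h.hotelling_one_eq, Params.marginal, Real.mul_rpow h.rate_pos.le hR.le]
    field_simp
  rw [e]
  exact (Real.hasDerivAt_rpow_const (p := p.α) (Or.inl hR.ne')).const_mul (p.hotelling 1)

lemma marginal_strictAnti (h : p.Regular) : StrictAntiOn p.marginal (Ioi 0) := by
  intro x hx y _ hxy
  have hb := h.rate_pos
  exact Real.rpow_lt_rpow_of_neg (mul_pos hb hx) (by gcongr) (by linarith [h.α_lt_one])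

lemma marginal_anti (h : p.Regular) {x y : ℝ} (hx : 0 < x) (hxy : x ≤ y) :
    p.marginal y ≤ p.marginal x :=
  h.marginal_strictAnti.antitoneOn hx (mem_Ioi.2 (hx.trans_le hxy)) hxy

lemma continuousOn_marginal (h : p.Regular) : ContinuousOn p.marginal (Ioi 0) := by
  intro x hx
  have : p.rate * x ≠ 0 := (mul_pos h.rate_pos hx).ne'
  unfold Params.marginal
  exact ((continuousAt_const.mul continuousAt_id).rpow_const (Or.inl this)).continuousWithinAt

lemma marginalInv_pos (h : p.Regular) {q : ℝ} (hq : 0 < q) : 0 < p.marginalInv q :=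
  div_pos (Real.rpow_pos_of_pos hq _) h.rate_pos

lemma marginalInv_marginal (h : p.Regular) {R : ℝ} (hR : 0 < R) :
    p.marginalInv (p.marginal R) = R := by
  have h1 := h.one_sub_pos.ne'
  unfold Params.marginalInv Params.marginal
  rw [← Real.rpow_mul (mul_pos h.rate_pos hR).le,
    show (p.α - 1) * -(1 / (1 - p.α)) = 1 by field_simp; ring, Real.rpow_one,
    mul_div_cancel_left₀ _ h.rate_pos.ne']

lemma marginal_marginalInv (h : p.Regular) {q : ℝ} (hq : 0 < q) :
    p.marginal (p.marginalInv q) = q := by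
  have h1 := h.one_sub_pos.ne'
  unfold Params.marginalInv Params.marginal
  rw [mul_div_cancel₀ _ h.rate_pos.ne', ← Real.rpow_mul hq.le,
    show -(1 / (1 - p.α)) * (p.α - 1) = 1 by field_simp; ring, Real.rpow_one]

lemma marginalInv_strictAnti (h : p.Regular) : StrictAntiOn p.marginalInv (Ioi 0) := by
  intro x hx y _ hxy
  have hb := h.rate_pos
  have := h.one_sub_pos
  exact div_lt_div_of_pos_right
    (Real.rpow_lt_rpow_of_neg hx hxy (neg_neg_of_pos (by positivity))) hb

lemma marginalInv_anti (h : p.Regular) {x y : ℝ} (hx : 0 < x) (hxy : x ≤ y) :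
    p.marginalInv y ≤ p.marginalInv x :=
  h.marginalInv_strictAnti.antitoneOn hx (mem_Ioi.2 (hx.trans_le hxy)) hxy

lemma continuousOn_marginalInv : ContinuousOn p.marginalInv (Ioi 0) := by
  intro x hx
  unfold Params.marginalInv
  exact ((continuousAt_id.rpow_const (Or.inl (ne_of_gt hx))).div_const _).continuousWithinAt

/-- Tangent inequality for the map sending the marginal value of `Z` to that of `Z + δ`. -/
lemma marginal_add_lt (h : p.Regular) {Z Z₀ δ : ℝ} (hZ : 0 < Z) (hZ₀ : 0 < Z₀) (hδ : 0 < δ)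
    (hne : Z ≠ Z₀) :
    p.marginal (Z + δ) < p.marginal (Z₀ + δ)
      + (Z₀ / (Z₀ + δ)) ^ (2 - p.α) * (p.marginal Z - p.marginal Z₀) := by
  have hb := h.rate_pos
  -- This weight writes Z + δ as w (Z/w) + (1 - w)(Z₀ + δ). Convexity of the marginal value and its
  -- homogeneity of degree α - 1 then give the claim, the slope `w ^ (2 - α)` being the derivative
  -- of the map at `Z₀`.
  set w := Z₀ / (Z₀ + δ) with hw
  have hw0 : 0 < w := by positivity
  have hw1 : 0 < 1 - w := by
    rw [hw, one_sub_div (by positivity)]; ring_nf; positivity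
  have hconv : StrictConvexOn ℝ (Ioi 0) p.marginal := by
    have hderiv : ∀ x ∈ Ioi (0:ℝ), HasDerivAt p.marginal
        ((p.α - 1) * p.rate * (p.rate * x) ^ (p.α - 2)) x := by
      intro x hx
      have := ((hasDerivAt_id x).const_mul p.rate).rpow_const (p := p.α - 1)
        (Or.inl (mul_pos hb hx).ne')
      have e : (p.α - 1) * p.rate * (p.rate * x) ^ (p.α - 2)
          = p.rate * 1 * (p.α - 1) * (p.rate * id x) ^ (p.α - 1 - 1) := by
        simp only [id]; ring_nf
      rw [e]; exact this
    refine StrictMonoOn.strictConvexOn_of_deriv (convex_Ioi 0) h.continuousOn_marginal ?_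
    rw [interior_Ioi]
    intro x hx y hy hxy
    rw [(hderiv x hx).deriv, (hderiv y hy).deriv]
    have h1 : (p.rate * y) ^ (p.α - 2) < (p.rate * x) ^ (p.α - 2) :=
      Real.rpow_lt_rpow_of_neg (mul_pos hb hx) (by gcongr) (by linarith [h.α_lt_one])
    have h2 : (p.α - 1) * p.rate < 0 := mul_neg_of_neg_of_pos (by linarith [h.α_lt_one]) hb
    nlinarith
  have key := hconv.2 (x := Z / w) (y := Z₀ + δ) (mem_Ioi.2 (by positivity))
    (mem_Ioi.2 (by positivity)) (by
      intro heq
      apply hne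
      rw [div_eq_iff hw0.ne', hw, mul_div_cancel₀ _ (by positivity)] at heq
      exact heq) hw0 hw1 (by ring)
  simp only [smul_eq_mul] at key
  have e1 : w * (Z / w) + (1 - w) * (Z₀ + δ) = Z + δ := by
    rw [hw]; field_simp; ring
  rw [e1] at key
  have e2 : w * p.marginal (Z / w) = w ^ (2 - p.α) * p.marginal Z := by
    unfold Params.marginal
    rw [show p.rate * (Z / w) = w⁻¹ * (p.rate * Z) by field_simp,
      Real.mul_rpow (by positivity) (by positivity), Real.inv_rpow hw0.le, ← Real.rpow_neg hw0.le,
      ← mul_assoc]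
    congr 1
    nth_rewrite 1 [← Real.rpow_one w]
    rw [← Real.rpow_add hw0]; congr 1; ring
  have e3 : w ^ (2 - p.α) * p.marginal Z₀ = w * p.marginal (Z₀ + δ) := by
    unfold Params.marginal
    rw [show p.rate * Z₀ = w * (p.rate * (Z₀ + δ)) by rw [hw]; field_simp,
      Real.mul_rpow (by positivity) (by positivity), ← mul_assoc, ← Real.rpow_add hw0]
    rw [show 2 - p.α + (p.α - 1) = 1 by ring, Real.rpow_one]
  rw [mul_sub, e3, ← e2]
  linarith

lemma marginal_add_le (h : p.Regular) {Z Z₀ δ : ℝ} (hZ : 0 < Z) (hZ₀ : 0 < Z₀) (hδ : 0 < δ) :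
    p.marginal (Z + δ) ≤ p.marginal (Z₀ + δ)
      + (Z₀ / (Z₀ + δ)) ^ (2 - p.α) * (p.marginal Z - p.marginal Z₀) := by
  by_cases hne : Z = Z₀
  · subst hne; simp
  · exact (h.marginal_add_lt hZ hZ₀ hδ hne).le

/-- The tangent line of the Hotelling value lies above it. -/
lemma hotelling_le_tangent (h : p.Regular) {z S : ℝ} (hz : 0 ≤ z) (hS : 0 < S) :
    p.hotelling z ≤ p.hotelling S + p.marginal S * (z - S) := by
  have hd := h.hasDerivAt_hotelling hS
  rcases lt_trichotomy z S with hlt | heq | hgt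
  · have := h.hotelling_concave.le_slope_of_hasDerivAt (x := z) (y := S) hz hS.le hlt hd
    rw [slope_def_field, le_div_iff₀ (by linarith)] at this
    linarith
  · simp [heq]
  · have := h.hotelling_concave.slope_le_of_hasDerivAt (x := S) (y := z) hS.le hz hgt hd
    rw [slope_def_field, div_le_iff₀ (by linarith)] at this
    linarith

/-- Increments of the Hotelling value decrease. -/
lemma hotelling_increment (h : p.Regular) {x y z : ℝ} (hx : 0 ≤ x) (hxy : x ≤ y) (hz : 0 ≤ z) :
    p.hotelling (z + y) - p.hotelling (z + x) ≤ p.hotelling y - p.hotelling x := by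
  have hanti : AntitoneOn (fun s => p.hotelling (z + s) - p.hotelling s) (Ici 0) := by
    refine antitoneOn_of_deriv_nonpos (convex_Ici 0) ?_ ?_ ?_
    · exact ((h.continuous_hotelling.comp (continuous_const.add continuous_id)).sub
        h.continuous_hotelling).continuousOn
    · rw [interior_Ici]
      intro s hs
      have hs' : 0 < z + s := add_pos_of_nonneg_of_pos hz hs
      exact (((h.hasDerivAt_hotelling hs').comp_const_add z s).sub
        (h.hasDerivAt_hotelling hs)).differentiableAt.differentiableWithinAt
    · rw [interior_Ici]
      intro s hs
      have hs' : 0 < z + s := add_pos_of_nonneg_of_pos hz hs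
      have hd := ((h.hasDerivAt_hotelling hs').comp_const_add z s).sub
        (h.hasDerivAt_hotelling hs)
      have := hd.deriv
      simp only [Pi.sub_def] at this
      rw [this]
      linarith [h.marginal_anti hs (show s ≤ z + s by linarith)]
  have := hanti hx (mem_Ici.2 (hx.trans hxy)) hxy
  simp only at this
  linarith

/-- The conjugate utility at the marginal value of reserves `Z`. -/
lemma uStar_marginal (h : p.Regular) {Z : ℝ} (hZ : 0 < Z) :
    p.uStar (p.marginal Z) = ((p.r * p.hotelling Z : ℝ) : EReal) := by
  have hb := h.rate_pos
  have hα := h.α_pos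
  have hc : 0 < p.rate * Z := mul_pos hb hZ
  -- The supremum is attained at c = rate · Z, the consumption rate whose marginal utility is
  -- `p.marginal Z`.
  have hval : p.u (p.rate * Z) - p.rate * Z * p.marginal Z = p.r * p.hotelling Z := by
    have e : p.rate * Z * (p.rate * Z) ^ (p.α - 1) = (p.rate * Z) ^ p.α := by
      nth_rewrite 1 [← Real.rpow_one (p.rate * Z)]
      rw [← Real.rpow_add hc]; congr 1; ring
    have er : p.r = p.rate * (1 - p.α) := by
      unfold Params.rate; rw [div_mul_cancel₀ _ h.one_sub_pos.ne']
    have eb : p.rate ^ p.α = p.rate * p.rate ^ (p.α - 1) := by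
      nth_rewrite 2 [← Real.rpow_one p.rate]
      rw [← Real.rpow_add hb]; congr 1; ring
    unfold Params.u Params.marginal
    rw [e, hotelling_eq Z, h.hotelling_one_eq, Real.mul_rpow hb.le hZ.le, er, eb]
    field_simp
  unfold Params.uStar
  apply le_antisymm
  · refine iSup₂_le fun c hc0 => ?_
    rw [EReal.coe_le_coe_iff, ← hval]
    have hconc := Real.concaveOn_rpow hα.le h.α_lt_one.le
    have hd := Real.hasDerivAt_rpow_const (p := p.α) (Or.inl hc.ne')
    have hu : c ^ p.α ≤ (p.rate * Z) ^ p.α + p.α * (p.rate * Z) ^ (p.α - 1) * (c - p.rate * Z) := by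
      rcases lt_trichotomy c (p.rate * Z) with hlt | heq | hgt
      · have := hconc.le_slope_of_hasDerivAt (x := c) (y := p.rate * Z) hc0.le hc.le hlt hd
        rw [slope_def_field, le_div_iff₀ (by linarith)] at this
        linarith
      · simp [heq]
      · have := hconc.slope_le_of_hasDerivAt (x := p.rate * Z) (y := c) hc.le hc0.le hgt hd
        rw [slope_def_field, div_le_iff₀ (by linarith)] at this
        linarith
    unfold Params.u Params.marginal
    have : c ^ p.α / p.α ≤ (p.rate * Z) ^ p.α / p.α
        + (p.rate * Z) ^ (p.α - 1) * (c - p.rate * Z) := by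
      rw [div_le_iff₀ hα, add_mul, div_mul_cancel₀ _ hα.ne']
      linarith
    linarith
  · refine le_iSup₂_of_le (p.rate * Z) hc ?_
    rw [hval]

/-- The utility is unbounded, so free consumption has infinite value. This is what forces solutions
of the HJB equation to be strictly increasing in the reserves. -/
lemma uStar_of_nonpos (h : p.Regular) {q : ℝ} (hq : q ≤ 0) : p.uStar q = ⊤ := by
  rw [EReal.eq_top_iff_forall_lt]
  intro y
  have htend : Filter.Tendsto (fun c : ℝ => c ^ p.α / p.α) Filter.atTop Filter.atTop :=
    (tendsto_rpow_atTop h.α_pos).atTop_div_const h.α_pos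
  obtain ⟨c, hc1, hc0⟩ := ((htend.eventually_gt_atTop y).and
    (Filter.eventually_gt_atTop 0)).exists
  refine lt_of_lt_of_le ?_ (le_iSup₂_of_le (f := fun (c : ℝ) (_ : 0 < c) =>
    ((p.u c - c * q : ℝ) : EReal)) c hc0 le_rfl)
  rw [EReal.coe_lt_coe_iff]
  unfold Params.u
  nlinarith

end Params.Regular

/-! ### Optimal depletion before a reward -/

/-- Excess over `R` of the reserves which, without exploration, are worth `G R`. -/
def Params.surplus (p : Params) (G : ℝ → ℝ) (R : ℝ) : ℝ := p.certain (G R) - R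

/-- The running maximum of `Params.surplus` over `[0, R]`. -/
def Params.maxSurplus (p : Params) (G : ℝ → ℝ) (R : ℝ) : ℝ :=
  sSup ((fun t => p.surplus G (t * R)) '' Icc 0 1)

/-- The value of optimally depleting the reserves `R` before collecting the reward `G`. -/
def Params.stopValue (p : Params) (G : ℝ → ℝ) (R : ℝ) : ℝ := p.hotelling (R + p.maxSurplus G R)

namespace Params.Regular

variable {p : Params}

lemma continuous_surplus (h : p.Regular) {α : Type*} [TopologicalSpace α] {G : α → ℝ → ℝ}
    (hG : Continuous fun z : α × ℝ => G z.1 z.2) :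
    Continuous fun z : α × ℝ => p.surplus (G z.1) z.2 :=
  (h.continuous_certain.comp hG).sub continuous_snd

/-- Parametrizing `[0, R]` by the fraction `t ∈ [0, 1]` makes the compact set independent of the
parameters, so a supremum of a jointly continuous function over it is continuous. -/
lemma continuous_maxSurplus (h : p.Regular) {α : Type*} [TopologicalSpace α] {G : α → ℝ → ℝ}
    (hG : Continuous fun z : α × ℝ => G z.1 z.2) :
    Continuous fun z : α × ℝ => p.maxSurplus (G z.1) z.2 := by
  unfold Params.maxSurplus
  refine IsCompact.continuous_sSup (f := fun (z : α × ℝ) t => p.surplus (G z.1) (t * z.2))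
    isCompact_Icc ?_
  exact (h.continuous_surplus hG).comp
    ((continuous_fst.comp continuous_fst).prodMk
      (continuous_snd.mul (continuous_snd.comp continuous_fst)))

lemma continuous_stopValue (h : p.Regular) {α : Type*} [TopologicalSpace α] {G : α → ℝ → ℝ}
    (hG : Continuous fun z : α × ℝ => G z.1 z.2) :
    Continuous fun z : α × ℝ => p.stopValue (G z.1) z.2 :=
  h.continuous_hotelling.comp (continuous_snd.add (h.continuous_maxSurplus hG))

variable {G G₁ G₂ g : ℝ → ℝ} {R R' : ℝ}

lemma continuous_surplus_single (h : p.Regular) (hG : Continuous G) :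
    Continuous (p.surplus G) :=
  (h.continuous_certain.comp hG).sub continuous_id

lemma continuous_maxSurplus_single (h : p.Regular) (hG : Continuous G) :
    Continuous (p.maxSurplus G) :=
  (h.continuous_maxSurplus (α := Unit) (G := fun _ => G) (hG.comp continuous_snd)).comp
    (Continuous.prodMk_right ())

lemma surplus_le_maxSurplus (h : p.Regular) (hG : Continuous G) (h0 : 0 ≤ R') (h1 : R' ≤ R) :
    p.surplus G R' ≤ p.maxSurplus G R := by
  have hc : Continuous fun t => p.surplus G (t * R) :=
    (h.continuous_surplus_single hG).comp (continuous_id.mul continuous_const)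
  refine le_csSup (isCompact_Icc.image hc).bddAbove ?_
  rcases eq_or_lt_of_le (h0.trans h1) with hR | hR
  · exact ⟨0, by simp, by simp [le_antisymm (h1.trans hR.ge) h0]⟩
  · exact ⟨R' / R, ⟨by positivity, by rw [div_le_one hR]; exact h1⟩, by
      simp only; rw [div_mul_cancel₀ _ hR.ne']⟩

lemma exists_maxSurplus (h : p.Regular) (hG : Continuous G) (hR : 0 ≤ R) :
    ∃ R' ∈ Icc 0 R, p.maxSurplus G R = p.surplus G R' := by
  have hc : Continuous fun t => p.surplus G (t * R) :=
    (h.continuous_surplus_single hG).comp (continuous_id.mul continuous_const)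
  obtain ⟨t, ht, he⟩ := (isCompact_Icc (a := (0:ℝ)) (b := 1)).exists_sSup_image_eq
    ⟨0, by simp⟩ hc.continuousOn
  exact ⟨t * R, ⟨mul_nonneg ht.1 hR, mul_le_of_le_one_left hR ht.2⟩, he⟩

lemma maxSurplus_le (h : p.Regular) (hG : Continuous G) (hR : 0 ≤ R) {c : ℝ}
    (hc : ∀ R' ∈ Icc 0 R, p.surplus G R' ≤ c) : p.maxSurplus G R ≤ c := by
  obtain ⟨R', hR', he⟩ := h.exists_maxSurplus hG hR
  exact he ▸ hc R' hR'

lemma maxSurplus_mono (h : p.Regular) (hG : Continuous G) (h0 : 0 ≤ R') (h1 : R' ≤ R) :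
    p.maxSurplus G R' ≤ p.maxSurplus G R :=
  h.maxSurplus_le hG h0 fun _ hx => h.surplus_le_maxSurplus hG hx.1 (hx.2.trans h1)

lemma maxSurplus_nonneg (h : p.Regular) (hG : Continuous G) (hG0 : 0 ≤ G 0) (hR : 0 ≤ R) :
    0 ≤ p.maxSurplus G R := by
  refine le_trans ?_ (h.surplus_le_maxSurplus hG le_rfl hR)
  simpa [Params.surplus] using h.certain_nonneg hG0

lemma maxSurplus_zero (h : p.Regular) (hG : Continuous G) :
    p.maxSurplus G 0 = p.certain (G 0) := by
  obtain ⟨R', hR', he⟩ := h.exists_maxSurplus hG le_rfl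
  rw [he, le_antisymm hR'.2 hR'.1]; simp [Params.surplus]

lemma stopValue_eq_of_maxSurplus_eq (h : p.Regular) (hG : 0 ≤ G R)
    (he : p.maxSurplus G R = p.surplus G R) : p.stopValue G R = G R := by
  rw [Params.stopValue, he, Params.surplus, add_sub_cancel, h.hotelling_certain hG]

lemma stopValue_zero (h : p.Regular) (hG : Continuous G) (hG0 : 0 ≤ G 0) : p.stopValue G 0 = G 0 :=
  h.stopValue_eq_of_maxSurplus_eq hG0 (by rw [h.maxSurplus_zero hG]; simp [Params.surplus])

lemma add_surplus_nonneg (h : p.Regular) (hG : 0 ≤ G R') : 0 ≤ R' + p.surplus G R' := by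
  rw [Params.surplus, add_sub_cancel]; exact h.certain_nonneg hG

lemma le_stopValue (h : p.Regular) (hGc : Continuous G) (hG : 0 ≤ G R) (hR : 0 ≤ R) :
    G R ≤ p.stopValue G R := by
  have h1 : G R = p.hotelling (R + p.surplus G R) := by
    rw [Params.surplus, add_sub_cancel, h.hotelling_certain hG]
  rw [h1]
  exact h.hotelling_mono (h.add_surplus_nonneg hG)
    (by linarith [h.surplus_le_maxSurplus hGc hR le_rfl])

lemma hotelling_le_stopValue (h : p.Regular) (hGc : Continuous G) (hG0 : 0 ≤ G 0) (hR : 0 ≤ R) :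
    p.hotelling R ≤ p.stopValue G R :=
  h.hotelling_mono hR (by linarith [h.maxSurplus_nonneg hGc hG0 hR])

/-- `Params.stopValue` is a contraction in the uniform norm over `[0, R]`. -/
lemma stopValue_le_add (h : p.Regular) (hG₁ : Continuous G₁) (hG₂ : Continuous G₂)
    (h₁ : ∀ R' ∈ Icc 0 R, 0 ≤ G₁ R') (h₂ : ∀ R' ∈ Icc 0 R, 0 ≤ G₂ R') (hR : 0 ≤ R) {ε : ℝ}
    (hε : 0 ≤ ε) (hle : ∀ R' ∈ Icc 0 R, G₁ R' ≤ G₂ R' + ε) : p.stopValue G₁ R ≤ p.stopValue G₂ R + ε := by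
  obtain ⟨R', hR', he⟩ := h.exists_maxSurplus hG₁ hR
  have e1 : p.stopValue G₁ R = p.hotelling ((R - R') + p.certain (G₁ R')) := by
    rw [Params.stopValue, he, Params.surplus]; ring_nf
  have e2 : p.hotelling ((R - R') + p.certain (G₂ R')) ≤ p.stopValue G₂ R := by
    refine h.hotelling_mono (add_nonneg (by linarith [hR'.2]) (h.certain_nonneg (h₂ R' hR'))) ?_
    have := h.surplus_le_maxSurplus hG₂ hR'.1 hR'.2
    simp only [Params.surplus] at this
    linarith
  rw [e1]
  rcases le_total (G₁ R') (G₂ R') with hle' | hle'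
  · have := h.hotelling_mono (add_nonneg (by linarith [hR'.2] : 0 ≤ R - R')
      (h.certain_nonneg (h₁ R' hR')))
      (by linarith [h.certain_mono (h₁ R' hR') hle'] :
        (R - R') + p.certain (G₁ R') ≤ (R - R') + p.certain (G₂ R'))
    linarith
  -- By concavity, adding the consumed reserves `R - R'` to both certain equivalents can only shrink
  -- the difference of their Hotelling values, which is `G₁ R' - G₂ R'`.
  · have := h.hotelling_increment (z := R - R') (h.certain_nonneg (h₂ R' hR'))
      (h.certain_mono (h₂ R' hR') hle') (by linarith [hR'.2])
    rw [h.hotelling_certain (h₁ R' hR'), h.hotelling_certain (h₂ R' hR')] at this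
    linarith [hle R' hR']

lemma maxSurplus_hotelling (h : p.Regular) (hR : 0 ≤ R) : p.maxSurplus p.hotelling R = 0 := by
  obtain ⟨R', hR', he⟩ := h.exists_maxSurplus h.continuous_hotelling hR
  rw [he, Params.surplus, h.certain_hotelling hR'.1, sub_self]

lemma stopValue_hotelling (h : p.Regular) (hR : 0 ≤ R) : p.stopValue p.hotelling R = p.hotelling R := by
  rw [Params.stopValue, h.maxSurplus_hotelling hR, add_zero]

lemma hasDerivAt_certain (h : p.Regular) {w : ℝ} (hw : 0 < w) :
    HasDerivAt p.certain (p.marginal (p.certain w))⁻¹ w := by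
  refine HasDerivAt.of_local_left_inverse h.continuous_certain.continuousAt
    (h.hasDerivAt_hotelling (h.certain_pos hw)) (h.marginal_pos (h.certain_pos hw)).ne' ?_
  filter_upwards [lt_mem_nhds hw] with y hy using h.hotelling_certain (le_of_lt hy)

end Params.Regular

/-! ### Profiles: the shape condition and smooth fit -/

/-- A value profile `G` with marginal value `g` which, in terms of the equivalent Hotelling
reserves, decreases at least as fast as the marginal Hotelling value. -/
structure Profile (p : Params) (G g : ℝ → ℝ) : Prop where
  continuous : Continuous G
  nonneg : ∀ R, 0 ≤ R → 0 ≤ G R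
  hasDerivAt : ∀ R, 0 < R → HasDerivAt G (g R) R
  deriv_pos : ∀ R, 0 < R → 0 < g R
  continuousOn_deriv : ContinuousOn g (Ioi 0)
  shape : ∀ R₁ R₂, 0 < R₁ → R₁ < R₂ → p.marginalInv (g R₁) + (R₂ - R₁) ≤ p.marginalInv (g R₂)

namespace Profile

variable {p : Params} {G g : ℝ → ℝ} {R R₁ R₂ : ℝ}

lemma pos (hG : Profile p G g) (hR : 0 < R) : 0 < G R := by
  have : StrictMonoOn G (Ici 0) := by
    refine strictMonoOn_of_deriv_pos (convex_Ici 0) hG.continuous.continuousOn ?_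
    rw [interior_Ici]
    intro x hx
    rw [(hG.hasDerivAt x hx).deriv]
    exact hG.deriv_pos x hx
  exact (hG.nonneg 0 le_rfl).trans_lt (this (by simp) hR.le hR)

/-- Let `R₁ → 0` in `shape`, where the certain reserves attached to `g R₁` are positive. Marginal
values of profiles are thus dominated by the Hotelling one, which supplies all later bounds. -/
lemma le_marginalInv (h : p.Regular) (hG : Profile p G g) (hR : 0 < R) :
    R ≤ p.marginalInv (g R) := by
  refine le_of_forall_pos_lt_add fun ε hε => ?_
  have hm : 0 < min ε (R / 2) := by positivity
  have hlt : min ε (R / 2) < R := (min_le_right _ _).trans_lt (by linarith)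
  have := hG.shape _ _ hm hlt
  have := h.marginalInv_pos (hG.deriv_pos _ hm)
  linarith [min_le_left ε (R / 2)]

lemma deriv_le_marginal (h : p.Regular) (hG : Profile p G g) (hR : 0 < R) :
    g R ≤ p.marginal R := by
  rw [← h.marginal_marginalInv (hG.deriv_pos R hR)]
  exact h.marginal_anti hR (hG.le_marginalInv h hR)

lemma deriv_anti (h : p.Regular) (hG : Profile p G g) (h0 : 0 < R₁) (h1 : R₁ ≤ R₂) :
    g R₂ ≤ g R₁ := by
  rcases eq_or_lt_of_le h1 with rfl | h1
  · exact le_rfl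
  rw [← h.marginal_marginalInv (hG.deriv_pos R₁ h0),
    ← h.marginal_marginalInv (hG.deriv_pos R₂ (h0.trans h1))]
  exact h.marginal_anti (h.marginalInv_pos (hG.deriv_pos R₁ h0))
    (by linarith [hG.shape R₁ R₂ h0 h1])

/-- Growth of a profile compared with the Hotelling value. -/
lemma sub_le (h : p.Regular) (hG : Profile p G g) (h0 : 0 < R₁) (h1 : R₁ ≤ R₂) :
    G R₂ - G R₁ ≤ p.hotelling (p.marginalInv (g R₁) + (R₂ - R₁))
      - p.hotelling (p.marginalInv (g R₁)) := by
  set Z := p.marginalInv (g R₁) with hZ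
  have hZ0 : 0 < Z := h.marginalInv_pos (hG.deriv_pos R₁ h0)
  -- By `shape`, g x is at most the marginal value of `Z + (x - R₁)` for x beyond `R₁`, so this
  -- difference has a nonnegative derivative.
  have hmono : MonotoneOn (fun R => p.hotelling (Z + (R - R₁)) - G R) (Ici R₁) := by
    refine monotoneOn_of_deriv_nonneg (convex_Ici R₁) ?_ ?_ ?_
    · exact ((h.continuous_hotelling.comp (by fun_prop)).sub hG.continuous).continuousOn
    all_goals
      rw [interior_Ici]
      intro x hx
      have hx' : R₁ < x := hx
      have hd : HasDerivAt (fun R => p.hotelling (Z + (R - R₁)) - G R)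
          (p.marginal (Z + (x - R₁)) - g x) x := by
        have h1 := (h.hasDerivAt_hotelling (R := Z + (x - R₁)) (by linarith))
        have h2 : HasDerivAt (fun R => Z + (R - R₁)) 1 x :=
          ((hasDerivAt_id x).sub_const R₁).const_add Z
        have := (h1.comp x h2).sub (hG.hasDerivAt x (h0.trans hx'))
        simpa using! this
    · exact hd.differentiableAt.differentiableWithinAt
    · rw [hd.deriv]
      have := hG.deriv_pos x (h0.trans hx')
      rw [← h.marginal_marginalInv this]
      linarith [h.marginal_anti (by linarith : 0 < Z + (x - R₁)) (hG.shape R₁ x h0 hx')]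
  have := hmono (mem_Ici.2 le_rfl) (mem_Ici.2 h1) h1
  simp only [sub_self, add_zero] at this
  linarith

lemma certain_le (h : p.Regular) (hG : Profile p G g) (h0 : 0 < R₁) (h1 : R₁ ≤ R₂)
    (hle : p.certain (G R₁) ≤ p.marginalInv (g R₁)) :
    p.certain (G R₂) ≤ p.marginalInv (g R₁) + (R₂ - R₁) := by
  have hZ0 : 0 < p.marginalInv (g R₁) := h.marginalInv_pos (hG.deriv_pos R₁ h0)
  have h2 := h.hotelling_mono (h.certain_nonneg (hG.nonneg R₁ h0.le)) hle
  rw [h.hotelling_certain (hG.nonneg R₁ h0.le)] at h2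
  have h3 := hG.sub_le h h0 h1
  have h4 := h.certain_mono (hG.nonneg R₂ (h0.le.trans h1)) (by linarith :
    G R₂ ≤ p.hotelling (p.marginalInv (g R₁) + (R₂ - R₁)))
  rwa [h.certain_hotelling (by linarith)] at h4

/-- Single crossing: the sign of `marginalInv (g R) - certain (G R)` is opposite to that of the
derivative of the surplus. Beyond a point where it is positive, the left term grows at least as fast
as R by `shape`, while `sub_le` keeps the certain equivalent below. So the surplus rises before it
falls. -/
lemma certain_lt (h : p.Regular) (hG : Profile p G g) (h0 : 0 < R₁) (h1 : R₁ ≤ R₂)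
    (hlt : p.certain (G R₁) < p.marginalInv (g R₁)) :
    p.certain (G R₂) < p.marginalInv (g R₂) := by
  rcases eq_or_lt_of_le h1 with rfl | h1'
  · exact hlt
  refine lt_of_lt_of_le ?_ (hG.shape R₁ R₂ h0 h1')
  have hZ0 : 0 < p.marginalInv (g R₁) := h.marginalInv_pos (hG.deriv_pos R₁ h0)
  have h2 := h.hotelling_strictMono (h.certain_nonneg (hG.nonneg R₁ h0.le)) hZ0.le hlt
  rw [h.hotelling_certain (hG.nonneg R₁ h0.le)] at h2
  have h3 := hG.sub_le h h0 h1
  have hR2 := hG.nonneg R₂ (h0.le.trans h1)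
  by_contra! hcon
  have h4 := h.hotelling_mono (by linarith) hcon
  rw [h.hotelling_certain hR2] at h4
  linarith

lemma hasDerivAt_surplus (h : p.Regular) (hG : Profile p G g) (hR : 0 < R) :
    HasDerivAt (p.surplus G) ((p.marginal (p.certain (G R)))⁻¹ * g R - 1) R :=
  ((h.hasDerivAt_certain (hG.pos hR)).comp R (hG.hasDerivAt R hR)).sub (hasDerivAt_id R)

lemma surplus_deriv_nonneg_iff (h : p.Regular) (hG : Profile p G g) (hR : 0 < R) :
    0 ≤ (p.marginal (p.certain (G R)))⁻¹ * g R - 1 ↔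
      p.marginalInv (g R) ≤ p.certain (G R) := by
  have hS := h.certain_pos (hG.pos hR)
  have hm := h.marginal_pos hS
  rw [sub_nonneg, le_inv_mul_iff₀ hm, mul_one]
  constructor
  · intro hle
    have := h.marginalInv_anti hm hle
    rwa [h.marginalInv_marginal hS] at this
  · intro hle
    have := h.marginal_anti (h.marginalInv_pos (hG.deriv_pos R hR)) hle
    rwa [h.marginal_marginalInv (hG.deriv_pos R hR)] at this

lemma surplus_monotoneOn (h : p.Regular) (hG : Profile p G g)
    (hle : p.marginalInv (g R) ≤ p.certain (G R)) : MonotoneOn (p.surplus G) (Icc 0 R) := by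
  refine monotoneOn_of_deriv_nonneg (convex_Icc 0 R)
    (h.continuous_surplus_single hG.continuous).continuousOn ?_ ?_
  all_goals
    rw [interior_Icc]
    intro x hx
  · exact (hG.hasDerivAt_surplus h hx.1).differentiableAt.differentiableWithinAt
  · rw [(hG.hasDerivAt_surplus h hx.1).deriv, hG.surplus_deriv_nonneg_iff h hx.1]
    by_contra! hcon
    exact absurd (hG.certain_lt h hx.1 hx.2.le hcon) (not_lt.2 hle)

lemma surplus_antitoneOn (h : p.Regular) (hG : Profile p G g) (hR : 0 < R)
    (hle : p.certain (G R) ≤ p.marginalInv (g R)) : AntitoneOn (p.surplus G) (Ici R) := by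
  refine antitoneOn_of_deriv_nonpos (convex_Ici R)
    (h.continuous_surplus_single hG.continuous).continuousOn ?_ ?_
  all_goals
    rw [interior_Ici]
    intro x hx
    have hx' : R < x := hx
    have hx0 := hR.trans hx'
  · exact (hG.hasDerivAt_surplus h hx0).differentiableAt.differentiableWithinAt
  · rw [(hG.hasDerivAt_surplus h hx0).deriv]
    have h1 : p.certain (G x) ≤ p.marginalInv (g x) :=
      (hG.certain_le h hR hx'.le hle).trans (hG.shape R x hR hx')
    have hS := h.certain_pos (hG.pos hx0)
    have hm := h.marginal_pos hS
    rw [sub_nonpos, inv_mul_le_iff₀ hm, mul_one, ← h.marginal_marginalInv (hG.deriv_pos x hx0)]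
    exact h.marginal_anti hS h1

lemma maxSurplus_eq_of_le (h : p.Regular) (hG : Profile p G g) (hR : 0 < R)
    (hle : p.marginalInv (g R) ≤ p.certain (G R)) : p.maxSurplus G R = p.surplus G R := by
  refine le_antisymm (h.maxSurplus_le hG.continuous hR.le fun x hx =>
    hG.surplus_monotoneOn h hle hx ⟨hR.le, le_rfl⟩ hx.2)
    (h.surplus_le_maxSurplus hG.continuous hR.le le_rfl)

lemma stopValue_eq_of_le (h : p.Regular) (hG : Profile p G g) (hR : 0 < R)
    (hle : p.marginalInv (g R) ≤ p.certain (G R)) : p.stopValue G R = G R :=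
  h.stopValue_eq_of_maxSurplus_eq (hG.nonneg R hR.le) (hG.maxSurplus_eq_of_le h hR hle)

lemma maxSurplus_eq_of_ge (h : p.Regular) (hG : Profile p G g) (h0 : 0 < R₁) (h1 : R₁ ≤ R₂)
    (hle : p.certain (G R₁) ≤ p.marginalInv (g R₁)) :
    p.maxSurplus G R₂ = p.maxSurplus G R₁ := by
  refine le_antisymm (h.maxSurplus_le hG.continuous (h0.le.trans h1) fun x hx => ?_)
    (h.maxSurplus_mono hG.continuous h0.le h1)
  rcases le_total x R₁ with hx1 | hx1
  · exact h.surplus_le_maxSurplus hG.continuous hx.1 hx1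
  · exact (hG.surplus_antitoneOn h h0 hle (mem_Ici.2 le_rfl) hx1 hx1).trans
      (h.surplus_le_maxSurplus hG.continuous h0.le le_rfl)

lemma continuousOn_gap (h : p.Regular) (hG : Profile p G g) :
    ContinuousOn (fun R => p.marginalInv (g R) - p.certain (G R)) (Ioi 0) :=
  (Params.Regular.continuousOn_marginalInv.comp hG.continuousOn_deriv
    fun x hx => hG.deriv_pos x hx).sub (h.continuous_certain.comp hG.continuous).continuousOn

/-- Where waiting is preferable, this says that the marginal value of waiting is at least g R.
Points past the crossing satisfy the bound by `shape`. A point before the crossing has a smaller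
surplus than the crossing itself, which lies in `[x, R]` by the intermediate value theorem. The
point 0 is reached by closure. -/
lemma add_maxSurplus_le (h : p.Regular) (hG : Profile p G g) (hR : 0 < R)
    (hle : p.certain (G R) ≤ p.marginalInv (g R)) :
    R + p.maxSurplus G R ≤ p.marginalInv (g R) := by
  have key : ∀ x ∈ Ioc 0 R, p.surplus G x ≤ p.marginalInv (g R) - R := by
    intro x hx
    have base : ∀ y ∈ Ioc 0 R, p.certain (G y) ≤ p.marginalInv (g y) →
        p.surplus G y ≤ p.marginalInv (g R) - R := by
      intro y hy hy'
      unfold Params.surplus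
      rcases eq_or_lt_of_le hy.2 with rfl | hlt
      · linarith
      · linarith [hG.shape y R hy.1 hlt]
    rcases le_total (p.certain (G x)) (p.marginalInv (g x)) with hx' | hx'
    · exact base x hx hx'
    · have hsub : Icc x R ⊆ Ioi 0 := fun y hy => hx.1.trans_le hy.1
      obtain ⟨y, hy, hy0⟩ := intermediate_value_Icc hx.2 ((hG.continuousOn_gap h).mono hsub)
        (show (0:ℝ) ∈ Icc _ _ from ⟨by linarith, by linarith⟩)
      simp only at hy0
      refine le_trans ?_ (base y ⟨hx.1.trans_le hy.1, hy.2⟩ (by linarith))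
      exact hG.surplus_monotoneOn h (by linarith) ⟨hx.1.le, hy.1⟩
        ⟨(hx.1.trans_le hy.1).le, le_rfl⟩ hy.1
  have hcl : ∀ x ∈ Icc 0 R, p.surplus G x ≤ p.marginalInv (g R) - R := by
    intro x hx
    have : x ∈ closure (Ioc 0 R) := by rw [closure_Ioc hR.ne]; exact hx
    exact closure_minimal (t := {x | p.surplus G x ≤ p.marginalInv (g R) - R}) key
      (isClosed_le (h.continuous_surplus_single hG.continuous) continuous_const) this
  linarith [h.maxSurplus_le hG.continuous hR.le hcl]

/-- Smooth fit. -/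
lemma hasDerivAt_stopValue (h : p.Regular) (hG : Profile p G g) (hR : 0 < R) :
    HasDerivAt (p.stopValue G) (max (g R) (p.marginal (R + p.maxSurplus G R))) R := by
  have hm0 : 0 ≤ p.maxSurplus G R :=
    h.maxSurplus_nonneg hG.continuous (hG.nonneg 0 le_rfl) hR.le
  have hRm : 0 < R + p.maxSurplus G R := by linarith
  have hgR := hG.deriv_pos R hR
  have hnhds : Ioi (0:ℝ) ∈ nhds R := Ioi_mem_nhds hR
  have hgap := ((hG.continuousOn_gap h).continuousAt hnhds)
  have chain : HasDerivAt (p.maxSurplus G) 0 R →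
      HasDerivAt (p.stopValue G) (p.marginal (R + p.maxSurplus G R)) R := by
    intro hd
    have := (h.hasDerivAt_hotelling hRm).comp R ((hasDerivAt_id R).add hd)
    simpa using! this
  rcases lt_trichotomy (p.certain (G R)) (p.marginalInv (g R)) with hlt | heq | hgt
  -- The surplus is already falling slightly before R, so its running maximum is constant near R.
  · have hle : g R ≤ p.marginal (R + p.maxSurplus G R) := by
      rw [← h.marginal_marginalInv hgR]
      exact h.marginal_anti hRm (hG.add_maxSurplus_le h hR hlt.le)
    rw [max_eq_right hle]
    apply chain
    have hev : ∀ᶠ x in nhds R, 0 < p.marginalInv (g x) - p.certain (G x) :=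
      hgap.eventually (lt_mem_nhds (by simpa using hlt))
    obtain ⟨l, u, hlu, hsub⟩ := (mem_nhds_iff_exists_Ioo_subset.1 (Filter.inter_mem hnhds hev))
    obtain ⟨R₀, hR₀⟩ := exists_between hlu.1
    have hmem := hsub ⟨hR₀.1, hR₀.2.trans hlu.2⟩
    have hle0 : p.certain (G R₀) ≤ p.marginalInv (g R₀) := by
      have := hmem.2; simp only [mem_ofPred_eq] at this; linarith
    refine (hasDerivAt_const R (p.maxSurplus G R₀)).congr_of_eventuallyEq ?_
    filter_upwards [lt_mem_nhds hR₀.2] with x hx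
    exact hG.maxSurplus_eq_of_ge h hmem.1 (le_of_lt hx) hle0
  -- At the crossing the running maximum is the surplus on the left, whose derivative vanishes here,
  -- and a constant on the right. Both expressions for the marginal value agree.
  · have hms := hG.maxSurplus_eq_of_le h hR heq.ge
    have hz : g R = p.marginal (R + p.maxSurplus G R) := by
      rw [hms, Params.surplus, add_sub_cancel, heq, h.marginal_marginalInv hgR]
    rw [← hz, max_self, hz]
    apply chain
    have hd0 : (p.marginal (p.certain (G R)))⁻¹ * g R - 1 = 0 := by
      rw [heq, h.marginal_marginalInv hgR, inv_mul_cancel₀ hgR.ne', sub_self]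
    have hds := hG.hasDerivAt_surplus h hR
    rw [hd0] at hds
    have hleft : HasDerivWithinAt (p.maxSurplus G) 0 (Iic R) R := by
      refine hds.hasDerivWithinAt.congr_of_eventuallyEq ?_ hms
      filter_upwards [self_mem_nhdsWithin, mem_nhdsWithin_of_mem_nhds hnhds] with x hx hx0
      refine hG.maxSurplus_eq_of_le h hx0 ?_
      by_contra! hcon
      exact absurd (hG.certain_lt h hx0 hx hcon) heq.not_lt
    have hright : HasDerivWithinAt (p.maxSurplus G) 0 (Ici R) R := by
      refine (hasDerivWithinAt_const R (Ici R) (p.maxSurplus G R)).congr ?_ rfl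
      intro x hx
      exact hG.maxSurplus_eq_of_ge h hR hx heq.le
    have := hleft.union hright
    rwa [Iic_union_Ici, hasDerivWithinAt_univ] at this
  -- The surplus is still rising near R, so it is its own running maximum and stopping at once is
  -- optimal.
  · have hms := hG.maxSurplus_eq_of_le h hR hgt.le
    have hle : p.marginal (R + p.maxSurplus G R) ≤ g R := by
      rw [hms, Params.surplus, add_sub_cancel]
      have := h.marginal_anti (h.marginalInv_pos hgR) hgt.le
      rwa [h.marginal_marginalInv hgR] at this
    rw [max_eq_left hle]
    refine (hG.hasDerivAt R hR).congr_of_eventuallyEq ?_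
    have hev : ∀ᶠ x in nhds R, p.marginalInv (g x) - p.certain (G x) < 0 :=
      hgap.eventually (gt_mem_nhds (by simpa using hgt))
    filter_upwards [hev, hnhds] with x hx hx0
    exact hG.stopValue_eq_of_le h hx0 (by linarith)

/-- `marginalInv` is decreasing and turns the maximum of the marginal values into a minimum. Minus
R, both terms of that minimum are nondecreasing: the first by `shape`, the second because it is the
running maximum. -/
lemma stopValue (h : p.Regular) (hG : Profile p G g) :
    Profile p (p.stopValue G) fun R => max (g R) (p.marginal (R + p.maxSurplus G R)) where
  continuous := (h.continuous_stopValue (α := Unit) (G := fun _ => G)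
    (hG.continuous.comp continuous_snd)).comp (Continuous.prodMk_right ())
  nonneg R hR := (hG.nonneg R hR).trans (h.le_stopValue hG.continuous (hG.nonneg R hR) hR)
  hasDerivAt R hR := hG.hasDerivAt_stopValue h hR
  deriv_pos R hR := lt_max_of_lt_left (hG.deriv_pos R hR)
  continuousOn_deriv := by
    refine ContinuousOn.sup hG.continuousOn_deriv (h.continuousOn_marginal.comp
      (continuous_id.add (h.continuous_maxSurplus_single hG.continuous)).continuousOn ?_)
    intro x hx
    exact add_pos_of_pos_of_nonneg hx
      (h.maxSurplus_nonneg hG.continuous (hG.nonneg 0 le_rfl) (le_of_lt hx))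
  shape R₁ R₂ h0 h1 := by
    have hm : ∀ R, 0 < R → 0 < R + p.maxSurplus G R := fun R hR =>
      add_pos_of_pos_of_nonneg hR
        (h.maxSurplus_nonneg hG.continuous (hG.nonneg 0 le_rfl) hR.le)
    have hinv : ∀ R, 0 < R → p.marginalInv (max (g R) (p.marginal (R + p.maxSurplus G R)))
        = min (p.marginalInv (g R)) (R + p.maxSurplus G R) := by
      intro R hR
      have hg := hG.deriv_pos R hR
      have hmm := h.marginal_pos (hm R hR)
      have := h.marginalInv_strictAnti.antitoneOn.map_max (a := g R)
        (b := p.marginal (R + p.maxSurplus G R)) hg hmm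
      rw [this, h.marginalInv_marginal (hm R hR)]
    rw [hinv R₁ h0, hinv R₂ (h0.trans h1)]
    refine le_min ?_ ?_
    · exact (add_le_add_left (min_le_left _ _) _).trans (hG.shape R₁ R₂ h0 h1)
    · have := min_le_right (p.marginalInv (g R₁)) (R₁ + p.maxSurplus G R₁)
      linarith [h.maxSurplus_mono hG.continuous h0.le h1.le]

end Profile

/-! ### The exploration operator -/

/-- Average of the reward `W` at the next discovery, if it occurs within the area `x`. -/
def Params.discovery (p : Params) (W : ℝ → ℝ → ℝ) (x R : ℝ) : ℝ :=
  ∫ s in (0 : ℝ)..x, W (x - s) (R + p.a) * (p.lam * Real.exp (-p.lam * s))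

/-- Marginal value of reserves under the exploration operator, where `q` is the marginal value of
reserves after the discovery. -/
def Params.marginalM (p : Params) (q : ℝ → ℝ → ℝ) (x R : ℝ) : ℝ :=
  p.discovery q x R + p.marginal R * Real.exp (-p.lam * x)

namespace Params.Regular

variable {p : Params}

lemma M_eq_discovery (W : ℝ → ℝ → ℝ) (x R : ℝ) :
    p.M W x R = p.discovery W x R + p.hotelling R * Real.exp (-p.lam * x)
      - p.k * ((1 - Real.exp (-p.lam * x)) / p.lam) := rfl

lemma integral_density (x : ℝ) :
    ∫ s in (0 : ℝ)..x, p.lam * Real.exp (-p.lam * s) = 1 - Real.exp (-p.lam * x) := by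
  have hd : ∀ s ∈ uIcc 0 x, HasDerivAt (fun s => -Real.exp (-p.lam * s))
      (p.lam * Real.exp (-p.lam * s)) s := by
    intro s _
    have := ((hasDerivAt_id s).const_mul (-p.lam)).exp.neg
    refine this.congr_deriv ?_
    simp only [id]; ring
  rw [intervalIntegral.integral_eq_sub_of_hasDerivAt hd
    (by apply Continuous.intervalIntegrable; fun_prop)]
  simp; ring

lemma exp_le_one (h : p.Regular) {x : ℝ} (hx : 0 ≤ x) : Real.exp (-p.lam * x) ≤ 1 := by
  rw [Real.exp_le_one_iff]; nlinarith [h.lam_pos]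

/-- Iterating the discovery operator gains a factorial. -/
lemma abs_integral_density_le (h : p.Regular) {x C : ℝ} (hx : 0 ≤ x) (n : ℕ) {f : ℝ → ℝ}
    (hf : ∀ s ∈ Ioc 0 x, |f s| ≤ C * ((p.lam * (x - s)) ^ n / n.factorial)) :
    |∫ s in (0 : ℝ)..x, f s * (p.lam * Real.exp (-p.lam * s))|
      ≤ C * ((p.lam * x) ^ (n + 1) / (n + 1).factorial) := by
  have hl := h.lam_pos
  have hint : ∫ s in (0 : ℝ)..x, C * ((p.lam * (x - s)) ^ n / n.factorial) * p.lam
      = C * ((p.lam * x) ^ (n + 1) / (n + 1).factorial) := by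
    have hd : ∀ s ∈ uIcc 0 x, HasDerivAt
        (fun s => -(C * ((p.lam * (x - s)) ^ (n + 1) / (n + 1).factorial)))
        (C * ((p.lam * (x - s)) ^ n / n.factorial) * p.lam) s := by
      intro s _
      have := ((((((hasDerivAt_id s).const_sub x).const_mul p.lam).pow (n + 1)).div_const
        ((n + 1).factorial : ℝ)).const_mul C).neg
      refine this.congr_deriv ?_
      have h2 : ((n + 1).factorial : ℝ) = (n + 1) * n.factorial := by
        rw [Nat.factorial_succ]; push_cast; ring
      rw [h2]
      have h3 : (n.factorial : ℝ) ≠ 0 := by positivity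
      simp only [id, Nat.add_sub_cancel]
      push_cast
      field_simp
    rw [intervalIntegral.integral_eq_sub_of_hasDerivAt hd
      (by apply Continuous.intervalIntegrable; fun_prop)]
    simp
  rw [← hint, ← Real.norm_eq_abs]
  refine intervalIntegral.norm_integral_le_of_norm_le hx (Filter.Eventually.of_forall
    fun s hs => ?_) (by apply Continuous.intervalIntegrable; fun_prop)
  rw [norm_mul, Real.norm_eq_abs, Real.norm_eq_abs,
    abs_of_pos (mul_pos hl (Real.exp_pos _))]
  refine mul_le_mul (hf s hs) ?_ (by positivity) ((abs_nonneg _).trans (hf s hs))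
  exact mul_le_of_le_one_right hl.le (h.exp_le_one hs.1.le)

lemma continuous_discovery {W : ℝ → ℝ → ℝ} (hW : Continuous fun z : ℝ × ℝ => W z.1 z.2) :
    Continuous fun z : ℝ × ℝ => p.discovery W z.1 z.2 := by
  unfold Params.discovery
  refine intervalIntegral.continuous_parametric_intervalIntegral_of_continuous
    (f := fun (z : ℝ × ℝ) s => W (z.1 - s) (z.2 + p.a) * (p.lam * Real.exp (-p.lam * s)))
    ?_ continuous_fst
  refine Continuous.mul (hW.comp (f := fun w : (ℝ × ℝ) × ℝ => (w.1.1 - w.2, w.1.2 + p.a))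
    (by fun_prop)) (by fun_prop)

lemma continuous_M (h : p.Regular) {W : ℝ → ℝ → ℝ}
    (hW : Continuous fun z : ℝ × ℝ => W z.1 z.2) :
    Continuous fun z : ℝ × ℝ => p.M W z.1 z.2 := by
  have h1 := continuous_discovery (p := p) hW
  have h2 := h.continuous_hotelling
  simp only [M_eq_discovery]
  exact (h1.add ((h2.comp continuous_snd).mul (by fun_prop))).sub (by fun_prop)

/-- The marginal values are evaluated at `R + a ≥ a`, away from their singularity at 0, so the
conclusion reaches R = 0. Clamping both variables reduces it to the globally continuous case. -/
lemma continuousOn_discovery (h : p.Regular) {q : ℝ → ℝ → ℝ}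
    (hq : ContinuousOn (fun z : ℝ × ℝ => q z.1 z.2) (Ici 0 ×ˢ Ioi 0)) :
    ContinuousOn (fun z : ℝ × ℝ => p.discovery q z.1 z.2) (Ici 0 ×ˢ Ici 0) := by
  have hc : Continuous fun z : ℝ × ℝ => q (max z.1 0) (max z.2 p.a) := by
    refine hq.comp_continuous (f := fun z : ℝ × ℝ => (max z.1 0, max z.2 p.a)) (by fun_prop) ?_
    intro z
    exact ⟨mem_Ici.2 (le_max_right _ _), mem_Ioi.2 (lt_max_of_lt_right h.a_pos)⟩
  have := continuous_discovery (p := p) (W := fun x R => q (max x 0) (max R p.a)) hc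
  refine this.continuousOn.congr ?_
  rintro ⟨x, R⟩ ⟨hx, hR⟩
  simp only [mem_Ici] at hx hR
  simp only [Params.discovery]
  refine intervalIntegral.integral_congr fun s hs => ?_
  rw [uIcc_of_le hx] at hs
  rw [max_eq_left (by linarith [hs.2] : 0 ≤ x - s), max_eq_left (by linarith : p.a ≤ R + p.a)]

lemma discovery_sub_const_eq (W : ℝ → ℝ → ℝ) (x R : ℝ) :
    p.discovery W x R
      = Real.exp (-p.lam * x) * ∫ y in (0 : ℝ)..x, W y (R + p.a) * (p.lam * Real.exp (p.lam * y)) := by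
  have := intervalIntegral.integral_comp_sub_left (a := 0) (b := x)
    (fun y => W y (R + p.a) * (p.lam * Real.exp (-p.lam * (x - y)))) x
  simp only [sub_sub_cancel, sub_self, sub_zero] at this
  rw [Params.discovery, this, ← intervalIntegral.integral_const_mul]
  congr 1
  ext y
  rw [show -p.lam * (x - y) = -p.lam * x + p.lam * y by ring, Real.exp_add]
  ring

/-- The exploration operator in terms of the area left after the discovery. -/
lemma M_add_eq (h : p.Regular) (W : ℝ → ℝ → ℝ) (x R : ℝ) :
    p.M W x R + p.k / p.lam = Real.exp (-p.lam * x) *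
      ((∫ y in (0 : ℝ)..x, W y (R + p.a) * (p.lam * Real.exp (p.lam * y)))
        + p.hotelling R + p.k / p.lam) := by
  have hl := h.lam_pos.ne'
  rw [M_eq_discovery, discovery_sub_const_eq]
  field_simp
  ring

/-- In the form `M_add_eq`, obtained by substituting the area left for the area explored, x enters
only through an exponential and the endpoint of an integral. Hence M produces differentiability in x
from mere continuity. -/
lemma hasDerivAt_M_left (h : p.Regular) {W : ℝ → ℝ → ℝ}
    (hW : Continuous fun z : ℝ × ℝ => W z.1 z.2) (x R : ℝ) :
    HasDerivAt (fun x => p.M W x R) (p.lam * (W x (R + p.a) - p.M W x R) - p.k) x := by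
  have hl := h.lam_pos.ne'
  have hc : Continuous fun y => W y (R + p.a) * (p.lam * Real.exp (p.lam * y)) :=
    (hW.comp (f := fun y => (y, R + p.a)) (by fun_prop)).mul (by fun_prop)
  have h1 : HasDerivAt (fun x => ∫ y in (0 : ℝ)..x, W y (R + p.a) * (p.lam * Real.exp (p.lam * y)))
      (W x (R + p.a) * (p.lam * Real.exp (p.lam * x))) x :=
    intervalIntegral.integral_hasDerivAt_right (hc.intervalIntegrable _ _)
      (hc.stronglyMeasurableAtFilter _ _) hc.continuousAt
  have h2 : HasDerivAt (fun x => Real.exp (-p.lam * x)) (-p.lam * Real.exp (-p.lam * x)) x := by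
    refine ((hasDerivAt_id x).const_mul (-p.lam)).exp.congr_deriv ?_
    simp only [id]; ring
  have h3 := (h2.mul ((h1.add_const (p.hotelling R)).add_const (p.k / p.lam))).sub_const
    (p.k / p.lam)
  have e : (fun x => p.M W x R) = fun x => Real.exp (-p.lam * x) *
      ((∫ y in (0 : ℝ)..x, W y (R + p.a) * (p.lam * Real.exp (p.lam * y)))
        + p.hotelling R + p.k / p.lam) - p.k / p.lam := by
    ext x; rw [← h.M_add_eq]; ring
  rw [e]
  refine h3.congr_deriv ?_
  have e1 : Real.exp (-p.lam * x) * Real.exp (p.lam * x) = 1 := by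
    rw [← Real.exp_add]; simp
  have e2 := h.M_add_eq W x R
  have e3 : p.lam * p.M W x R = p.lam * (Real.exp (-p.lam * x) *
      ((∫ y in (0 : ℝ)..x, W y (R + p.a) * (p.lam * Real.exp (p.lam * y)))
        + p.hotelling R + p.k / p.lam)) - p.k := by
    rw [← e2]; field_simp; ring
  linear_combination (W x (R + p.a) * p.lam) * e1 + e3

lemma M_zero (W : ℝ → ℝ → ℝ) (R : ℝ) : p.M W 0 R = p.hotelling R := by
  simp [Params.M]

lemma discovery_mono {W₁ W₂ : ℝ → ℝ → ℝ} {x R : ℝ} (hlam : 0 < p.lam) (hx : 0 ≤ x)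
    (h1 : IntervalIntegrable (fun s => W₁ (x - s) (R + p.a) * (p.lam * Real.exp (-p.lam * s)))
      volume 0 x)
    (h2 : IntervalIntegrable (fun s => W₂ (x - s) (R + p.a) * (p.lam * Real.exp (-p.lam * s)))
      volume 0 x)
    (hle : ∀ y ∈ Icc 0 x, W₁ y (R + p.a) ≤ W₂ y (R + p.a)) :
    p.discovery W₁ x R ≤ p.discovery W₂ x R := by
  refine intervalIntegral.integral_mono_on hx h1 h2 fun s hs => ?_
  exact mul_le_mul_of_nonneg_right (hle _ ⟨by linarith [hs.2], by linarith [hs.1]⟩)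
    (by positivity)

lemma discovery_right (f : ℝ → ℝ) (x R : ℝ) :
    p.discovery (fun _ R => f R) x R = f (R + p.a) * (1 - Real.exp (-p.lam * x)) := by
  rw [Params.discovery, intervalIntegral.integral_const_mul, integral_density]

/-- Exploration is at least as good as without later explorations. -/
lemma M_ge (h : p.Regular) {W : ℝ → ℝ → ℝ} {x R : ℝ} (hx : 0 ≤ x)
    (hi : IntervalIntegrable (fun s => W (x - s) (R + p.a) * (p.lam * Real.exp (-p.lam * s)))
      volume 0 x)
    (hW : ∀ y ∈ Icc 0 x, p.hotelling (R + p.a) ≤ W y (R + p.a)) :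
    p.hotelling R * Real.exp (-p.lam * x)
      + (1 - Real.exp (-p.lam * x)) * (p.hotelling (R + p.a) - p.k / p.lam) ≤ p.M W x R := by
  have := discovery_mono (p := p) (W₁ := fun _ R => p.hotelling R) (W₂ := W) h.lam_pos hx
    (by apply Continuous.intervalIntegrable; fun_prop) hi hW
  rw [discovery_right] at this
  rw [M_eq_discovery]
  have e : p.k * ((1 - Real.exp (-p.lam * x)) / p.lam)
      = (1 - Real.exp (-p.lam * x)) * (p.k / p.lam) := by ring
  rw [e]
  linarith

/-- This is where `cost_le` enters: a deposit found with any reserves leaves a value of at least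
𝒰(a), which covers the expected cost k/λ of a search carried on until a discovery. -/
lemma M_nonneg (h : p.Regular) {W : ℝ → ℝ → ℝ} {x R : ℝ} (hx : 0 ≤ x) (hR : 0 ≤ R)
    (hi : IntervalIntegrable (fun s => W (x - s) (R + p.a) * (p.lam * Real.exp (-p.lam * s)))
      volume 0 x)
    (hW : ∀ y ∈ Icc 0 x, p.hotelling (R + p.a) ≤ W y (R + p.a)) :
    0 ≤ p.M W x R := by
  refine le_trans ?_ (h.M_ge hx hi hW)
  have h1 := h.exp_le_one hx
  have h2 := h.hotelling_mono h.a_pos.le (by linarith : p.a ≤ R + p.a)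
  have h3 := h.cost_le
  have := h.hotelling_nonneg hR
  exact add_nonneg (by positivity) (mul_nonneg (by linarith) (by linarith))

end Params.Regular

/-! ### Candidates: a class stable under exploration followed by optimal depletion -/

/-- Candidate value functions `V`, with marginal value of reserves `q`. -/
structure Candidate (p : Params) (V q : ℝ → ℝ → ℝ) : Prop where
  continuous : Continuous fun z : ℝ × ℝ => V z.1 z.2
  hotelling_le : ∀ x R, 0 ≤ x → 0 ≤ R → p.hotelling R ≤ V x R
  initial : ∀ R, 0 ≤ R → V 0 R = p.hotelling R
  mono : ∀ R, 0 ≤ R → MonotoneOn (fun x => V x R) (Ici 0)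
  profile : ∀ x, 0 ≤ x → Profile p (V x) (q x)
  continuousOn_deriv : ContinuousOn (fun z : ℝ × ℝ => q z.1 z.2) (Ici 0 ×ˢ Ioi 0)
  marginal_le : ∀ x R, 0 ≤ x → 0 < R → p.marginal (p.certain (V x R)) ≤ q x R

namespace Candidate

variable {p : Params} {V q : ℝ → ℝ → ℝ} {x R : ℝ}

lemma intervalIntegrable (hV : Candidate p V q) (x R : ℝ) : IntervalIntegrable
    (fun s => V (x - s) (R + p.a) * (p.lam * Real.exp (-p.lam * s))) volume 0 x := by
  apply Continuous.intervalIntegrable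
  exact (hV.continuous.comp (f := fun s => (x - s, R + p.a)) (by fun_prop)).mul (by fun_prop)

lemma continuousOn_slice (hV : Candidate p V q) (hR : 0 < R) : ContinuousOn
    (fun s => q (x - s) R) (Icc 0 x) := by
  refine hV.continuousOn_deriv.comp (f := fun s => (x - s, R)) (by fun_prop) ?_
  intro s hs
  exact ⟨by simpa using hs.2, hR⟩

lemma continuousOn_integrand (hV : Candidate p V q) (hR : 0 < R) : ContinuousOn
    (fun s => q (x - s) R * (p.lam * Real.exp (-p.lam * s))) (Icc 0 x) :=
  (hV.continuousOn_slice hR).mul (by fun_prop)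

lemma intervalIntegrable_deriv (hV : Candidate p V q) (hx : 0 ≤ x) (hR : 0 < R) :
    IntervalIntegrable (fun s => q (x - s) R * (p.lam * Real.exp (-p.lam * s))) volume 0 x := by
  apply ContinuousOn.intervalIntegrable
  rw [uIcc_of_le hx]
  exact hV.continuousOn_integrand hR

lemma M_nonneg (h : p.Regular) (hV : Candidate p V q) (hx : 0 ≤ x) (hR : 0 ≤ R) :
    0 ≤ p.M V x R :=
  h.M_nonneg hx hR (hV.intervalIntegrable x R) fun y hy =>
    hV.hotelling_le y _ hy.1 (by linarith [h.a_pos])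

lemma continuous_M_slice (h : p.Regular) (hV : Candidate p V q) (x : ℝ) : Continuous (p.M V x) :=
  (h.continuous_M hV.continuous).comp (f := fun R => (x, R)) (by fun_prop)

lemma hasDerivAt_M (h : p.Regular) (hV : Candidate p V q) (hx : 0 ≤ x) (hR : 0 < R) :
    HasDerivAt (p.M V x) (p.marginalM q x R) R := by
  have ha := h.a_pos
  -- The shift by a bounds the marginal value after a discovery by that of a, uniformly in R > 0,
  -- hence the dominating constant.
  have key := intervalIntegral.hasDerivAt_integral_of_dominated_loc_of_deriv_le (μ := volume)
    (a := 0) (b := x) (bound := fun _ => p.marginal p.a * p.lam)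
    (F := fun R s => V (x - s) (R + p.a) * (p.lam * Real.exp (-p.lam * s)))
    (F' := fun R s => q (x - s) (R + p.a) * (p.lam * Real.exp (-p.lam * s)))
    (x₀ := R) (s := Ioi 0) (Ioi_mem_nhds hR) ?_ (hV.intervalIntegrable x R) ?_ ?_
    (by apply Continuous.intervalIntegrable; fun_prop) ?_
  · have := (key.2.add ((h.hasDerivAt_hotelling hR).mul_const (Real.exp (-p.lam * x)))).sub_const
      (p.k * ((1 - Real.exp (-p.lam * x)) / p.lam))
    exact this
  · refine Filter.Eventually.of_forall fun R' => ?_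
    exact (((hV.continuous.comp (f := fun s => (x - s, R' + p.a)) (by fun_prop)).mul
      (by fun_prop)).aestronglyMeasurable)
  · rw [uIoc_of_le hx]
    exact ((hV.continuousOn_integrand (by linarith)).mono Ioc_subset_Icc_self).aestronglyMeasurable
      measurableSet_Ioc
  · refine Filter.Eventually.of_forall fun s hs R' hR' => ?_
    rw [uIoc_of_le hx] at hs
    have hR'0 : (0:ℝ) < R' := hR'
    have hxs : 0 ≤ x - s := by linarith [hs.2]
    have hq := (hV.profile _ hxs).deriv_pos (R' + p.a) (by linarith)
    have hq2 := (hV.profile _ hxs).deriv_le_marginal h (R := R' + p.a) (by linarith)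
    have hq3 := h.marginal_anti ha (by linarith : p.a ≤ R' + p.a)
    rw [Real.norm_eq_abs, abs_of_nonneg (mul_nonneg hq.le
      (mul_nonneg h.lam_pos.le (Real.exp_pos _).le))]
    exact mul_le_mul (hq2.trans hq3) (mul_le_of_le_one_right h.lam_pos.le (h.exp_le_one hs.1.le))
      (mul_nonneg h.lam_pos.le (Real.exp_pos _).le) (h.marginal_pos ha).le
  · refine Filter.Eventually.of_forall fun s hs R' hR' => ?_
    rw [uIoc_of_le hx] at hs
    have hR'0 : (0:ℝ) < R' := hR'
    have hxs : 0 ≤ x - s := by linarith [hs.2]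
    exact (((hV.profile _ hxs).hasDerivAt (R' + p.a) (by linarith)).comp_add_const R' p.a).mul_const
      _

lemma discovery_nonneg (h : p.Regular) (hV : Candidate p V q) (hx : 0 ≤ x) (hR : 0 ≤ R) :
    0 ≤ p.discovery q x R := by
  refine intervalIntegral.integral_nonneg hx fun s hs => ?_
  exact mul_nonneg ((hV.profile _ (by linarith [hs.2] : 0 ≤ x - s)).deriv_pos _
    (by linarith [h.a_pos])).le (mul_nonneg h.lam_pos.le (Real.exp_pos _).le)

lemma marginalM_pos (h : p.Regular) (hV : Candidate p V q) (hx : 0 ≤ x) (hR : 0 < R) :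
    0 < p.marginalM q x R :=
  add_pos_of_nonneg_of_pos (hV.discovery_nonneg h hx hR.le)
    (mul_pos (h.marginal_pos hR) (Real.exp_pos _))

lemma discovery_le (h : p.Regular) (hV : Candidate p V q) (hx : 0 ≤ x) (hR : 0 ≤ R) :
    p.discovery q x R ≤ p.marginal (R + p.a) * (1 - Real.exp (-p.lam * x)) := by
  have hRa : 0 < R + p.a := by linarith [h.a_pos]
  rw [← Params.Regular.discovery_right]
  refine Params.Regular.discovery_mono h.lam_pos hx (hV.intervalIntegrable_deriv hx hRa)
    (by apply Continuous.intervalIntegrable; fun_prop) fun y hy => ?_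
  exact (hV.profile y hy.1).deriv_le_marginal h hRa

/-- Strict because a discovery occurs with positive probability and lowers the marginal value. It
separates `R₁` from the average reserves `Z₀` in the strict case of `marginalM_add_le`. -/
lemma marginalM_lt (h : p.Regular) (hV : Candidate p V q) (hx : 0 < x) (hR : 0 < R) :
    p.marginalM q x R < p.marginal R := by
  have h1 := hV.discovery_le h hx.le hR.le
  have h2 : p.marginal (R + p.a) < p.marginal R :=
    h.marginal_strictAnti hR (mem_Ioi.2 (by linarith [h.a_pos])) (by linarith [h.a_pos])
  have h3 : Real.exp (-p.lam * x) < 1 := by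
    rw [Real.exp_lt_one_iff]; nlinarith [h.lam_pos]
  unfold Params.marginalM
  nlinarith

/-- Mixtures of marginal values keep the shape of profiles. -/
lemma marginalM_add_le (h : p.Regular) (hV : Candidate p V q) (hx : 0 ≤ x) {R₁ R₂ : ℝ}
    (h0 : 0 < R₁) (h1 : R₁ < R₂) :
    p.marginalM q x R₂ ≤ p.marginal (p.marginalInv (p.marginalM q x R₁) + (R₂ - R₁)) ∧
    (0 < x → p.marginalM q x R₂
      < p.marginal (p.marginalInv (p.marginalM q x R₁) + (R₂ - R₁))) := by
  have ha := h.a_pos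
  set q₀ := p.marginalM q x R₁ with hq₀
  have hq₀pos : 0 < q₀ := hV.marginalM_pos h hx h0
  set Z₀ := p.marginalInv q₀ with hZ₀
  have hZ₀pos : 0 < Z₀ := h.marginalInv_pos hq₀pos
  have hmZ₀ : p.marginal Z₀ = q₀ := h.marginal_marginalInv hq₀pos
  set δ := R₂ - R₁ with hδ
  have hδpos : 0 < δ := by linarith
  set w := (Z₀ / (Z₀ + δ)) ^ (2 - p.α)
  set A := p.marginal (Z₀ + δ)
  -- The tangent inequality at the averaged marginal value `q₀` is affine in the marginal value.
  -- Averaging it over the discoveries and the fruitless outcome, whose weights sum to 1, cancels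
  -- the linear term and leaves A.
  have hpt : ∀ y ∈ Icc 0 x, q y (R₂ + p.a) ≤ A + w * (q y (R₁ + p.a) - q₀) := by
    intro y hy
    have hP := hV.profile y hy.1
    have hq1 := hP.deriv_pos (R₁ + p.a) (by linarith)
    have hq2 := hP.deriv_pos (R₂ + p.a) (by linarith)
    have hs := hP.shape (R₁ + p.a) (R₂ + p.a) (by linarith) (by linarith)
    have hm := h.marginal_anti (by have := h.marginalInv_pos hq1; linarith) hs
    rw [h.marginal_marginalInv hq2] at hm
    have ht := h.marginal_add_le (h.marginalInv_pos hq1) hZ₀pos hδpos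
    rw [h.marginal_marginalInv hq1, hmZ₀] at ht
    refine le_trans hm (le_trans (le_of_eq ?_) ht)
    congr 1; rw [hδ]; ring
  have hint : p.discovery q x R₂
      ≤ (A - w * q₀) * (1 - Real.exp (-p.lam * x)) + w * p.discovery q x R₁ := by
    have e : (A - w * q₀) * (1 - Real.exp (-p.lam * x)) + w * p.discovery q x R₁
        = ∫ s in (0 : ℝ)..x, ((A - w * q₀) * (p.lam * Real.exp (-p.lam * s))
          + w * (q (x - s) (R₁ + p.a) * (p.lam * Real.exp (-p.lam * s)))) := by
      rw [intervalIntegral.integral_add, intervalIntegral.integral_const_mul (A - w * q₀),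
        intervalIntegral.integral_const_mul w, Params.Regular.integral_density, Params.discovery]
      · apply Continuous.intervalIntegrable; fun_prop
      · exact (hV.intervalIntegrable_deriv hx (by linarith)).const_mul w
    rw [e]
    have hi : IntervalIntegrable (fun s => (A - w * q₀) * (p.lam * Real.exp (-p.lam * s)))
        volume 0 x := by
      apply Continuous.intervalIntegrable; fun_prop
    refine intervalIntegral.integral_mono_on hx (hV.intervalIntegrable_deriv hx (by linarith))
      (hi.add ((hV.intervalIntegrable_deriv hx (by linarith)).const_mul w)) fun s hs => ?_
    have hk : 0 ≤ p.lam * Real.exp (-p.lam * s) := mul_nonneg h.lam_pos.le (Real.exp_pos _).le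
    have := mul_le_mul_of_nonneg_right (hpt (x - s) ⟨by linarith [hs.2], by linarith [hs.1]⟩) hk
    linarith
  have hE := Real.exp_pos (-p.lam * x)
  have hmR := h.marginal_add_le h0 hZ₀pos hδpos
  rw [hmZ₀, show R₁ + δ = R₂ by rw [hδ]; ring] at hmR
  have hdef : p.discovery q x R₁ = q₀ - p.marginal R₁ * Real.exp (-p.lam * x) := by
    rw [hq₀, Params.marginalM]; ring
  rw [hdef] at hint
  constructor
  · unfold Params.marginalM
    have := mul_le_mul_of_nonneg_right hmR hE.le
    linarith
  -- Strictness comes from the fruitless outcome alone, which has positive weight and marginal value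
  -- different from `q₀`.
  · intro hx0
    have hne : R₁ ≠ Z₀ := by
      intro heq
      have := hV.marginalM_lt h hx0 h0
      rw [← hq₀, ← hmZ₀, ← heq] at this
      exact lt_irrefl _ this
    have hmR := h.marginal_add_lt h0 hZ₀pos hδpos hne
    rw [hmZ₀, show R₁ + δ = R₂ by rw [hδ]; ring] at hmR
    unfold Params.marginalM
    have := mul_lt_mul_of_pos_right hmR hE
    linarith

lemma continuousOn_marginalM (h : p.Regular) (hV : Candidate p V q) :
    ContinuousOn (fun z : ℝ × ℝ => p.marginalM q z.1 z.2) (Ici 0 ×ˢ Ioi 0) := by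
  refine ((h.continuousOn_discovery hV.continuousOn_deriv).mono
    (prod_mono_right Ioi_subset_Ici_self)).add (ContinuousOn.mul ?_ (by fun_prop))
  exact h.continuousOn_marginal.comp continuousOn_snd fun z hz => hz.2

lemma profile_M (h : p.Regular) (hV : Candidate p V q) (hx : 0 ≤ x) :
    Profile p (p.M V x) (p.marginalM q x) where
  continuous := hV.continuous_M_slice h x
  nonneg R hR := hV.M_nonneg h hx hR
  hasDerivAt R hR := hV.hasDerivAt_M h hx hR
  deriv_pos R hR := hV.marginalM_pos h hx hR
  continuousOn_deriv := (hV.continuousOn_marginalM h).comp (f := fun R => (x, R)) (by fun_prop)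
    fun R hR => ⟨hx, hR⟩
  shape R₁ R₂ h0 h1 := by
    have hZ := h.marginalInv_pos (hV.marginalM_pos h hx h0)
    have := h.marginalInv_anti (hV.marginalM_pos h hx (h0.trans h1))
      (hV.marginalM_add_le h hx h0 h1).1
    rwa [h.marginalInv_marginal (by linarith)] at this

lemma shape_M_strict (h : p.Regular) (hV : Candidate p V q) (hx : 0 < x) {R₁ R₂ : ℝ}
    (h0 : 0 < R₁) (h1 : R₁ < R₂) :
    p.marginalInv (p.marginalM q x R₁) + (R₂ - R₁) < p.marginalInv (p.marginalM q x R₂) := by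
  have hZ := h.marginalInv_pos (hV.marginalM_pos h hx.le h0)
  have hlt := (hV.marginalM_add_le h hx.le h0 h1).2 hx
  have h2 := hV.marginalM_pos h hx.le (h0.trans h1)
  have := h.marginalInv_strictAnti h2 (mem_Ioi.2 (h2.trans hlt)) hlt
  rwa [h.marginalInv_marginal (by linarith)] at this

/-- As a function of the area, the value of exploring at once decreases, then increases. -/
lemma M_le_M (h : p.Regular) (hV : Candidate p V q) (hR : 0 ≤ R) {x₁ x₂ : ℝ} (h0 : 0 < x₁)
    (h1 : x₁ ≤ x₂) (hle : p.hotelling R ≤ p.M V x₁ R) : p.M V x₁ R ≤ p.M V x₂ R := by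
  set D : ℝ → ℝ := fun x => p.lam * (V x (R + p.a) - p.M V x R) - p.k with hD
  have hd : ∀ x, HasDerivAt (fun x => p.M V x R) (D x) x :=
    fun x => h.hasDerivAt_M_left hV.continuous x R
  have hl := h.lam_pos
  have hcont : Continuous fun x => p.M V x R :=
    (h.continuous_M hV.continuous).comp (f := fun x => (x, R)) (by fun_prop)
  have hcV : Continuous fun y => V y (R + p.a) * (p.lam * Real.exp (p.lam * y)) :=
    (hV.continuous.comp (f := fun y => (y, R + p.a)) (by fun_prop)).mul (by fun_prop)
  have hRa : 0 ≤ R + p.a := by linarith [h.a_pos]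
  -- Up to a constant, `exp (λ x) * D x` is λ times the Stieltjes integral of `exp (λ y)` against
  -- the nondecreasing function `y ↦ V y (R + a)`. So D changes sign at most once, from negative to
  -- positive.
  have hDm : ∀ y z, 0 ≤ y → y ≤ z → Real.exp (p.lam * y) * D y ≤ Real.exp (p.lam * z) * D z := by
    intro y z hy hyz
    have form : ∀ x, Real.exp (p.lam * x) * D x = p.lam * (Real.exp (p.lam * x) * V x (R + p.a)
        - ((∫ y in (0 : ℝ)..x, V y (R + p.a) * (p.lam * Real.exp (p.lam * y)))
        + p.hotelling R + p.k / p.lam)) := by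
      intro x
      have e1 : Real.exp (p.lam * x) * Real.exp (-p.lam * x) = 1 := by
        rw [← Real.exp_add]; simp
      have e2 := h.M_add_eq V x R
      have e3 : D x = p.lam * (V x (R + p.a) - (p.M V x R + p.k / p.lam)) := by
        simp only [hD]; field_simp; ring
      rw [e3, e2]
      linear_combination (-p.lam * ((∫ y in (0 : ℝ)..x, V y (R + p.a) *
        (p.lam * Real.exp (p.lam * y))) + p.hotelling R + p.k / p.lam)) * e1
    rw [form y, form z]
    refine mul_le_mul_of_nonneg_left ?_ hl.le
    have hsplit := intervalIntegral.integral_add_adjacent_intervals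
      (hcV.intervalIntegrable (μ := volume) 0 y) (hcV.intervalIntegrable (μ := volume) y z)
    have hexp : ∫ s in y..z, V z (R + p.a) * (p.lam * Real.exp (p.lam * s))
        = V z (R + p.a) * (Real.exp (p.lam * z) - Real.exp (p.lam * y)) := by
      rw [intervalIntegral.integral_const_mul]
      congr 1
      refine intervalIntegral.integral_eq_sub_of_hasDerivAt (f := fun s => Real.exp (p.lam * s))
        (fun s _ => ?_) (by apply Continuous.intervalIntegrable; fun_prop)
      refine ((hasDerivAt_id s).const_mul p.lam).exp.congr_deriv ?_
      simp only [id]; ring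
    have hle : ∫ s in y..z, V s (R + p.a) * (p.lam * Real.exp (p.lam * s))
        ≤ ∫ s in y..z, V z (R + p.a) * (p.lam * Real.exp (p.lam * s)) := by
      refine intervalIntegral.integral_mono_on hyz (hcV.intervalIntegrable _ _)
        (by apply Continuous.intervalIntegrable; fun_prop) fun s hs => ?_
      exact mul_le_mul_of_nonneg_right (hV.mono _ hRa (mem_Ici.2 (hy.trans hs.1))
        (mem_Ici.2 (hy.trans hyz)) hs.2) (by positivity)
    have := hV.mono _ hRa (mem_Ici.2 hy) (mem_Ici.2 (hy.trans hyz)) hyz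
    simp only at this
    nlinarith [Real.exp_pos (p.lam * y)]
  -- Otherwise D is negative on all of `[0, x₁]`, and M falls strictly below its value 𝒰(R) at area
  -- 0.
  have hD1 : 0 ≤ D x₁ := by
    by_contra! hneg
    have : StrictAntiOn (fun x => p.M V x R) (Icc 0 x₁) := by
      refine strictAntiOn_of_deriv_neg (convex_Icc 0 x₁) hcont.continuousOn ?_
      rw [interior_Icc]
      intro x hx
      rw [(hd x).deriv]
      have := hDm x x₁ hx.1.le hx.2.le
      by_contra! hpos
      have h1 := mul_nonneg (Real.exp_pos (p.lam * x)).le hpos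
      have h2 := mul_neg_of_pos_of_neg (Real.exp_pos (p.lam * x₁)) hneg
      linarith
    have := this ⟨le_rfl, h0.le⟩ ⟨h0.le, le_rfl⟩ h0
    simp only [Params.Regular.M_zero] at this
    linarith
  have : MonotoneOn (fun x => p.M V x R) (Ici x₁) := by
    refine monotoneOn_of_deriv_nonneg (convex_Ici x₁) hcont.continuousOn
      (fun x _ => (hd x).differentiableAt.differentiableWithinAt) ?_
    rw [interior_Ici]
    intro x hx
    rw [(hd x).deriv]
    have h2 := hDm x₁ x h0.le (le_of_lt hx)
    have h3 := mul_nonneg (Real.exp_pos (p.lam * x₁)).le hD1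
    exact nonneg_of_mul_nonneg_right (h3.trans h2) (Real.exp_pos _)
  exact this (mem_Ici.2 le_rfl) (mem_Ici.2 h1) h1

/-- Depleting reserves before an exploration preserves candidates. -/
lemma step (h : p.Regular) (hV : Candidate p V q) :
    Candidate p (fun x R => p.stopValue (p.M V x) R)
      (fun x R => max (p.marginalM q x R) (p.marginal (R + p.maxSurplus (p.M V x) R))) where
  continuous := h.continuous_stopValue (h.continuous_M hV.continuous)
  hotelling_le x R hx hR :=
    h.hotelling_le_stopValue (hV.continuous_M_slice h x) (hV.M_nonneg h hx le_rfl) hR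
  initial R hR := by
    have : p.M V 0 = p.hotelling := funext fun R => Params.Regular.M_zero V R
    simp only [this]
    exact h.stopValue_hotelling hR
  mono R hR x₁ hx₁ x₂ hx₂ hle := by
    simp only [mem_Ici] at hx₁ hx₂
    simp only
    have hc1 := hV.continuous_M_slice h x₁
    have hc2 := hV.continuous_M_slice h x₂
    rcases eq_or_lt_of_le hx₁ with rfl | hx₁'
    · have : p.M V 0 = p.hotelling := funext fun R => Params.Regular.M_zero V R
      rw [this, h.stopValue_hotelling hR]
      exact h.hotelling_le_stopValue hc2 (hV.M_nonneg h hx₂ le_rfl) hR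
    -- M need not increase in x everywhere, but it does at the level that matters: the maximal
    -- surplus is nonnegative, so at the maximizer R' exploring is worth at least 𝒰(R') and `M_le_M`
    -- applies.
    · obtain ⟨R', hR', he⟩ := h.exists_maxSurplus hc1 hR
      have hn := h.maxSurplus_nonneg hc1 (hV.M_nonneg h hx₁ le_rfl) hR
      have hM := hV.M_nonneg h hx₁ hR'.1
      have h2 : p.hotelling R' ≤ p.M V x₁ R' := by
        rw [he, Params.surplus] at hn
        have := h.hotelling_mono hR'.1 (by linarith : R' ≤ p.certain (p.M V x₁ R'))
        rwa [h.hotelling_certain hM] at this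
      have h3 := h.certain_mono hM (hV.M_le_M h hR'.1 hx₁' hle h2)
      have h4 := h.surplus_le_maxSurplus hc2 hR'.1 hR'.2
      unfold Params.stopValue
      refine h.hotelling_mono (by linarith) ?_
      rw [he]
      simp only [Params.surplus] at h4 ⊢
      linarith
  profile x hx := (hV.profile_M h hx).stopValue h
  continuousOn_deriv := by
    refine ContinuousOn.sup (hV.continuousOn_marginalM h) (h.continuousOn_marginal.comp
      (continuous_snd.add (h.continuous_maxSurplus
        (h.continuous_M hV.continuous))).continuousOn ?_)
    rintro ⟨x, R⟩ ⟨hx, hR⟩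
    exact add_pos_of_pos_of_nonneg hR (h.maxSurplus_nonneg (hV.continuous_M_slice h x)
      (hV.M_nonneg h hx le_rfl) (le_of_lt hR))
  marginal_le x R hx hR := by
    have := h.maxSurplus_nonneg (hV.continuous_M_slice h x) (hV.M_nonneg h hx le_rfl) hR.le
    simp only [Params.stopValue]
    rw [h.certain_hotelling (by linarith)]
    exact le_max_right _ _

end Candidate

/-! ### Successive approximations and their limit -/

namespace Params.Regular

variable {p : Params}

lemma profile_hotelling (h : p.Regular) : Profile p p.hotelling p.marginal where
  continuous := h.continuous_hotelling
  nonneg _ hR := h.hotelling_nonneg hR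
  hasDerivAt _ hR := h.hasDerivAt_hotelling hR
  deriv_pos _ hR := h.marginal_pos hR
  continuousOn_deriv := h.continuousOn_marginal
  shape R₁ R₂ h0 h1 := by
    rw [h.marginalInv_marginal h0, h.marginalInv_marginal (h0.trans h1)]; linarith

lemma candidate_hotelling (h : p.Regular) :
    Candidate p (fun _ => p.hotelling) (fun _ => p.marginal) where
  continuous := h.continuous_hotelling.comp continuous_snd
  hotelling_le _ _ _ _ := le_rfl
  initial _ _ := rfl
  mono _ _ := monotoneOn_const
  profile _ _ := h.profile_hotelling
  continuousOn_deriv := h.continuousOn_marginal.comp continuousOn_snd fun _ hz => hz.2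
  marginal_le _ _ _ hR := by rw [h.certain_hotelling hR.le]

lemma abs_M_sub_le (h : p.Regular) {W₁ W₂ : ℝ → ℝ → ℝ} {x R C : ℝ} (n : ℕ) (hx : 0 ≤ x)
    (h1 : IntervalIntegrable (fun s => W₁ (x - s) (R + p.a) * (p.lam * Real.exp (-p.lam * s)))
      volume 0 x)
    (h2 : IntervalIntegrable (fun s => W₂ (x - s) (R + p.a) * (p.lam * Real.exp (-p.lam * s)))
      volume 0 x)
    (hle : ∀ y ∈ Icc 0 x, |W₁ y (R + p.a) - W₂ y (R + p.a)|
      ≤ C * ((p.lam * y) ^ n / n.factorial)) :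
    |p.M W₁ x R - p.M W₂ x R| ≤ C * ((p.lam * x) ^ (n + 1) / (n + 1).factorial) := by
  have e : p.M W₁ x R - p.M W₂ x R = ∫ s in (0 : ℝ)..x,
      (W₁ (x - s) (R + p.a) - W₂ (x - s) (R + p.a)) * (p.lam * Real.exp (-p.lam * s)) := by
    rw [M_eq_discovery, M_eq_discovery, Params.discovery, Params.discovery]
    simp only [sub_mul]
    rw [intervalIntegral.integral_sub h1 h2]
    ring
  rw [e]
  exact h.abs_integral_density_le hx n fun s hs => hle _ ⟨by linarith [hs.2], by linarith [hs.1]⟩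

lemma abs_stopValue_sub_le (h : p.Regular) {G₁ G₂ : ℝ → ℝ} {R ε : ℝ} (hG₁ : Continuous G₁)
    (hG₂ : Continuous G₂) (h₁ : ∀ R, 0 ≤ R → 0 ≤ G₁ R) (h₂ : ∀ R, 0 ≤ R → 0 ≤ G₂ R)
    (hR : 0 ≤ R) (hle : ∀ R' ∈ Icc 0 R, |G₁ R' - G₂ R'| ≤ ε) :
    |p.stopValue G₁ R - p.stopValue G₂ R| ≤ ε := by
  have hε : 0 ≤ ε := (abs_nonneg _).trans (hle 0 ⟨le_rfl, hR⟩)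
  have a1 := h.stopValue_le_add hG₁ hG₂ (fun x hx => h₁ x hx.1) (fun x hx => h₂ x hx.1) hR hε
    fun x hx => by linarith [(abs_le.1 (hle x hx)).2]
  have a2 := h.stopValue_le_add hG₂ hG₁ (fun x hx => h₂ x hx.1) (fun x hx => h₁ x hx.1) hR hε
    fun x hx => by linarith [(abs_le.1 (hle x hx)).1]
  rw [abs_le]; constructor <;> linarith

/-- The Hotelling marginal value is a Lipschitz function of the value. -/
lemma exists_lipschitz_marginal_certain (h : p.Regular) {R₀ : ℝ} (hR₀ : 0 < R₀) :
    ∃ L, 0 ≤ L ∧ ∀ v w, p.hotelling R₀ ≤ v → p.hotelling R₀ ≤ w →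
      |p.marginal (p.certain v) - p.marginal (p.certain w)| ≤ L * |v - w| := by
  have hα := h.α_pos
  have hK := h.hotelling_one_pos
  have hb := h.rate_pos
  have hv₀ := h.hotelling_pos hR₀
  set v₀ := p.hotelling R₀
  set e := (1 / p.α) * (p.α - 1) with he
  have he0 : e < 0 := mul_neg_of_pos_of_neg (by positivity) (by linarith [h.α_lt_one])
  set c := p.rate ^ (p.α - 1) / (p.hotelling 1) ^ e with hc
  have hc0 : 0 < c := by positivity
  have form : ∀ v, 0 < v → p.marginal (p.certain v) = c * v ^ e := by
    intro v hv
    unfold Params.marginal Params.certain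
    rw [Real.mul_rpow hb.le (by positivity), ← Real.rpow_mul (by positivity), ← he,
      Real.div_rpow hv.le hK.le, hc]
    ring
  refine ⟨c * (-e * v₀ ^ (e - 1)),
    mul_nonneg hc0.le (mul_nonneg (neg_nonneg.2 he0.le) (by positivity)), fun v w hv hw => ?_⟩
  rw [form v (hv₀.trans_le hv), form w (hv₀.trans_le hw)]
  have := Convex.norm_image_sub_le_of_norm_hasDerivWithin_le (f := fun v => c * v ^ e)
    (f' := fun v => c * (e * v ^ (e - 1))) (s := Ici v₀) (C := c * (-e * v₀ ^ (e - 1)))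
    (x := w) (y := v) (fun x hx => ?_) (fun x hx => ?_) (convex_Ici v₀) hw hv
  · simpa only [Real.norm_eq_abs] using this
  · have hx0 : 0 < x := hv₀.trans_le hx
    exact ((Real.hasDerivAt_rpow_const (Or.inl hx0.ne')).const_mul c).hasDerivWithinAt
  · have hx0 : 0 < x := hv₀.trans_le hx
    have := Real.rpow_le_rpow_of_nonpos hv₀ hx (by linarith : e - 1 ≤ 0)
    rw [Real.norm_eq_abs, abs_mul, abs_mul, abs_of_pos hc0, abs_of_neg he0,
      abs_of_pos (Real.rpow_pos_of_pos hx0 _)]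
    gcongr
    linarith

end Params.Regular

lemma tendstoUniformlyOn_of_summable_sub {β : Type*} {f : ℕ → β → ℝ} {u : ℕ → ℝ}
    (hu : Summable u) {s : Set β} (hf : ∀ n, ∀ z ∈ s, |f (n + 1) z - f n z| ≤ u n) :
    TendstoUniformlyOn f (fun z => f 0 z + ∑' n, (f (n + 1) z - f n z)) Filter.atTop s := by
  have := tendstoUniformlyOn_tsum_nat hu (f := fun n z => f (n + 1) z - f n z) hf
  rw [Metric.tendstoUniformlyOn_iff] at this ⊢
  intro ε hε
  filter_upwards [this ε hε] with n hn z hz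
  have := hn z hz
  rw [Finset.sum_range_sub (fun n => f n z), Real.dist_eq] at this
  rw [Real.dist_eq]
  convert this using 2
  ring

/-- Successive approximations of the value function and of the marginal value: at most `n`
explorations are allowed. -/
def Params.approx (p : Params) : ℕ → (ℝ → ℝ → ℝ) × (ℝ → ℝ → ℝ)
  | 0 => (fun _ => p.hotelling, fun _ => p.marginal)
  | n + 1 => (fun x R => p.stopValue (p.M (p.approx n).1 x) R,
      fun x R => max (p.marginalM (p.approx n).2 x R)
        (p.marginal (R + p.maxSurplus (p.M (p.approx n).1 x) R)))

/-- Limit of the successive approximations of the value function, extended by clamping. -/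
def Params.limitValue (p : Params) (x R : ℝ) : ℝ :=
  (p.approx 0).1 (max x 0) (max R 0)
    + ∑' n, ((p.approx (n + 1)).1 (max x 0) (max R 0) - (p.approx n).1 (max x 0) (max R 0))

/-- Limit of the successive approximations of the marginal value. -/
def Params.limitDeriv (p : Params) (x R : ℝ) : ℝ :=
  (p.approx 0).2 x R + ∑' n, ((p.approx (n + 1)).2 x R - (p.approx n).2 x R)

namespace Params.Regular

variable {p : Params}

lemma candidate_approx (h : p.Regular) (n : ℕ) :
    Candidate p (p.approx n).1 (p.approx n).2 := by
  induction n with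
  | zero => exact h.candidate_hotelling
  | succ n ih => exact ih.step h

lemma abs_step_sub_le (h : p.Regular) {V₁ q₁ V₂ q₂ : ℝ → ℝ → ℝ} (h₁ : Candidate p V₁ q₁)
    (h₂ : Candidate p V₂ q₂) {C x R : ℝ} (n : ℕ) (hx : 0 ≤ x) (hR : 0 ≤ R)
    (hle : ∀ y R, y ∈ Icc 0 x → 0 ≤ R → |V₁ y R - V₂ y R| ≤ C * ((p.lam * y) ^ n / n.factorial)) :
    |p.stopValue (p.M V₁ x) R - p.stopValue (p.M V₂ x) R|
      ≤ C * ((p.lam * x) ^ (n + 1) / (n + 1).factorial) := by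
  refine h.abs_stopValue_sub_le (h₁.continuous_M_slice h x) (h₂.continuous_M_slice h x)
    (fun R hR => h₁.M_nonneg h hx hR) (fun R hR => h₂.M_nonneg h hx hR) hR fun R' hR' => ?_
  exact h.abs_M_sub_le n hx (h₁.intervalIntegrable x R') (h₂.intervalIntegrable x R')
    fun y hy => hle y _ hy (by linarith [hR'.1, h.a_pos])

/-- For n = 0, M 𝒰 - 𝒰 is at most 𝒰(a) in absolute value, by subadditivity of 𝒰 and `cost_le`. Each
further step applies the Volterra operator M and the nonexpansive `stopValue`. -/
lemma abs_approx_sub_le (h : p.Regular) (n : ℕ) {x R : ℝ} (hx : 0 ≤ x) (hR : 0 ≤ R) :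
    |(p.approx (n + 1)).1 x R - (p.approx n).1 x R|
      ≤ p.hotelling p.a * ((p.lam * x) ^ n / n.factorial) := by
  induction n generalizing x R with
  | zero =>
    simp only [Params.approx]
    rw [← h.stopValue_hotelling hR]
    refine h.abs_stopValue_sub_le (h.candidate_hotelling.continuous_M_slice h x)
      h.continuous_hotelling (fun R hR => h.candidate_hotelling.M_nonneg h hx hR)
      (fun R hR => h.hotelling_nonneg hR) hR fun R' hR' => ?_
    rw [M_eq_discovery, discovery_right]
    have h1 := h.hotelling_add_le hR'.1 h.a_pos.le
    have h2 := h.hotelling_mono hR'.1 (by linarith [h.a_pos] : R' ≤ R' + p.a)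
    have h3 := h.cost_le
    have h4 : 0 < p.k / p.lam := div_pos h.k_pos h.lam_pos
    have h5 := h.exp_le_one hx
    have h6 := Real.exp_pos (-p.lam * x)
    have e : p.hotelling (R' + p.a) * (1 - Real.exp (-p.lam * x))
        + p.hotelling R' * Real.exp (-p.lam * x) - p.k * ((1 - Real.exp (-p.lam * x)) / p.lam)
        - p.hotelling R' = (1 - Real.exp (-p.lam * x))
          * (p.hotelling (R' + p.a) - p.hotelling R' - p.k / p.lam) := by ring
    rw [e, abs_mul, abs_of_nonneg (by linarith : 0 ≤ 1 - Real.exp (-p.lam * x))]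
    simp only [pow_zero, Nat.factorial_zero, Nat.cast_one, div_one, mul_one]
    have h7 : |p.hotelling (R' + p.a) - p.hotelling R' - p.k / p.lam| ≤ p.hotelling p.a := by
      rw [abs_le]; constructor <;> linarith
    exact (mul_le_of_le_one_left (abs_nonneg _) (by linarith)).trans h7
  | succ n ih =>
    exact h.abs_step_sub_le (h.candidate_approx (n + 1)) (h.candidate_approx n) n hx hR
      fun y R hy hR => ih hy.1 hR

/-- A difference of maxima is controlled termwise. The averaged marginal values gain a factorial as
M does, because `R + a ≥ R₀`. The waiting term is a function of the value, Lipschitz above 𝒰(R₀), so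
`abs_approx_sub_le` applies; a constant at least `L * 𝒰(a)` closes the induction. -/
lemma exists_abs_approx_deriv_sub_le (h : p.Regular) {R₀ : ℝ} (hR₀ : 0 < R₀) :
    ∃ C, ∀ n x R, 0 ≤ x → R₀ ≤ R → |(p.approx (n + 1)).2 x R - (p.approx n).2 x R|
      ≤ C * ((p.lam * x) ^ n / n.factorial) := by
  obtain ⟨L, hL0, hL⟩ := h.exists_lipschitz_marginal_certain hR₀
  refine ⟨max (p.marginal R₀) (L * p.hotelling p.a), fun n => ?_⟩
  induction n with
  | zero =>
    intro x R hx hR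
    have hR' := hR₀.trans_le hR
    simp only [pow_zero, Nat.factorial_zero, Nat.cast_one, div_one, mul_one]
    refine le_max_of_le_left ?_
    have b : ∀ n, 0 < (p.approx n).2 x R ∧ (p.approx n).2 x R ≤ p.marginal R₀ := fun n =>
      ⟨((h.candidate_approx n).profile x hx).deriv_pos R hR',
        (((h.candidate_approx n).profile x hx).deriv_le_marginal h hR').trans
          (h.marginal_anti hR₀ hR)⟩
    rw [abs_le]
    constructor <;> linarith [(b 0).1, (b 0).2, (b (0 + 1)).1, (b (0 + 1)).2]
  | succ n ih =>
    intro x R hx hR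
    have hR' := hR₀.trans_le hR
    have hv : ∀ m, R + p.maxSurplus (p.M (p.approx m).1 x) R
        = p.certain ((p.approx (m + 1)).1 x R) := by
      intro m
      have hc := h.candidate_approx m
      have := h.maxSurplus_nonneg (hc.continuous_M_slice h x) (hc.M_nonneg h hx le_rfl) hR'.le
      simp only [Params.approx, Params.stopValue]
      rw [h.certain_hotelling (by linarith)]
    have hge : ∀ m, p.hotelling R₀ ≤ (p.approx m).1 x R := fun m =>
      (h.hotelling_mono hR₀.le hR).trans ((h.candidate_approx m).hotelling_le x R hx hR'.le)
    have hx' : 0 ≤ p.lam * x := mul_nonneg h.lam_pos.le hx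
    have e2 : ∀ m, (p.approx (m + 1)).2 x R = max (p.marginalM (p.approx m).2 x R)
        (p.marginal (p.certain ((p.approx (m + 1)).1 x R))) := fun m => by
      rw [← hv m]; rfl
    rw [e2 (n + 1), e2 n]
    refine (abs_max_sub_max_le_max _ _ _ _).trans (max_le ?_ ?_)
    · have e : p.marginalM (p.approx (n + 1)).2 x R - p.marginalM (p.approx n).2 x R
          = ∫ s in (0 : ℝ)..x, ((p.approx (n + 1)).2 (x - s) (R + p.a)
            - (p.approx n).2 (x - s) (R + p.a)) * (p.lam * Real.exp (-p.lam * s)) := by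
        have hRa : 0 < R + p.a := by linarith [h.a_pos]
        simp only [sub_mul]
        rw [intervalIntegral.integral_sub
          ((h.candidate_approx (n + 1)).intervalIntegrable_deriv hx hRa)
          ((h.candidate_approx n).intervalIntegrable_deriv hx hRa)]
        simp only [Params.marginalM, Params.discovery]; ring
      rw [e]
      exact h.abs_integral_density_le hx n fun s hs =>
        ih _ _ (by linarith [hs.2]) (by linarith [h.a_pos])
    · refine (hL _ _ (hge _) (hge _)).trans ?_
      refine (mul_le_mul_of_nonneg_left (h.abs_approx_sub_le (n + 1) hx hR'.le) hL0).trans ?_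
      rw [← mul_assoc]
      exact mul_le_mul_of_nonneg_right (le_max_right _ _) (by positivity)

lemma summable_bound (C X : ℝ) : Summable fun n : ℕ => C * ((p.lam * X) ^ n / n.factorial) :=
  (Real.summable_pow_div_factorial _).mul_left C

lemma bound_mono (h : p.Regular) {C x X : ℝ} (hC : 0 ≤ C) (hx : 0 ≤ x) (hX : x ≤ X) (n : ℕ) :
    C * ((p.lam * x) ^ n / n.factorial) ≤ C * ((p.lam * X) ^ n / n.factorial) := by
  have := h.lam_pos
  gcongr

lemma tendstoUniformlyOn_approx (h : p.Regular) (X : ℝ) :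
    TendstoUniformlyOn (fun n (z : ℝ × ℝ) => (p.approx n).1 z.1 z.2)
      (fun z => p.limitValue z.1 z.2) Filter.atTop (Icc 0 X ×ˢ Ici 0) := by
  have := tendstoUniformlyOn_of_summable_sub (f := fun n (z : ℝ × ℝ) => (p.approx n).1 z.1 z.2)
    (s := Icc 0 X ×ˢ Ici 0) (summable_bound (p := p) (p.hotelling p.a) X) fun n z hz =>
    (h.abs_approx_sub_le n hz.1.1 hz.2).trans
      (h.bound_mono (h.hotelling_pos h.a_pos).le hz.1.1 hz.1.2 n)
  refine this.congr_right fun z hz => ?_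
  simp only [Params.limitValue]
  rw [max_eq_left hz.1.1, max_eq_left hz.2]

lemma tendsto_approx (h : p.Regular) {x R : ℝ} (hx : 0 ≤ x) (hR : 0 ≤ R) :
    Filter.Tendsto (fun n => (p.approx n).1 x R) Filter.atTop (nhds (p.limitValue x R)) :=
  (h.tendstoUniformlyOn_approx x).tendsto_at (x := (x, R)) ⟨⟨hx, le_rfl⟩, hR⟩

lemma tendstoUniformlyOn_approx_deriv (h : p.Regular) (X : ℝ) {R₀ : ℝ} (hR₀ : 0 < R₀) :
    TendstoUniformlyOn (fun n (z : ℝ × ℝ) => (p.approx n).2 z.1 z.2)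
      (fun z => p.limitDeriv z.1 z.2) Filter.atTop (Icc 0 X ×ˢ Ici R₀) := by
  obtain ⟨C, hC⟩ := h.exists_abs_approx_deriv_sub_le hR₀
  have hC0 : 0 ≤ C := by simpa using (abs_nonneg _).trans (hC 0 0 R₀ le_rfl le_rfl)
  exact tendstoUniformlyOn_of_summable_sub (f := fun n (z : ℝ × ℝ) => (p.approx n).2 z.1 z.2)
    (s := Icc 0 X ×ˢ Ici R₀) (summable_bound (p := p) C X) fun n z hz =>
    (hC n _ _ hz.1.1 hz.2).trans (h.bound_mono hC0 hz.1.1 hz.1.2 n)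

lemma tendsto_approx_deriv (h : p.Regular) {x R : ℝ} (hx : 0 ≤ x) (hR : 0 < R) :
    Filter.Tendsto (fun n => (p.approx n).2 x R) Filter.atTop (nhds (p.limitDeriv x R)) :=
  (h.tendstoUniformlyOn_approx_deriv x hR).tendsto_at (x := (x, R)) ⟨⟨hx, le_rfl⟩, mem_Ici.2 le_rfl⟩

lemma continuousOn_limitValue (h : p.Regular) :
    ContinuousOn (fun z : ℝ × ℝ => p.limitValue z.1 z.2) (Ici 0 ×ˢ Ici 0) := by
  refine TendstoLocallyUniformlyOn.continuousOn (F := fun n (z : ℝ × ℝ) => (p.approx n).1 z.1 z.2)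
    (p := Filter.atTop) (tendstoLocallyUniformlyOn_of_forall_exists_nhds fun z hz => ?_)
    (Filter.Frequently.of_forall fun n => (h.candidate_approx n).continuous.continuousOn)
  refine ⟨Icc 0 (z.1 + 1) ×ˢ Ici 0, ?_, h.tendstoUniformlyOn_approx _⟩
  have h1 : {w : ℝ × ℝ | w.1 < z.1 + 1} ∈ nhds z :=
    (isOpen_lt continuous_fst continuous_const).mem_nhds (by simp)
  filter_upwards [self_mem_nhdsWithin, mem_nhdsWithin_of_mem_nhds h1] with w hw hw1
  exact ⟨⟨hw.1, le_of_lt hw1⟩, hw.2⟩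

lemma continuous_limitValue (h : p.Regular) :
    Continuous fun z : ℝ × ℝ => p.limitValue z.1 z.2 := by
  have := h.continuousOn_limitValue.comp_continuous
    (f := fun z : ℝ × ℝ => (max z.1 0, max z.2 0)) (by fun_prop)
    fun z => ⟨mem_Ici.2 (le_max_right _ _), mem_Ici.2 (le_max_right _ _)⟩
  refine this.congr fun z => ?_
  simp only [Function.comp_apply, Params.limitValue, max_assoc, max_self]

lemma continuousOn_limitDeriv (h : p.Regular) :
    ContinuousOn (fun z : ℝ × ℝ => p.limitDeriv z.1 z.2) (Ici 0 ×ˢ Ioi 0) := by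
  refine TendstoLocallyUniformlyOn.continuousOn (F := fun n (z : ℝ × ℝ) => (p.approx n).2 z.1 z.2)
    (p := Filter.atTop) (tendstoLocallyUniformlyOn_of_forall_exists_nhds fun z hz => ?_)
    (Filter.Frequently.of_forall fun n => (h.candidate_approx n).continuousOn_deriv)
  have hz2 : 0 < z.2 := hz.2
  refine ⟨Icc 0 (z.1 + 1) ×ˢ Ici (z.2 / 2), ?_, h.tendstoUniformlyOn_approx_deriv _ (by linarith)⟩
  have h1 : {w : ℝ × ℝ | w.1 < z.1 + 1} ∈ nhds z :=
    (isOpen_lt continuous_fst continuous_const).mem_nhds (by simp)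
  have h2 : {w : ℝ × ℝ | z.2 / 2 < w.2} ∈ nhds z :=
    (isOpen_lt continuous_const continuous_snd).mem_nhds (by simpa using hz2)
  filter_upwards [self_mem_nhdsWithin, mem_nhdsWithin_of_mem_nhds h1,
    mem_nhdsWithin_of_mem_nhds h2] with w hw hw1 hw2
  exact ⟨⟨hw.1, le_of_lt hw1⟩, le_of_lt hw2⟩

lemma hasDerivAt_limitValue (h : p.Regular) {x R : ℝ} (hx : 0 ≤ x) (hR : 0 < R) :
    HasDerivAt (p.limitValue x) (p.limitDeriv x R) R := by
  refine hasDerivAt_of_tendstoLocallyUniformlyOn (l := Filter.atTop) (s := Ioi 0)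
    (f := fun n => (p.approx n).1 x) (f' := fun n => (p.approx n).2 x) isOpen_Ioi
    (tendstoLocallyUniformlyOn_of_forall_exists_nhds fun R hR => ?_)
    (Filter.Eventually.of_forall fun n R hR => ((h.candidate_approx n).profile x hx).hasDerivAt R hR)
    (fun R hR => h.tendsto_approx hx (le_of_lt hR)) hR
  have hR' : (0:ℝ) < R := hR
  refine ⟨Ici (R / 2), mem_nhdsWithin_of_mem_nhds (Ici_mem_nhds (by linarith)), ?_⟩
  have := (h.tendstoUniformlyOn_approx_deriv x (R₀ := R / 2) (by linarith)).comp
    (fun R => (x, R))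
  refine this.mono ?_
  intro y hy
  exact ⟨⟨hx, le_rfl⟩, hy⟩

lemma marginal_le_limitDeriv (h : p.Regular) {x R : ℝ} (hx : 0 ≤ x) (hR : 0 < R) :
    p.marginal (p.certain (p.limitValue x R)) ≤ p.limitDeriv x R := by
  have hge : p.hotelling R ≤ p.limitValue x R := ge_of_tendsto' (h.tendsto_approx hx hR.le)
    fun n => (h.candidate_approx n).hotelling_le x R hx hR.le
  have hpos := h.certain_pos ((h.hotelling_pos hR).trans_le hge)
  have hc : ContinuousAt (fun v => p.marginal (p.certain v)) (p.limitValue x R) :=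
    ContinuousAt.comp (f := p.certain) (g := p.marginal)
      (h.continuousOn_marginal.continuousAt (Ioi_mem_nhds hpos)) h.continuous_certain.continuousAt
  exact le_of_tendsto_of_tendsto' (hc.tendsto.comp (h.tendsto_approx hx hR.le))
    (h.tendsto_approx_deriv hx hR) fun n => (h.candidate_approx n).marginal_le x R hx hR

/-- A limit of positive marginal values could vanish. The lower bound `marginal_le` carried by
candidates excludes this. -/
lemma limitDeriv_pos (h : p.Regular) {x R : ℝ} (hx : 0 ≤ x) (hR : 0 < R) :
    0 < p.limitDeriv x R := by
  have hge : p.hotelling R ≤ p.limitValue x R := ge_of_tendsto' (h.tendsto_approx hx hR.le)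
    fun n => (h.candidate_approx n).hotelling_le x R hx hR.le
  exact (h.marginal_pos (h.certain_pos ((h.hotelling_pos hR).trans_le hge))).trans_le
    (h.marginal_le_limitDeriv hx hR)

lemma candidate_limit (h : p.Regular) : Candidate p p.limitValue p.limitDeriv where
  continuous := h.continuous_limitValue
  hotelling_le x R hx hR := ge_of_tendsto' (h.tendsto_approx hx hR)
    fun n => (h.candidate_approx n).hotelling_le x R hx hR
  initial R hR := by
    refine tendsto_nhds_unique (h.tendsto_approx le_rfl hR) ?_
    simp only [(h.candidate_approx _).initial R hR]
    exact tendsto_const_nhds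
  mono R hR x₁ hx₁ x₂ hx₂ hle := le_of_tendsto_of_tendsto' (h.tendsto_approx hx₁ hR)
    (h.tendsto_approx hx₂ hR) fun n => (h.candidate_approx n).mono R hR hx₁ hx₂ hle
  profile x hx :=
    { continuous := h.continuous_limitValue.comp (f := fun R => (x, R)) (by fun_prop)
      nonneg R hR := ge_of_tendsto' (h.tendsto_approx hx hR)
        fun n => ((h.candidate_approx n).profile x hx).nonneg R hR
      hasDerivAt R hR := h.hasDerivAt_limitValue hx hR
      deriv_pos R hR := h.limitDeriv_pos hx hR
      continuousOn_deriv := h.continuousOn_limitDeriv.comp (f := fun R => (x, R)) (by fun_prop)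
        fun R hR => ⟨hx, hR⟩
      shape R₁ R₂ h0 h1 := by
        have lim : ∀ R, 0 < R → Filter.Tendsto (fun n => p.marginalInv ((p.approx n).2 x R))
            Filter.atTop (nhds (p.marginalInv (p.limitDeriv x R))) := fun R hR =>
          ((continuousOn_marginalInv.continuousAt
            (Ioi_mem_nhds (h.limitDeriv_pos hx hR))).tendsto).comp (h.tendsto_approx_deriv hx hR)
        exact le_of_tendsto_of_tendsto' ((lim R₁ h0).add_const _) (lim R₂ (h0.trans h1))
          fun n => ((h.candidate_approx n).profile x hx).shape R₁ R₂ h0 h1 }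
  continuousOn_deriv := h.continuousOn_limitDeriv
  marginal_le x R hx hR := h.marginal_le_limitDeriv hx hR

/-- The limit is a fixed point. -/
lemma limitValue_eq_stopValue (h : p.Regular) {x R : ℝ} (hx : 0 ≤ x) (hR : 0 ≤ R) :
    p.limitValue x R = p.stopValue (p.M p.limitValue x) R := by
  have hu := Metric.tendstoUniformlyOn_iff.1 (h.tendstoUniformlyOn_approx x)
  have h2 : Filter.Tendsto (fun n => (p.approx (n + 1)).1 x R) Filter.atTop
      (nhds (p.stopValue (p.M p.limitValue x) R)) := by
    rw [Metric.tendsto_nhds]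
    intro ε hε
    have hx' : 0 ≤ p.lam * x := mul_nonneg h.lam_pos.le hx
    have hd : 0 < ε / (p.lam * x + 1) := by positivity
    filter_upwards [hu _ hd] with n hn
    rw [Real.dist_eq]
    have := h.abs_step_sub_le (h.candidate_approx n) h.candidate_limit
      (C := ε / (p.lam * x + 1)) 0 hx hR fun y R hy hR => by
        have := hn (y, R) ⟨hy, hR⟩
        rw [Real.dist_eq, abs_sub_comm] at this
        simpa using this.le
    refine this.trans_lt ?_
    simp only [zero_add, pow_one, Nat.factorial_one, Nat.cast_one, div_one]
    rw [div_mul_eq_mul_div, div_lt_iff₀ (by positivity)]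
    nlinarith
  exact tendsto_nhds_unique ((Filter.tendsto_add_atTop_iff_nat 1).2 (h.tendsto_approx hx hR)) h2

end Params.Regular

/-! ### Uniqueness of the maximizer of the surplus -/

namespace Profile

variable {p : Params} {G g : ℝ → ℝ} {R R₁ R₂ : ℝ}

lemma surplus_deriv_pos_iff (h : p.Regular) (hG : Profile p G g) (hR : 0 < R) :
    0 < (p.marginal (p.certain (G R)))⁻¹ * g R - 1 ↔
      p.marginalInv (g R) < p.certain (G R) := by
  have hS := h.certain_pos (hG.pos hR)
  have hm := h.marginal_pos hS
  have hg := hG.deriv_pos R hR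
  rw [sub_pos, lt_inv_mul_iff₀ hm, mul_one]
  constructor
  · intro hlt
    have := h.marginalInv_strictAnti hm hg hlt
    rwa [h.marginalInv_marginal hS] at this
  · intro hlt
    have := h.marginal_strictAnti (h.marginalInv_pos hg) hS hlt
    rwa [h.marginal_marginalInv hg] at this

/-- With a strict shape inequality the surplus has a unique maximum. -/
lemma eq_of_surplus_eq (h : p.Regular) (hG : Profile p G g)
    (hs : ∀ R₁ R₂, 0 < R₁ → R₁ < R₂ →
      p.marginalInv (g R₁) + (R₂ - R₁) < p.marginalInv (g R₂))
    (h0 : 0 ≤ R₁) (h1 : R₁ < R₂) (h2 : R₂ ≤ R) (he₁ : p.surplus G R₁ = p.maxSurplus G R)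
    (he₂ : p.surplus G R₂ = p.maxSurplus G R) : False := by
  have hR₂ : 0 < R₂ := h0.trans_lt h1
  have hc := h.continuous_surplus_single hG.continuous
  -- Either the surplus increases strictly up to `R₂`, so `R₁` is not maximal, or it decreases
  -- strictly just before `R₂`, where it would exceed the maximum.
  rcases le_or_gt (p.marginalInv (g R₂)) (p.certain (G R₂)) with hle | hgt
  · have : StrictMonoOn (p.surplus G) (Icc R₁ R₂) := by
      refine strictMonoOn_of_deriv_pos (convex_Icc R₁ R₂) hc.continuousOn ?_
      rw [interior_Icc]
      intro y hy
      have hy0 : 0 < y := h0.trans_lt hy.1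
      rw [(hG.hasDerivAt_surplus h hy0).deriv, hG.surplus_deriv_pos_iff h hy0]
      by_contra! hcon
      exact absurd ((hG.certain_le h hy0 hy.2.le hcon).trans_lt (hs y R₂ hy0 hy.2))
        (not_lt.2 hle)
    have := this ⟨le_rfl, h1.le⟩ ⟨h1.le, le_rfl⟩ h1
    linarith
  · have hev : ∀ᶠ x in nhds R₂, 0 < p.marginalInv (g x) - p.certain (G x) :=
      ((hG.continuousOn_gap h).continuousAt (Ioi_mem_nhds hR₂)).eventually
        (lt_mem_nhds (by simpa using hgt))
    obtain ⟨l, u, hlu, hsub⟩ := mem_nhds_iff_exists_Ioo_subset.1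
      (Filter.inter_mem (Ioi_mem_nhds h1) hev)
    obtain ⟨y, hy⟩ := exists_between hlu.1
    have hlow : ∀ z ∈ Icc y R₂, 0 < z ∧ p.certain (G z) < p.marginalInv (g z) := by
      intro z hz
      have := hsub ⟨hy.1.trans_le hz.1, hz.2.trans_lt hlu.2⟩
      have h3 := this.2
      simp only [mem_ofPred_eq] at h3
      exact ⟨h0.trans_lt this.1, by linarith⟩
    have : StrictAntiOn (p.surplus G) (Icc y R₂) := by
      refine strictAntiOn_of_deriv_neg (convex_Icc y R₂) hc.continuousOn ?_
      rw [interior_Icc]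
      intro z hz
      obtain ⟨hz0, hz1⟩ := hlow z ⟨hz.1.le, hz.2.le⟩
      rw [(hG.hasDerivAt_surplus h hz0).deriv]
      by_contra! hcon
      exact absurd ((hG.surplus_deriv_nonneg_iff h hz0).1 hcon) (not_le.2 hz1)
    have h3 := this ⟨le_rfl, hy.2.le⟩ ⟨hy.2.le, le_rfl⟩ hy.2
    have h4 := h.surplus_le_maxSurplus (R := R) hG.continuous
      (hlow y ⟨le_rfl, hy.2.le⟩).1.le (hy.2.le.trans h2)
    linarith

end Profile

namespace Params.Regular

variable {p : Params} {x R : ℝ}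

/-! ### The HJB equation -/

lemma limitDeriv_eq (h : p.Regular) (hx : 0 ≤ x) (hR : 0 < R) :
    p.limitDeriv x R = max (p.marginalM p.limitDeriv x R)
      (p.marginal (R + p.maxSurplus (p.M p.limitValue x) R)) := by
  have h1 := ((h.candidate_limit.profile_M h hx).hasDerivAt_stopValue h hR)
  refine (h.hasDerivAt_limitValue hx hR).unique (h1.congr_of_eventuallyEq ?_)
  filter_upwards [Ioi_mem_nhds hR] with y hy using h.limitValue_eq_stopValue hx (le_of_lt hy)

lemma M_limitValue_le (h : p.Regular) (hx : 0 ≤ x) (hR : 0 ≤ R) :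
    p.M p.limitValue x R ≤ p.limitValue x R := by
  rw [h.limitValue_eq_stopValue hx hR]
  exact h.le_stopValue (h.candidate_limit.continuous_M_slice h x) (h.candidate_limit.M_nonneg h hx hR) hR

lemma limitValue_zero_right (h : p.Regular) (hx : 0 ≤ x) :
    p.limitValue x 0 = p.M p.limitValue x 0 := by
  rw [h.limitValue_eq_stopValue hx le_rfl]
  exact h.stopValue_zero (h.candidate_limit.continuous_M_slice h x)
    (h.candidate_limit.M_nonneg h hx le_rfl)

lemma uStar_eq_of_pos (h : p.Regular) {q : ℝ} (hq : 0 < q) :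
    p.uStar q = ((p.r * p.hotelling (p.marginalInv q) : ℝ) : EReal) := by
  rw [← h.uStar_marginal (h.marginalInv_pos hq), h.marginal_marginalInv hq]

/-- With Z the Hotelling reserves whose marginal value is `∂V/∂R`, the first term is r (𝒰(Z) - V).
It is nonpositive because `marginal_le` reads Z ≤ 𝒰⁻¹(V). Where M V < V, waiting is optimal, the
marginal value is that of R + m, and Z = R + m = 𝒰⁻¹(V). -/
lemma limitValue_interior (h : p.Regular) (hx : 0 ≤ x) (hR : 0 < R) :
    max (p.uStar (deriv (p.limitValue x) R) - ((p.r * p.limitValue x R : ℝ) : EReal))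
      ((p.M p.limitValue x R - p.limitValue x R : ℝ) : EReal) = 0 := by
  have hq := h.limitDeriv_pos hx hR
  have hV0 : 0 ≤ p.limitValue x R := (h.candidate_limit.profile x hx).nonneg R hR.le
  have hS := h.certain_pos ((h.candidate_limit.profile x hx).pos hR)
  have hm0 := h.maxSurplus_nonneg (h.candidate_limit.continuous_M_slice h x)
    (h.candidate_limit.M_nonneg h hx le_rfl) hR.le
  rw [(h.hasDerivAt_limitValue hx hR).deriv, h.uStar_eq_of_pos hq, ← EReal.coe_sub,
    ← EReal.coe_zero]
  have hle : p.r * p.hotelling (p.marginalInv (p.limitDeriv x R)) - p.r * p.limitValue x R ≤ 0 := by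
    have h1 := h.marginalInv_anti (h.marginal_pos hS) (h.marginal_le_limitDeriv hx hR)
    rw [h.marginalInv_marginal hS] at h1
    have h2 := h.hotelling_mono (h.marginalInv_pos hq).le h1
    rw [h.hotelling_certain hV0] at h2
    nlinarith [h.r_pos]
  have hM := h.M_limitValue_le hx hR.le
  rw [← EReal.coe_strictMono.monotone.map_max, EReal.coe_eq_coe_iff]
  rcases eq_or_lt_of_le hM with heq | hlt
  · rw [heq, sub_self]
    exact max_eq_right hle
  · have hP := h.candidate_limit.profile_M h hx
    have hgap : p.certain (p.M p.limitValue x R)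
        < p.marginalInv (p.marginalM p.limitDeriv x R) := by
      by_contra! hcon
      rw [h.limitValue_eq_stopValue hx hR.le, hP.stopValue_eq_of_le h hR hcon] at hlt
      exact lt_irrefl _ hlt
    have hRm := hP.add_maxSurplus_le h hR hgap.le
    have h1 := h.marginal_anti (by linarith) hRm
    rw [h.marginal_marginalInv (hP.deriv_pos R hR)] at h1
    have h2 : p.limitDeriv x R = p.marginal (R + p.maxSurplus (p.M p.limitValue x) R) := by
      rw [h.limitDeriv_eq hx hR, max_eq_right h1]
    have h3 : p.hotelling (p.marginalInv (p.limitDeriv x R)) = p.limitValue x R := by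
      rw [h2, h.marginalInv_marginal (by linarith), h.limitValue_eq_stopValue hx hR.le]; rfl
    rw [h3, sub_self]
    exact max_eq_left (by linarith)

lemma solvesHJB_limitValue (h : p.Regular) : SolvesHJB p p.limitValue where
  continuousOn x hx := (h.candidate_limit.profile x hx).continuous.continuousOn
  differentiableAt x R hx hR := (h.hasDerivAt_limitValue hx hR).differentiableAt
  integrable x R _ _ := h.candidate_limit.intervalIntegrable x R
  interior x R hx hR := h.limitValue_interior hx hR
  boundary x hx := by
    rw [← h.limitValue_zero_right hx, sub_self]
    refine max_eq_right ?_
    have := mul_nonneg h.r_pos.le ((h.candidate_limit.profile x hx).nonneg 0 le_rfl)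
    linarith
  initial R hR := h.candidate_limit.initial R hR

lemma concaveOn_limitValue (h : p.Regular) (hx : 0 ≤ x) :
    ConcaveOn ℝ (Ici 0) (p.limitValue x) := by
  have hP := h.candidate_limit.profile x hx
  refine AntitoneOn.concaveOn_of_deriv (convex_Ici 0) hP.continuous.continuousOn ?_ ?_
  · rw [interior_Ici]
    exact fun R hR => (hP.hasDerivAt R hR).differentiableAt.differentiableWithinAt
  · rw [interior_Ici]
    intro R₁ h₁ R₂ h₂ hle
    rw [(hP.hasDerivAt R₁ h₁).deriv, (hP.hasDerivAt R₂ h₂).deriv]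
    exact hP.deriv_anti h h₁ hle

/-! ### Differentiability in the unexplored area -/

lemma contDiff_certain (h : p.Regular) : ContDiff ℝ 1 p.certain := by
  unfold Params.certain
  refine (Real.contDiff_rpow_const_of_le ?_).comp (contDiff_id.div_const _)
  rw [Nat.cast_one, one_le_div h.α_pos]
  exact h.α_lt_one.le

end Params.Regular

/-- Derivative in the area of the surplus of exploring at once. -/
def Params.surplusDeriv (p : Params) (x R : ℝ) : ℝ :=
  deriv p.certain (p.M p.limitValue x R)
    * (p.lam * (p.limitValue x (R + p.a) - p.M p.limitValue x R) - p.k)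

/-- Average of `Params.surplusDeriv` over areas between `y` and `x`. -/
def Params.surplusSlope (p : Params) (y x R : ℝ) : ℝ :=
  ∫ t in (0 : ℝ)..1, p.surplusDeriv (y + t * (x - y)) R

namespace Params.Regular

variable {p : Params} {x R : ℝ}

lemma continuous_surplusDeriv (h : p.Regular) :
    Continuous fun z : ℝ × ℝ => p.surplusDeriv z.1 z.2 := by
  have hV := h.continuous_limitValue
  have hM := h.continuous_M hV
  unfold Params.surplusDeriv
  refine ((h.contDiff_certain.continuous_deriv le_rfl).comp hM).mul (((continuous_const.mul
    ((hV.comp (f := fun z : ℝ × ℝ => (z.1, z.2 + p.a)) (by fun_prop)).sub hM))).sub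
      continuous_const)

lemma continuous_surplusSlope (h : p.Regular) (y : ℝ) :
    Continuous fun z : ℝ × ℝ => p.surplusSlope y z.1 z.2 := by
  unfold Params.surplusSlope
  refine intervalIntegral.continuous_parametric_intervalIntegral_of_continuous'
    (f := fun (z : ℝ × ℝ) t => p.surplusDeriv (y + t * (z.1 - y)) z.2) ?_ 0 1
  exact h.continuous_surplusDeriv.comp
    (f := fun w : (ℝ × ℝ) × ℝ => (y + w.2 * (w.1.1 - y), w.1.2)) (by fun_prop)

lemma surplusSlope_self (y R : ℝ) : p.surplusSlope y y R = p.surplusDeriv y R := by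
  simp [Params.surplusSlope]

lemma sub_mul_surplusSlope (h : p.Regular) (y x R : ℝ) :
    (x - y) * p.surplusSlope y x R
      = p.surplus (p.M p.limitValue x) R - p.surplus (p.M p.limitValue y) R := by
  have hd : ∀ x, HasDerivAt (fun x => p.surplus (p.M p.limitValue x) R) (p.surplusDeriv x R) x := by
    intro x
    have h1 : HasDerivAt p.certain (deriv p.certain (p.M p.limitValue x R))
        (p.M p.limitValue x R) :=
      ((h.contDiff_certain.differentiable one_ne_zero) _).hasDerivAt
    exact (h1.comp x (h.hasDerivAt_M_left h.continuous_limitValue x R)).sub_const R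
  have hint : ∀ t ∈ uIcc (0:ℝ) 1, HasDerivAt
      (fun t => p.surplus (p.M p.limitValue (y + t * (x - y))) R)
      ((x - y) * p.surplusDeriv (y + t * (x - y)) R) t := by
    intro t _
    have h2 : HasDerivAt (fun t => y + t * (x - y)) (x - y) t := by
      simpa using! ((hasDerivAt_id t).mul_const (x - y)).const_add y
    exact ((hd (y + t * (x - y))).comp t h2).congr_deriv (mul_comm _ _)
  have := intervalIntegral.integral_eq_sub_of_hasDerivAt hint
    (by
      apply Continuous.intervalIntegrable
      exact continuous_const.mul (h.continuous_surplusDeriv.comp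
        (f := fun t => (y + t * (x - y), R)) (by fun_prop)))
  rw [intervalIntegral.integral_const_mul] at this
  simpa [Params.surplusSlope] using this

lemma surplus_M_zero (h : p.Regular) (hR : 0 ≤ R) : p.surplus (p.M p.limitValue 0) R = 0 := by
  rw [Params.surplus, M_zero, h.certain_hotelling hR, sub_self]

end Params.Regular

/-- Continuity of the optimal value of an auxiliary function at a maximizer. -/
lemma tendsto_of_isMaxOn {α : Type*} [TopologicalSpace α] {s : Set α} {z₀ : α}
    {Φ f : α × ℝ → ℝ} (hΦ : Continuous Φ) (hf : Continuous f) {τ : α → ℝ}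
    (hτ : ∀ z ∈ s, τ z ∈ Icc (0:ℝ) 1)
    (hmax : ∀ z ∈ s, ∀ t ∈ Icc (0:ℝ) 1, Φ (z, t) ≤ Φ (z, τ z)) {d : ℝ}
    (huniq : ∀ t ∈ Icc (0:ℝ) 1, (∀ t' ∈ Icc (0:ℝ) 1, Φ (z₀, t') ≤ Φ (z₀, t)) → f (z₀, t) = d) :
    Filter.Tendsto (fun z => f (z, τ z)) (nhdsWithin z₀ s) (nhds d) := by
  -- Along an ultrafilter the maximizers converge in the compact `[0, 1]`. The limit maximizes `Φ
  -- (z₀, ·)`, so f takes the value d there, even if the maximizer is not unique.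
  rw [Filter.tendsto_iff_ultrafilter]
  intro g hg
  have hs : ∀ᶠ z in (g : Filter α), z ∈ s := hg self_mem_nhdsWithin
  obtain ⟨t, ht, hle⟩ := isCompact_Icc.ultrafilter_le_nhds' (g.map τ)
    (s := Icc (0:ℝ) 1) (hs.mono fun z hz => hτ z hz)
  have hz : Filter.Tendsto (fun z : α => z) g (nhds z₀) := hg.trans nhdsWithin_le_nhds
  have hpair : Filter.Tendsto (fun z => (z, τ z)) g (nhds (z₀, t)) := hz.prodMk_nhds hle
  rw [← huniq t ht fun t' ht' => le_of_tendsto_of_tendsto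
    ((hΦ.tendsto (z₀, t')).comp (hz.prodMk_nhds tendsto_const_nhds))
    ((hΦ.tendsto (z₀, t)).comp hpair) (hs.mono fun z hz => hmax z hz t' ht')]
  exact (hf.tendsto (z₀, t)).comp hpair

namespace Params.Regular

variable {p : Params} {x R : ℝ}

/-- At area 0 the surplus vanishes identically and every level maximizes it. The surplus divided by
x has the same maximizers for x > 0, extends continuously to x = 0 as the derivative in x, and still
discriminates between levels there. -/
lemma exists_argmax_slope (h : p.Regular) (x R : ℝ) : ∃ t ∈ Icc (0:ℝ) 1, ∀ t' ∈ Icc (0:ℝ) 1,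
    p.surplusSlope 0 x (t' * R) ≤ p.surplusSlope 0 x (t * R) := by
  have hc : Continuous fun t => p.surplusSlope 0 x (t * R) :=
    (h.continuous_surplusSlope 0).comp (f := fun t => (x, t * R)) (by fun_prop)
  exact isCompact_Icc.exists_isMaxOn ⟨0, by simp⟩ hc.continuousOn

/-- The fraction of the reserves at which exploration starts, for unexplored area `x`. -/
def argmaxSlope (h : p.Regular) (x R : ℝ) : ℝ := (h.exists_argmax_slope x R).choose

lemma argmaxSlope_mem (h : p.Regular) (x R : ℝ) : h.argmaxSlope x R ∈ Icc (0:ℝ) 1 :=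
  (h.exists_argmax_slope x R).choose_spec.1

lemma argmaxSlope_max (h : p.Regular) (x R : ℝ) : ∀ t' ∈ Icc (0:ℝ) 1,
    p.surplusSlope 0 x (t' * R) ≤ p.surplusSlope 0 x (h.argmaxSlope x R * R) :=
  (h.exists_argmax_slope x R).choose_spec.2

lemma mul_slope_eq (h : p.Regular) (hR : 0 ≤ R) :
    x * p.surplusSlope 0 x R = p.surplus (p.M p.limitValue x) R := by
  have := h.sub_mul_surplusSlope 0 x R
  rwa [h.surplus_M_zero hR, sub_zero, sub_zero] at this

lemma surplus_eq_max_of_slope_max (h : p.Regular) (hx : 0 ≤ x) (hR : 0 ≤ R) {t : ℝ}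
    (ht : t ∈ Icc (0:ℝ) 1) (hmax : ∀ t' ∈ Icc (0:ℝ) 1,
      p.surplusSlope 0 x (t' * R) ≤ p.surplusSlope 0 x (t * R)) :
    p.surplus (p.M p.limitValue x) (t * R) = p.maxSurplus (p.M p.limitValue x) R := by
  have hc := h.candidate_limit.continuous_M_slice h x
  refine le_antisymm (h.surplus_le_maxSurplus hc (mul_nonneg ht.1 hR)
    (mul_le_of_le_one_left hR ht.2)) (h.maxSurplus_le hc hR fun R' hR' => ?_)
  rw [← h.mul_slope_eq hR'.1, ← h.mul_slope_eq (mul_nonneg ht.1 hR)]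
  refine mul_le_mul_of_nonneg_left ?_ hx
  rcases eq_or_lt_of_le hR with rfl | hR0
  · rw [le_antisymm hR'.2 hR'.1, mul_zero]
  · have := hmax (R' / R) ⟨div_nonneg hR'.1 hR, (div_le_one hR0).2 hR'.2⟩
    rwa [div_mul_cancel₀ _ hR0.ne'] at this

/-- For x > 0 the maximizing level is unique by the strict shape inequality. At x = 0 it may not be,
but the maximized quantity is then the derivative itself. -/
lemma surplusDeriv_eq_of_slope_max (h : p.Regular) (hx : 0 ≤ x) (hR : 0 ≤ R) {t : ℝ}
    (ht : t ∈ Icc (0:ℝ) 1) (hmax : ∀ t' ∈ Icc (0:ℝ) 1,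
      p.surplusSlope 0 x (t' * R) ≤ p.surplusSlope 0 x (t * R)) :
    p.surplusDeriv x (t * R) = p.surplusDeriv x (h.argmaxSlope x R * R) := by
  have ht0 := h.argmaxSlope_mem x R
  have hmax0 := h.argmaxSlope_max x R
  rcases eq_or_lt_of_le hx with rfl | hx0
  · rw [← surplusSlope_self, ← surplusSlope_self]
    exact le_antisymm (hmax0 t ht) (hmax _ ht0)
  · have e1 := h.surplus_eq_max_of_slope_max hx hR ht hmax
    have e2 := h.surplus_eq_max_of_slope_max hx hR ht0 hmax0
    have hP := h.candidate_limit.profile_M h hx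
    have hs := fun R₁ R₂ => h.candidate_limit.shape_M_strict h hx0 (R₁ := R₁) (R₂ := R₂)
    congr 1
    rcases lt_trichotomy (t * R) (h.argmaxSlope x R * R) with hlt | heq | hgt
    · exact (hP.eq_of_surplus_eq h hs (mul_nonneg ht.1 hR) hlt
        (mul_le_of_le_one_left hR ht0.2) e1 e2).elim
    · exact heq
    · exact (hP.eq_of_surplus_eq h hs (mul_nonneg ht0.1 hR) hgt
        (mul_le_of_le_one_left hR ht.2) e2 e1).elim

lemma continuousOn_argmax_deriv (h : p.Regular) : ContinuousOn
    (fun z : ℝ × ℝ => p.surplusDeriv z.1 (h.argmaxSlope z.1 z.2 * z.2)) (Ici 0 ×ˢ Ici 0) := by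
  intro z₀ hz₀
  refine tendsto_of_isMaxOn (τ := fun z : ℝ × ℝ => h.argmaxSlope z.1 z.2)
    (Φ := fun w : (ℝ × ℝ) × ℝ => p.surplusSlope 0 w.1.1 (w.2 * w.1.2))
    (f := fun w : (ℝ × ℝ) × ℝ => p.surplusDeriv w.1.1 (w.2 * w.1.2)) ?_ ?_
    (fun z _ => h.argmaxSlope_mem z.1 z.2) (fun z _ => h.argmaxSlope_max z.1 z.2)
    fun t ht hmax => h.surplusDeriv_eq_of_slope_max hz₀.1 hz₀.2 ht hmax
  · exact (h.continuous_surplusSlope 0).comp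
      (f := fun w : (ℝ × ℝ) × ℝ => (w.1.1, w.2 * w.1.2)) (by fun_prop)
  · exact h.continuous_surplusDeriv.comp
      (f := fun w : (ℝ × ℝ) × ℝ => (w.1.1, w.2 * w.1.2)) (by fun_prop)

/-- Envelope theorem for the surplus. -/
lemma hasDerivWithinAt_maxSurplus (h : p.Regular) (hx : 0 ≤ x) (hR : 0 ≤ R) :
    HasDerivWithinAt (fun y => p.maxSurplus (p.M p.limitValue y) R)
      (p.surplusDeriv x (h.argmaxSlope x R * R)) (Ici 0) x := by
  rw [hasDerivWithinAt_iff_tendsto_slope]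
  set d := p.surplusDeriv x (h.argmaxSlope x R * R) with hd
  set ρ := fun y => h.argmaxSlope y R * R with hρ
  have hup : Filter.Tendsto (fun y => p.surplusSlope x y (ρ y)) (nhdsWithin x (Ici 0))
      (nhds d) := by
    refine tendsto_of_isMaxOn (τ := fun y : ℝ => h.argmaxSlope y R)
      (Φ := fun w : ℝ × ℝ => p.surplusSlope 0 w.1 (w.2 * R))
      (f := fun w : ℝ × ℝ => p.surplusSlope x w.1 (w.2 * R)) ?_ ?_
      (fun y _ => h.argmaxSlope_mem y R) (fun y _ => h.argmaxSlope_max y R) fun t ht hmax => ?_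
    · exact (h.continuous_surplusSlope 0).comp
        (f := fun w : ℝ × ℝ => (w.1, w.2 * R)) (by fun_prop)
    · exact (h.continuous_surplusSlope x).comp
        (f := fun w : ℝ × ℝ => (w.1, w.2 * R)) (by fun_prop)
    · rw [surplusSlope_self]
      exact h.surplusDeriv_eq_of_slope_max hx hR ht hmax
  have hlo : Filter.Tendsto (fun y => p.surplusSlope x y (ρ x)) (nhdsWithin x (Ici 0))
      (nhds d) := by
    have hc : Continuous fun y => p.surplusSlope x y (ρ x) :=
      (h.continuous_surplusSlope x).comp (f := fun y => (y, ρ x)) (by fun_prop)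
    have := hc.tendsto x
    rw [surplusSlope_self] at this
    exact this.mono_left nhdsWithin_le_nhds
  have hsub : nhdsWithin x (Ici 0 \ {x}) ≤ nhdsWithin x (Ici 0) :=
    nhdsWithin_mono x sdiff_subset
  have hmin := (hlo.min hup).mono_left hsub
  have hmx := (hlo.max hup).mono_left hsub
  rw [min_self] at hmin
  rw [max_self] at hmx
  have hρ0 : ∀ y, ρ y ∈ Icc 0 R := fun y => ⟨mul_nonneg (h.argmaxSlope_mem y R).1 hR,
    mul_le_of_le_one_left hR (h.argmaxSlope_mem y R).2⟩
  have hval : ∀ y, 0 ≤ y → p.maxSurplus (p.M p.limitValue y) R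
      = p.surplus (p.M p.limitValue y) (ρ y) := fun y hy =>
    (h.surplus_eq_max_of_slope_max hy hR (h.argmaxSlope_mem y R) (h.argmaxSlope_max y R)).symm
  -- Keeping the optimal level of x bounds the increment from below, and using that of y bounds it
  -- from above. Both average slopes tend to d as y → x.
  have hbd : ∀ y, 0 ≤ y → (y - x) * p.surplusSlope x y (ρ x)
        ≤ p.maxSurplus (p.M p.limitValue y) R - p.maxSurplus (p.M p.limitValue x) R ∧
      p.maxSurplus (p.M p.limitValue y) R - p.maxSurplus (p.M p.limitValue x) R
        ≤ (y - x) * p.surplusSlope x y (ρ y) := by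
    intro y hy
    have h1 := h.surplus_le_maxSurplus (h.candidate_limit.continuous_M_slice h y)
      (hρ0 x).1 (hρ0 x).2
    have h2 := h.surplus_le_maxSurplus (h.candidate_limit.continuous_M_slice h x)
      (hρ0 y).1 (hρ0 y).2
    rw [h.sub_mul_surplusSlope, h.sub_mul_surplusSlope]
    constructor
    · rw [hval x hx]; linarith
    · rw [hval y hy]; linarith
  refine tendsto_of_tendsto_of_tendsto_of_le_of_le' hmin hmx ?_ ?_
  all_goals
    filter_upwards [self_mem_nhdsWithin] with y hy
    obtain ⟨hb1, hb2⟩ := hbd y hy.1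
    have hyx : y ≠ x := fun hyx => hy.2 hyx
    rw [slope_def_field]
    rcases lt_or_gt_of_ne hyx with hlt | hgt
  · refine (min_le_right _ _).trans ?_
    rw [le_div_iff_of_neg (by linarith)]; linarith
  · refine (min_le_left _ _).trans ?_
    rw [le_div_iff₀ (by linarith)]; linarith
  · refine le_trans ?_ (le_max_left _ _)
    rw [div_le_iff_of_neg (by linarith)]; linarith
  · refine le_trans ?_ (le_max_right _ _)
    rw [div_le_iff₀ (by linarith)]; linarith

lemma hasDerivWithinAt_limitValue_left (h : p.Regular) (hx : 0 ≤ x) (hR : 0 < R) :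
    HasDerivWithinAt (fun y => p.limitValue y R)
      (p.marginal (R + p.maxSurplus (p.M p.limitValue x) R)
        * p.surplusDeriv x (h.argmaxSlope x R * R)) (Ici 0) x := by
  have hm := h.maxSurplus_nonneg (h.candidate_limit.continuous_M_slice h x)
    (h.candidate_limit.M_nonneg h hx le_rfl) hR.le
  have := (h.hasDerivAt_hotelling (by linarith :
    0 < R + p.maxSurplus (p.M p.limitValue x) R)).comp_hasDerivWithinAt x
      ((h.hasDerivWithinAt_maxSurplus hx hR.le).const_add R)
  exact this.congr (fun y hy => h.limitValue_eq_stopValue hy hR.le) (h.limitValue_eq_stopValue hx hR.le)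

lemma differentiableOn_limitValue_left (h : p.Regular) (hR : 0 ≤ R) :
    DifferentiableOn ℝ (fun y => p.limitValue y R) (Ici 0) := by
  intro x hx
  rcases eq_or_lt_of_le hR with rfl | hR0
  · exact (h.hasDerivAt_M_left h.continuous_limitValue x 0).hasDerivWithinAt.differentiableWithinAt.congr
      (fun y hy => h.limitValue_zero_right hy) (h.limitValue_zero_right hx)
  · exact (h.hasDerivWithinAt_limitValue_left hx hR0).differentiableWithinAt

/-- Without net gain from a deposit found with empty reserves, exploration is useless. -/
lemma limitValue_eq_hotelling (h : p.Regular) (heq : p.k / p.lam = p.hotelling p.a) (hx : 0 ≤ x)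
    (hR : 0 ≤ R) : p.limitValue x R = p.hotelling R := by
  refine le_antisymm ?_ (h.candidate_limit.hotelling_le x R hx hR)
  have key : ∀ n x R, 0 ≤ x → 0 ≤ R → (p.approx n).1 x R ≤ p.hotelling R := by
    intro n
    induction n with
    | zero => intro x R _ _; exact le_rfl
    | succ n ih =>
      intro x R hx hR
      have hc := h.candidate_approx n
      simp only [Params.approx, Params.stopValue]
      refine h.hotelling_mono ?_ ?_
      · linarith [h.maxSurplus_nonneg (hc.continuous_M_slice h x) (hc.M_nonneg h hx le_rfl) hR]
      suffices p.maxSurplus (p.M (p.approx n).1 x) R ≤ 0 by linarith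
      refine h.maxSurplus_le (hc.continuous_M_slice h x) hR fun R' hR' => ?_
      have h1 : p.M (p.approx n).1 x R' ≤ p.hotelling R' := by
        have h2 := discovery_mono (p := p) (W₁ := (p.approx n).1) (W₂ := fun _ R => p.hotelling R)
          h.lam_pos hx (hc.intervalIntegrable x R')
          (by apply Continuous.intervalIntegrable; fun_prop)
          fun y hy => ih y _ hy.1 (by linarith [hR'.1, h.a_pos])
        rw [discovery_right] at h2
        have h3 := h.hotelling_add_le hR'.1 h.a_pos.le
        have h4 := h.exp_le_one hx
        have e : p.k * ((1 - Real.exp (-p.lam * x)) / p.lam)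
            = (1 - Real.exp (-p.lam * x)) * (p.k / p.lam) := by ring
        rw [M_eq_discovery, e, heq]
        nlinarith
      have h5 := h.certain_mono (hc.M_nonneg h hx hR'.1) h1
      rw [h.certain_hotelling hR'.1] at h5
      simpa [Params.surplus] using h5
  exact le_of_tendsto' (h.tendsto_approx hx hR) fun n => key n x R hx hR

/-- With a net gain, small reserves call for exploration at once. -/
lemma exists_limitValue_eq_M (h : p.Regular) (hlt : p.k / p.lam < p.hotelling p.a) (X : ℝ) :
    ∃ δ > 0, ∀ x R, 0 ≤ x → x ≤ X → 0 ≤ R → R < δ →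
      p.limitValue x R = p.M p.limitValue x R := by
  have hl := h.lam_pos
  have h1α := h.one_sub_pos
  set γ := 1 / (1 - p.α) with hγ
  have hγ0 : 0 < γ := by positivity
  set β := p.α * γ with hβ
  have hβ0 : 0 < β := mul_pos h.α_pos hγ0
  set η := p.hotelling p.a - p.k / p.lam with hη
  have hη0 : 0 < η := by linarith
  -- C bounds `(exp (β y) - exp (-y)) / (1 - exp (-y))` for 0 < y ≤ λX, through `exp (β y) - 1 ≤ β y
  -- exp (β y)` and `y ≤ exp y (1 - exp (-y))`. As it does not degenerate when y → 0, δ does not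
  -- depend on x.
  set C := 1 + β * Real.exp (β * (p.lam * X)) * Real.exp (p.lam * X) with hC
  have hC0 : 0 < C := by positivity
  have hev : ∀ᶠ R in nhds (0:ℝ), p.hotelling R < η / C := by
    have := h.continuous_hotelling.tendsto 0
    rw [h.hotelling_zero] at this
    exact this.eventually (gt_mem_nhds (by positivity))
  obtain ⟨δ, hδ, hball⟩ := Metric.eventually_nhds_iff.1 hev
  refine ⟨δ, hδ, fun x R hx hxX hR hRδ => ?_⟩
  have hU : p.hotelling R < η / C := hball (by rwa [Real.dist_eq, sub_zero, abs_of_nonneg hR])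
  rcases eq_or_lt_of_le hR with rfl | hR0
  · exact h.limitValue_zero_right hx
  have hP := h.candidate_limit.profile_M h hx
  rw [h.limitValue_eq_stopValue hx hR]
  refine hP.stopValue_eq_of_le h hR0 ?_
  set y := p.lam * x with hy
  have hy0 : 0 ≤ y := by positivity
  have hyX : y ≤ p.lam * X := by rw [hy]; gcongr
  -- Dropping the discoveries bounds the marginal value of exploring from below by the Hotelling one
  -- at `R exp (γ y)`. It then suffices that exploring is worth 𝒰(R exp (γ y)) = exp (β y) 𝒰(R). The
  -- lower bound `M_ge` contains the gain η (1 - exp (-y)), which suffices when C 𝒰(R) ≤ η.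
  have hge : p.marginal (R * Real.exp (γ * y)) ≤ p.marginalM p.limitDeriv x R := by
    have e : p.marginal (R * Real.exp (γ * y)) = p.marginal R * Real.exp (-p.lam * x) := by
      unfold Params.marginal
      rw [← mul_assoc, Real.mul_rpow (mul_pos h.rate_pos hR0).le (Real.exp_pos _).le,
        ← Real.exp_mul]
      congr 2
      rw [hγ, hy]
      field_simp
      ring
    rw [e]
    unfold Params.marginalM
    linarith [h.candidate_limit.discovery_nonneg h hx hR]
  have hRe : 0 < R * Real.exp (γ * y) := by positivity
  have h2 := h.marginalInv_anti (h.marginal_pos hRe) hge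
  rw [h.marginalInv_marginal hRe] at h2
  refine h2.trans ?_
  have h3 : p.hotelling (R * Real.exp (γ * y)) ≤ p.M p.limitValue x R := by
    refine le_trans ?_ (h.M_ge hx (h.candidate_limit.intervalIntegrable x R)
      fun z hz => h.candidate_limit.hotelling_le z _ hz.1 (by linarith [h.a_pos]))
    have e : p.hotelling (R * Real.exp (γ * y)) = Real.exp (β * y) * p.hotelling R := by
      rw [mul_comm R, hotelling_mul (Real.exp_pos _).le hR, ← Real.exp_mul, hβ]
      ring_nf
    rw [e]
    have e2 : -p.lam * x = -y := by rw [hy]; ring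
    rw [e2]
    have h4 := h.hotelling_mono h.a_pos.le (by linarith : p.a ≤ R + p.a)
    have h5 : 0 ≤ 1 - Real.exp (-y) := by
      rw [sub_nonneg, Real.exp_le_one_iff]; linarith
    have h6 : Real.exp (β * y) - 1 ≤ β * y * Real.exp (β * y) := by
      have h7 := Real.add_one_le_exp (-(β * y))
      have h8 : Real.exp (-(β * y)) * Real.exp (β * y) = 1 := by rw [← Real.exp_add]; simp
      nlinarith [Real.exp_pos (β * y)]
    have h9 : y ≤ Real.exp y * (1 - Real.exp (-y)) := by
      have h7 := Real.add_one_le_exp y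
      have h8 : Real.exp y * Real.exp (-y) = 1 := by rw [← Real.exp_add]; simp
      nlinarith
    have h10 : Real.exp (β * y) - Real.exp (-y) ≤ C * (1 - Real.exp (-y)) := by
      have a1 : Real.exp (β * y) ≤ Real.exp (β * (p.lam * X)) := by gcongr
      have a2 : Real.exp y ≤ Real.exp (p.lam * X) := by gcongr
      have a3 : β * y * Real.exp (β * y) ≤ β * (Real.exp (p.lam * X) * (1 - Real.exp (-y)))
          * Real.exp (β * (p.lam * X)) := by
        gcongr
        exact h9.trans (mul_le_mul_of_nonneg_right a2 h5)
      rw [hC]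
      linarith
    have h11 : p.hotelling R * C ≤ η := by rw [lt_div_iff₀ hC0] at hU; exact hU.le
    have h12 := h.hotelling_nonneg hR
    have h13 := mul_le_mul_of_nonneg_left h10 h12
    have h14 := mul_le_mul_of_nonneg_right h11 h5
    have h15 := mul_le_mul_of_nonneg_left
      (by linarith : η ≤ p.hotelling (R + p.a) - p.k / p.lam) h5
    linarith
  have h4 := h.certain_mono (h.hotelling_nonneg hRe.le) h3
  rwa [h.certain_hotelling hRe.le] at h4

/-- The envelope formula serves for R > 0. Its factor `marginal (R + m)` may blow up as R → 0, for
instance at x = 0 where m vanishes, so near R = 0 the identity V = M V is used, or V = 𝒰 if a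
deposit brings no net gain. -/
lemma continuousOn_derivWithin_limitValue (h : p.Regular) : ContinuousOn
    (fun z : ℝ × ℝ => derivWithin (fun x => p.limitValue x z.2) (Ici 0) z.1)
    (Ici 0 ×ˢ Ici 0) := by
  rcases eq_or_lt_of_le h.cost_le with heq | hlt
  · refine continuousOn_const (c := (0:ℝ)).congr fun z hz => ?_
    rw [derivWithin_congr (x := z.1) (s := Ici 0) (f := fun _ : ℝ => p.hotelling z.2)
      (fun x hx => h.limitValue_eq_hotelling heq hx hz.2)
      (h.limitValue_eq_hotelling heq hz.1 hz.2)]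
    simp
  rintro ⟨x₀, R₀⟩ ⟨hx₀, hR₀⟩
  simp only [mem_Ici] at hx₀ hR₀
  rcases eq_or_lt_of_le hR₀ with rfl | hR₀'
  · obtain ⟨δ, hδ, heq⟩ := h.exists_limitValue_eq_M hlt (x₀ + 1)
    have hV := h.continuous_limitValue
    have hM := h.continuous_M hV
    have hcont : Continuous fun z : ℝ × ℝ =>
        p.lam * (p.limitValue z.1 (z.2 + p.a) - p.M p.limitValue z.1 z.2) - p.k :=
      (continuous_const.mul ((hV.comp (f := fun z : ℝ × ℝ => (z.1, z.2 + p.a))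
        (by fun_prop)).sub hM)).sub continuous_const
    have hz : ∀ z ∈ Ici (0:ℝ) ×ˢ Ici (0:ℝ), z.1 < x₀ + 1 → z.2 < δ →
        derivWithin (fun x => p.limitValue x z.2) (Ici 0) z.1
          = p.lam * (p.limitValue z.1 (z.2 + p.a) - p.M p.limitValue z.1 z.2) - p.k := by
      intro z hz hz1 hz2
      have hd := (h.hasDerivAt_M_left hV z.1 z.2).hasDerivWithinAt (s := Ici 0)
      refine HasDerivWithinAt.derivWithin (hd.congr_of_eventuallyEq ?_
        (heq z.1 z.2 hz.1 hz1.le hz.2 hz2)) (uniqueDiffOn_Ici 0 z.1 hz.1)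
      filter_upwards [self_mem_nhdsWithin, mem_nhdsWithin_of_mem_nhds (Iio_mem_nhds hz1)]
        with x hx hx1
      exact heq x z.2 hx (le_of_lt hx1) hz.2 hz2
    refine hcont.continuousWithinAt.congr_of_eventuallyEq ?_
      (hz (x₀, 0) ⟨hx₀, by simp⟩ (by simp) hδ)
    have h1 : {w : ℝ × ℝ | w.1 < x₀ + 1} ∈ nhds (x₀, (0:ℝ)) :=
      (isOpen_lt continuous_fst continuous_const).mem_nhds (by simp)
    have h2 : {w : ℝ × ℝ | w.2 < δ} ∈ nhds (x₀, (0:ℝ)) :=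
      (isOpen_lt continuous_snd continuous_const).mem_nhds (by simpa using hδ)
    filter_upwards [self_mem_nhdsWithin, mem_nhdsWithin_of_mem_nhds h1,
      mem_nhdsWithin_of_mem_nhds h2] with z hz0 hz1 hz2
    exact hz z hz0 hz1 hz2
  · have hz : ∀ z ∈ Ici (0:ℝ) ×ˢ Ioi (0:ℝ), derivWithin (fun x => p.limitValue x z.2) (Ici 0) z.1
        = p.marginal (z.2 + p.maxSurplus (p.M p.limitValue z.1) z.2)
          * p.surplusDeriv z.1 (h.argmaxSlope z.1 z.2 * z.2) := fun z hz =>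
      (h.hasDerivWithinAt_limitValue_left hz.1 hz.2).derivWithin (uniqueDiffOn_Ici 0 z.1 hz.1)
    have hc1 : ContinuousWithinAt (fun z : ℝ × ℝ => p.marginal
        (z.2 + p.maxSurplus (p.M p.limitValue z.1) z.2)) (Ici 0 ×ˢ Ici 0) (x₀, R₀) := by
      have hpos : 0 < R₀ + p.maxSurplus (p.M p.limitValue x₀) R₀ := by
        linarith [h.maxSurplus_nonneg (h.candidate_limit.continuous_M_slice h x₀)
          (h.candidate_limit.M_nonneg h hx₀ le_rfl) hR₀]
      have h3 : ContinuousAt p.marginal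
          ((fun z : ℝ × ℝ => z.2 + p.maxSurplus (p.M p.limitValue z.1) z.2) (x₀, R₀)) :=
        h.continuousOn_marginal.continuousAt (Ioi_mem_nhds hpos)
      exact (ContinuousAt.comp (g := p.marginal) (f := fun z : ℝ × ℝ =>
        z.2 + p.maxSurplus (p.M p.limitValue z.1) z.2) h3 (continuous_snd.add (h.continuous_maxSurplus
        (h.continuous_M h.continuous_limitValue))).continuousAt).continuousWithinAt
    have hc := hc1.mul (h.continuousOn_argmax_deriv (x₀, R₀) ⟨hx₀, hR₀⟩)
    refine hc.congr_of_eventuallyEq ?_ (hz (x₀, R₀) ⟨hx₀, hR₀'⟩)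
    have h2 : {w : ℝ × ℝ | 0 < w.2} ∈ nhds (x₀, R₀) :=
      (isOpen_lt continuous_const continuous_snd).mem_nhds (by simpa using hR₀')
    filter_upwards [self_mem_nhdsWithin, mem_nhdsWithin_of_mem_nhds h2] with z hz0 hz2
    exact hz z ⟨hz0.1, hz2⟩

end Params.Regular

/-! ### Uniqueness for the HJB equation -/

namespace SolvesHJB

variable {p : Params} {W : ℝ → ℝ → ℝ} {x R : ℝ}

lemma M_le (hW : SolvesHJB p W) (hx : 0 ≤ x) (hR : 0 ≤ R) : p.M W x R ≤ W x R := by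
  rcases eq_or_lt_of_le hR with rfl | hR0
  · have := (le_max_right _ _).trans (hW.boundary x hx).le
    linarith
  · have := (le_max_right _ _).trans (hW.interior x R hx hR0).le
    rw [← EReal.coe_zero, EReal.coe_le_coe_iff] at this
    linarith

/-- The equation with its extended values removed: a nonpositive derivative would give u* = ⊤, and
for a positive one u* is r times a Hotelling value. -/
lemma hotelling_marginalInv_deriv (h : p.Regular) (hW : SolvesHJB p W) (hx : 0 ≤ x) (hR : 0 < R) :
    0 < deriv (W x) R ∧ p.hotelling (p.marginalInv (deriv (W x) R)) ≤ W x R ∧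
      (p.M W x R < W x R → p.hotelling (p.marginalInv (deriv (W x) R)) = W x R) := by
  have hint := hW.interior x R hx hR
  have hpos : 0 < deriv (W x) R := by
    by_contra! hneg
    have := (le_max_left _ _).trans hint.le
    rw [h.uStar_of_nonpos hneg, EReal.top_sub_coe] at this
    simp at this
  rw [h.uStar_eq_of_pos hpos, ← EReal.coe_sub, ← EReal.coe_strictMono.monotone.map_max,
    ← EReal.coe_zero, EReal.coe_eq_coe_iff] at hint
  have hr := h.r_pos
  refine ⟨hpos, ?_, fun hlt => ?_⟩
  · have := (le_max_left _ _).trans hint.le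
    rw [← mul_sub] at this
    linarith [nonpos_of_mul_nonpos_right this hr]
  · rcases max_choice (p.r * p.hotelling (p.marginalInv (deriv (W x) R)) - p.r * W x R)
      (p.M W x R - W x R) with hc | hc
    · rw [hc, ← mul_sub] at hint
      rcases mul_eq_zero.1 hint with h0 | h0
      · exact absurd h0 hr.ne'
      · linarith
    · rw [hc] at hint; linarith

lemma pos (h : p.Regular) (hW : SolvesHJB p W) (hx : 0 ≤ x) (hR : 0 < R) : 0 < W x R := by
  obtain ⟨h1, h2, _⟩ := hW.hotelling_marginalInv_deriv h hx hR
  exact (h.hotelling_pos (h.marginalInv_pos h1)).trans_le h2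

lemma hasDerivAt_surplus (h : p.Regular) (hW : SolvesHJB p W) (hx : 0 ≤ x) (hR : 0 < R) :
    HasDerivAt (p.surplus (W x))
      ((p.marginal (p.certain (W x R)))⁻¹ * deriv (W x) R - 1) R :=
  ((h.hasDerivAt_certain (hW.pos h hx hR)).comp R
    (hW.differentiableAt x R hx hR).hasDerivAt).sub (hasDerivAt_id R)

lemma continuousOn_surplus (h : p.Regular) (hW : SolvesHJB p W) (hx : 0 ≤ x) :
    ContinuousOn (p.surplus (W x)) (Ici 0) :=
  (h.continuous_certain.comp_continuousOn (hW.continuousOn x hx)).sub continuousOn_id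

/-- The inequality u*(∂W/∂R) ≤ rW means that ∂W/∂R is at least 𝒰' at the certain equivalent of W,
that is, 𝒰⁻¹(W) has slope at least 1 in R. -/
lemma surplus_monotoneOn (h : p.Regular) (hW : SolvesHJB p W) (hx : 0 ≤ x) :
    MonotoneOn (p.surplus (W x)) (Ici 0) := by
  refine monotoneOn_of_deriv_nonneg (convex_Ici 0) (hW.continuousOn_surplus h hx) ?_ ?_
  all_goals
    rw [interior_Ici]
    intro R hR
    have hR0 : (0:ℝ) < R := hR
  · exact (hW.hasDerivAt_surplus h hx hR0).differentiableAt.differentiableWithinAt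
  · rw [(hW.hasDerivAt_surplus h hx hR0).deriv]
    obtain ⟨h1, h2, _⟩ := hW.hotelling_marginalInv_deriv h hx hR0
    have hZ := h.marginalInv_pos h1
    have hS := h.certain_pos (hW.pos h hx hR0)
    have h3 := h.certain_mono (h.hotelling_nonneg hZ.le) h2
    rw [h.certain_hotelling hZ.le] at h3
    have h4 := h.marginal_anti hZ h3
    rw [h.marginal_marginalInv h1] at h4
    rw [sub_nonneg, le_inv_mul_iff₀ (h.marginal_pos hS), mul_one]
    exact h4

lemma hotelling_le (h : p.Regular) (hW : SolvesHJB p W) (hx : 0 ≤ x) (hW0 : 0 ≤ W x 0)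
    (hR : 0 ≤ R) : p.hotelling R ≤ W x R := by
  rcases eq_or_lt_of_le hR with rfl | hR0
  · rwa [h.hotelling_zero]
  have h1 := hW.surplus_monotoneOn h hx (mem_Ici.2 le_rfl) (mem_Ici.2 hR) hR
  have h2 := h.certain_nonneg hW0
  simp only [Params.surplus] at h1
  have h3 := h.hotelling_mono hR (by linarith : R ≤ p.certain (W x R))
  rwa [h.hotelling_certain (hW.pos h hx hR0).le] at h3

lemma continuousOn_M (h : p.Regular) (hW : SolvesHJB p W) (hx : 0 ≤ x)
    (hnn : ∀ y R, 0 ≤ y → 0 ≤ R → 0 ≤ W y R) {C : ℝ}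
    (hC : ∀ y R, 0 ≤ y → y ≤ x → 0 ≤ R → W y R ≤ C * (1 + p.hotelling R)) :
    ContinuousOn (p.M W x) (Ici 0) := by
  have hC0 : 0 ≤ C := by
    have := (hnn 0 0 le_rfl le_rfl).trans (hC 0 0 le_rfl hx le_rfl)
    rwa [h.hotelling_zero, add_zero, mul_one] at this
  have hd : ContinuousOn (p.discovery W x) (Ici 0) := by
    intro R₀ hR₀
    have hR₀' : (0:ℝ) ≤ R₀ := hR₀
    refine intervalIntegral.continuousWithinAt_of_dominated_interval
      (bound := fun _ => C * (1 + p.hotelling (R₀ + 1 + p.a)) * p.lam) ?_ ?_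
      (by apply Continuous.intervalIntegrable; fun_prop) ?_
    · filter_upwards [self_mem_nhdsWithin] with R hR
      have := (hW.integrable x R hx hR).aestronglyMeasurable
      rwa [uIoc_of_le hx]
    · filter_upwards [self_mem_nhdsWithin,
        mem_nhdsWithin_of_mem_nhds (Iio_mem_nhds (by linarith : R₀ < R₀ + 1))] with R hR hR1
      have hR' : (0:ℝ) ≤ R := hR
      have hR1' : R < R₀ + 1 := hR1
      have ha := h.a_pos
      refine Filter.Eventually.of_forall fun s hs => ?_
      rw [uIoc_of_le hx] at hs
      have h0 : 0 ≤ x - s := by linarith [hs.2]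
      have h1 := hC (x - s) (R + p.a) h0 (by linarith [hs.1]) (by linarith)
      have h2 := h.hotelling_mono (by linarith) (by linarith : R + p.a ≤ R₀ + 1 + p.a)
      have h3 := hnn (x - s) (R + p.a) h0 (by linarith)
      have h4 := Real.exp_pos (-p.lam * s)
      rw [Real.norm_eq_abs, abs_of_nonneg (mul_nonneg h3 (mul_nonneg h.lam_pos.le h4.le))]
      refine mul_le_mul (h1.trans ?_) (mul_le_of_le_one_right h.lam_pos.le (h.exp_le_one hs.1.le))
        (mul_nonneg h.lam_pos.le h4.le)
        (mul_nonneg hC0 (by linarith [h.hotelling_nonneg (by linarith : 0 ≤ R₀ + 1 + p.a)]))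
      gcongr
    · refine Filter.Eventually.of_forall fun s hs => ?_
      rw [uIoc_of_le hx] at hs
      have hc := hW.continuousOn (x - s) (by linarith [hs.2])
      have : ContinuousOn (fun R => W (x - s) (R + p.a)) (Ici 0) :=
        hc.comp (f := fun R => R + p.a) (by fun_prop) fun R hR => by
          have : (0:ℝ) ≤ R := hR
          exact mem_Ici.2 (by linarith [h.a_pos])
      exact (this R₀ hR₀).mul continuousWithinAt_const
  exact (hd.add (h.continuous_hotelling.continuousOn.mul continuousOn_const)).sub continuousOn_const

/-- A solution of the HJB equation is a fixed point of optimal depletion before exploration. -/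
lemma eq_stopValue (h : p.Regular) (hW : SolvesHJB p W) (hx : 0 ≤ x) (hW0 : 0 ≤ W x 0)
    (hc : ContinuousOn (p.M W x) (Ici 0)) (hM : ∀ R, 0 ≤ R → 0 ≤ p.M W x R) (hR : 0 ≤ R) :
    W x R = p.stopValue (fun R => p.M W x (max R 0)) R := by
  set G : ℝ → ℝ := fun R => p.M W x (max R 0) with hG
  have hGc : Continuous G := hc.comp_continuous (by fun_prop) fun R => mem_Ici.2 (le_max_right _ _)
  have hGR : ∀ R, 0 ≤ R → G R = p.M W x R := fun R hR => by simp only [hG]; rw [max_eq_left hR]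
  have hmono := hW.surplus_monotoneOn h hx
  have hWnn : ∀ R, 0 ≤ R → 0 ≤ W x R := fun R hR =>
    (h.hotelling_nonneg hR).trans (hW.hotelling_le h hx hW0 hR)
  have hle : ∀ R, 0 ≤ R → p.surplus G R ≤ p.surplus (W x) R := by
    intro R hR
    simp only [Params.surplus]
    rw [hGR R hR]
    linarith [h.certain_mono (hM R hR) (hW.M_le hx hR)]
  suffices p.maxSurplus G R = p.surplus (W x) R by
    rw [Params.stopValue, this, Params.surplus, add_sub_cancel, h.hotelling_certain (hWnn R hR)]
  refine le_antisymm (h.maxSurplus_le hGc hR fun R' hR' =>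
    (hle R' hR'.1).trans (hmono hR'.1 hR hR'.2)) ?_
  -- The running maximum is reached at the last level `R₀ ≤ R` where exploring at once is optimal.
  -- Such a level exists because R = 0 is one.
  have hne : (Icc 0 R ∩ {y | W x y - G y ≤ 0}).Nonempty := by
    refine ⟨0, ⟨le_rfl, hR⟩, ?_⟩
    simp only [mem_ofPred_eq]
    rw [hGR 0 le_rfl]
    -- If the first term of the boundary condition vanishes, then W(x, 0) = 0, which is at most M
    -- W(x, 0) ≥ 0; otherwise the two are equal.
    rcases max_choice (0 - p.r * W x 0) (p.M W x 0 - W x 0) with hc | hc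
    · have hb := hW.boundary x hx
      rw [hc] at hb
      have : W x 0 = 0 := by
        rcases mul_eq_zero.1 (by linarith : p.r * W x 0 = 0) with h0 | h0
        · exact absurd h0 h.r_pos.ne'
        · exact h0
      linarith [hM 0 le_rfl]
    · have hb := hW.boundary x hx
      rw [hc] at hb
      linarith
  have hclosed : IsCompact (Icc 0 R ∩ {y | W x y - G y ≤ 0}) := by
    have : ContinuousOn (fun y => W x y - G y) (Icc 0 R) :=
      ((hW.continuousOn x hx).mono Icc_subset_Ici_self).sub hGc.continuousOn
    exact isCompact_Icc.of_isClosed_subset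
      (this.preimage_isClosed_of_isClosed isClosed_Icc isClosed_Iic) inter_subset_left
  obtain ⟨R₀, ⟨hR₀, hR₀le⟩, hmax⟩ := hclosed.exists_isGreatest hne
  simp only [mem_ofPred_eq] at hR₀le
  -- Beyond `R₀` the inequality M W < W is strict, so the other term of the equation vanishes and
  -- the surplus of W is stationary.
  have hanti : AntitoneOn (p.surplus (W x)) (Icc R₀ R) := by
    refine antitoneOn_of_deriv_nonpos (convex_Icc R₀ R)
      ((hW.continuousOn_surplus h hx).mono fun y hy => hR₀.1.trans hy.1) ?_ ?_
    all_goals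
      rw [interior_Icc]
      intro y hy
      have hy0 : 0 < y := hR₀.1.trans_lt hy.1
    · exact (hW.hasDerivAt_surplus h hx hy0).differentiableAt.differentiableWithinAt
    · rw [(hW.hasDerivAt_surplus h hx hy0).deriv]
      have hlt : p.M W x y < W x y := by
        by_contra! hcon
        have := hmax ⟨⟨hy0.le, hy.2.le⟩, by
          simp only [mem_ofPred_eq]; rw [hGR y hy0.le]; linarith⟩
        linarith [hy.1]
      obtain ⟨h1, -, h3⟩ := hW.hotelling_marginalInv_deriv h hx hy0
      have hZ := h.marginalInv_pos h1
      rw [← h3 hlt, h.certain_hotelling hZ.le, h.marginal_marginalInv h1,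
        inv_mul_cancel₀ h1.ne', sub_self]
  refine (hanti ⟨le_rfl, hR₀.2⟩ ⟨hR₀.2, le_rfl⟩ hR₀.2).trans ?_
  refine le_trans ?_ (h.surplus_le_maxSurplus hGc hR₀.1 hR₀.2)
  simp only [Params.surplus]
  linarith [h.certain_mono (hWnn R₀ hR₀.1) (by linarith : W x R₀ ≤ G R₀)]

end SolvesHJB

namespace Params.Regular

variable {p : Params} {x R : ℝ}

lemma limitValue_le (h : p.Regular) (hx : 0 ≤ x) (hR : 0 ≤ R) :
    p.limitValue x R ≤ p.hotelling R + p.limitValue x 0 := by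
  have hP := h.candidate_limit.profile x hx
  have : AntitoneOn (fun R => p.limitValue x R - p.hotelling R) (Ici 0) := by
    refine antitoneOn_of_deriv_nonpos (convex_Ici 0)
      (hP.continuous.sub h.continuous_hotelling).continuousOn ?_ ?_
    all_goals
      rw [interior_Ici]
      intro R hR
      have hd := (hP.hasDerivAt R hR).sub (h.hasDerivAt_hotelling hR)
    · exact hd.differentiableAt.differentiableWithinAt
    · have := hd.deriv
      simp only [Pi.sub_def] at this
      rw [this]
      linarith [hP.deriv_le_marginal h hR]
  have := this (mem_Ici.2 le_rfl) (mem_Ici.2 hR) hR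
  simp only [h.hotelling_zero] at this
  linarith

lemma hotelling_add_nat_mul_le (h : p.Regular) (hR : 0 ≤ R) (n : ℕ) :
    p.hotelling (R + n * p.a) ≤ p.hotelling R + n * p.hotelling p.a := by
  have ha := h.a_pos
  induction n with
  | zero => simp
  | succ n ih =>
    have := h.hotelling_add_le (by positivity : 0 ≤ R + n * p.a) ha.le
    push_cast
    rw [show R + ((n:ℝ) + 1) * p.a = R + n * p.a + p.a by ring]
    linarith

/-- By subadditivity 𝒰(R + na) grows at most linearly in n. Bounding n by 2ⁿ absorbs this growth
into the power, and the factorial wins. The bound kills the remainder both in the uniqueness proof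
and in the verification of the optimal strategy. -/
lemma tendsto_growth_bound (h : p.Regular) (hR : 0 ≤ R) (hx : 0 ≤ x) {C : ℝ} (hC : 0 ≤ C) :
    Filter.Tendsto (fun n : ℕ => C * (1 + p.hotelling (R + n * p.a))
      * ((p.lam * x) ^ n / n.factorial)) Filter.atTop (nhds 0) := by
  have hl := h.lam_pos
  have ha := h.a_pos
  have hUa := h.hotelling_nonneg ha.le
  have hU := h.hotelling_nonneg hR
  have lim := (FloorSemiring.tendsto_pow_div_factorial_atTop (2 * (p.lam * x))).const_mul
    (C * (1 + p.hotelling R + p.hotelling p.a))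
  rw [mul_zero] at lim
  refine squeeze_zero (fun n => ?_) (fun n => ?_) lim
  · have := h.hotelling_nonneg (by positivity : 0 ≤ R + n * p.a)
    positivity
  · have h1 := h.hotelling_add_nat_mul_le hR n
    have h2 : (n:ℝ) ≤ 2 ^ n := by exact_mod_cast (Nat.lt_two_pow_self).le
    have h3 : (1:ℝ) ≤ 2 ^ n := one_le_pow₀ (by norm_num)
    have h4 : 1 + p.hotelling (R + n * p.a) ≤ (1 + p.hotelling R + p.hotelling p.a) * 2 ^ n := by
      nlinarith
    rw [mul_pow 2, mul_div_assoc, mul_assoc C, mul_assoc C]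
    refine mul_le_mul_of_nonneg_left ?_ hC
    rw [← mul_assoc]
    exact mul_le_mul_of_nonneg_right h4 (by positivity)

/-- Uniqueness for the HJB equation. -/
lemma eq_limitValue_of_solvesHJB (h : p.Regular) {W : ℝ → ℝ → ℝ}
    (hnn : ∀ x R, 0 ≤ x → 0 ≤ R → 0 ≤ W x R) (hW : SolvesHJB p W)
    (hgrowth : ∀ x, 0 ≤ x → ∃ C : ℝ, ∀ y R, 0 ≤ y → y ≤ x → 0 ≤ R →
      W y R ≤ C * (1 + p.hotelling R)) (hx : 0 ≤ x) (hR : 0 ≤ R) :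
    W x R = p.limitValue x R := by
  have ha := h.a_pos
  obtain ⟨C, hC⟩ := hgrowth x hx
  have hC0 : 0 ≤ C := by
    have := (hnn 0 0 le_rfl le_rfl).trans (hC 0 0 le_rfl hx le_rfl)
    rwa [h.hotelling_zero, add_zero, mul_one] at this
  have hV0 := (h.candidate_limit.profile x hx).nonneg 0 le_rfl
  set C' := C + 1 + p.limitValue x 0 with hC'
  -- Each application of M evaluates the functions at reserves larger by a, so after n steps the a
  -- priori bound is taken at `R + n a`.
  have key : ∀ n : ℕ, ∀ y R, 0 ≤ y → y ≤ x → 0 ≤ R → |W y R - p.limitValue y R|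
      ≤ C' * (1 + p.hotelling (R + n * p.a)) * ((p.lam * y) ^ n / n.factorial) := by
    intro n
    induction n with
    | zero =>
      intro y R hy hyx hR
      have hU := h.hotelling_nonneg hR
      have h1 := hnn y R hy hR
      have h2 := hC y R hy hyx hR
      have h3 := (h.candidate_limit.profile y hy).nonneg R hR
      have h4 := h.limitValue_le hy hR
      have h5 := h.candidate_limit.mono 0 le_rfl (mem_Ici.2 hy) (mem_Ici.2 hx) hyx
      simp only at h5
      have h6 : p.limitValue y R ≤ (1 + p.limitValue x 0) * (1 + p.hotelling R) := by nlinarith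
      simp only [Nat.cast_zero, zero_mul, add_zero, pow_zero, Nat.factorial_zero, Nat.cast_one,
        div_one, mul_one]
      have h7 : C' * (1 + p.hotelling R)
          = C * (1 + p.hotelling R) + (1 + p.limitValue x 0) * (1 + p.hotelling R) := by
        rw [hC']; ring
      rw [abs_le, h7]
      constructor <;> linarith
    | succ n ih =>
      intro y R hy hyx hR
      have hcM := hW.continuousOn_M h hy hnn fun z R hz hzy hR => hC z R hz (hzy.trans hyx) hR
      have hWge := fun z R hz hR => hW.hotelling_le (x := z) (R := R) h hz (hnn z 0 hz le_rfl) hR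
      have hMnn : ∀ R, 0 ≤ R → 0 ≤ p.M W y R := fun R hR =>
        h.M_nonneg hy hR (hW.integrable y R hy hR) fun z hz => hWge z _ hz.1 (by linarith)
      rw [hW.eq_stopValue h hy (hnn y 0 hy le_rfl) hcM hMnn hR, h.limitValue_eq_stopValue hy hR]
      refine h.abs_stopValue_sub_le
        (hcM.comp_continuous (by fun_prop) fun R => mem_Ici.2 (le_max_right _ _))
        (h.candidate_limit.continuous_M_slice h y) (fun R _ => hMnn _ (le_max_right _ _))
        (fun R hR => h.candidate_limit.M_nonneg h hy hR) hR fun R' hR' => ?_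
      rw [max_eq_left hR'.1]
      refine h.abs_M_sub_le n hy (hW.integrable y R' hy hR'.1)
        (h.candidate_limit.intervalIntegrable y R') fun z hz => ?_
      refine (ih z (R' + p.a) hz.1 (hz.2.trans hyx) (by linarith [hR'.1])).trans ?_
      have hz' : 0 ≤ p.lam * z := mul_nonneg h.lam_pos.le hz.1
      refine mul_le_mul_of_nonneg_right ?_ (by positivity)
      refine mul_le_mul_of_nonneg_left ?_ (by rw [hC']; linarith)
      have : R' + p.a + n * p.a ≤ R + ((n + 1 : ℕ) : ℝ) * p.a := by
        push_cast; linarith [hR'.2]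
      have := h.hotelling_mono (by have := hR'.1; positivity) this
      linarith
  have lim := h.tendsto_growth_bound hR hx (by linarith : 0 ≤ C')
  have := ge_of_tendsto' lim fun n => key n x R hx le_rfl hR
  exact sub_eq_zero.1 (abs_eq_zero.1 (le_antisymm this (abs_nonneg _)))

end Params.Regular

/-! ### Information after n explorations -/

section Filtration

variable {Ω : Type*}

/-- The information of the first `n` spacings between arrivals. -/
@[reducible] def past (ξ : ℕ → Ω → ℝ) (n : ℕ) : MeasurableSpace Ω :=
  ⨆ i ∈ Iio n, MeasurableSpace.comap (fun ω => ξ (i + 1) ω - ξ i ω) (borel ℝ)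

variable [MeasurableSpace Ω] {P : Measure Ω} {lam : ℝ} {ξ : ℕ → Ω → ℝ}

namespace IsPoissonArrivals

lemma past_le (h : IsPoissonArrivals P lam ξ) (n : ℕ) : past ξ n ≤ ‹MeasurableSpace Ω› :=
  iSup₂_le fun i _ => ((h.measurable (i + 1)).sub (h.measurable i)).comap_le

lemma measurable_past (h : IsPoissonArrivals P lam ξ) {j n : ℕ} (hj : j ≤ n) :
    Measurable[past ξ n] (ξ j) := by
  induction j with
  | zero =>
    have : ξ 0 = fun _ => 0 := funext h.zero
    rw [this]
    exact measurable_const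
  | succ j ih =>
    have h1 : Measurable[past ξ n] (fun ω => ξ (j + 1) ω - ξ j ω) :=
      Measurable.mono (comap_measurable _)
        (le_iSup₂_of_le (f := fun i (_ : i ∈ Iio n) =>
          MeasurableSpace.comap (fun ω => ξ (i + 1) ω - ξ i ω) (borel ℝ)) j hj le_rfl) le_rfl
    have h2 := Measurable.add (m := past ξ n) (ih (Nat.le_of_succ_le hj)) h1
    simpa [Pi.add_def] using! h2

lemma indep_past (h : IsPoissonArrivals P lam ξ) (n : ℕ) :
    Indep (past ξ n) (MeasurableSpace.comap (fun ω => ξ (n + 1) ω - ξ n ω) (borel ℝ)) P := by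
  have := indep_iSup_of_disjoint (μ := P) (S := Iio n) (T := {n})
    (m := fun i => MeasurableSpace.comap (fun ω => ξ (i + 1) ω - ξ i ω) (borel ℝ))
    (fun i => ((h.measurable (i + 1)).sub (h.measurable i)).comap_le) h.indep (by simp)
  simpa only [iSup_singleton, mem_singleton_iff, iSup_iSup_eq_left] using this

/-- Before the arrival n + 1, a count at w ≤ v is at most n and is read off from ξ 0, …, ξ n. So the
natural filtration and the past have the same trace there, which is checked on the generators. -/
lemma exists_past_set (h : IsPoissonArrivals P lam ξ) (n : ℕ) {v : ℝ} {B : Set Ω}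
    (hB : MeasurableSet[natFiltration ξ v] B) :
    ∃ B', MeasurableSet[past ξ n] B' ∧ ∀ ω, v < ξ (n + 1) ω → (ω ∈ B ↔ ω ∈ B') := by
  let E : Set Ω := {ω | v < ξ (n + 1) ω}
  have hle : natFiltration ξ v ≤
      MeasurableSpace.map (Subtype.val : E → Ω) (MeasurableSpace.comap Subtype.val (past ξ n)) := by
    refine iSup₂_le fun w hw => ?_
    rw [MeasurableSpace.comap_le_iff_le_map, MeasurableSpace.map_comp]
    have hm : @Measurable E ℕ (MeasurableSpace.comap Subtype.val (past ξ n)) _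
        (count ξ w ∘ Subtype.val) := by
      refine measurable_of_Ici (mδ := MeasurableSpace.comap Subtype.val (past ξ n)) ?_
      intro j
      by_cases hj : j ≤ n
      · refine ⟨{ω | ξ j ω ≤ w}, measurableSet_le (mδ := past ξ n) (h.measurable_past hj)
          measurable_const, ?_⟩
        ext ω
        simp [le_count_iff h hw.1]
      · have : (count ξ w ∘ Subtype.val) ⁻¹' Ici j = (∅ : Set E) := by
          ext ω
          simp only [mem_preimage, Function.comp_apply, mem_Ici, le_count_iff h hw.1,
            mem_empty_iff_false, iff_false, not_le]
          have h1 : v < ξ (n + 1) ω := ω.2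
          have h2 : ξ (n + 1) ω.1 ≤ ξ j ω.1 := (h.strictMono ω).monotone (by omega : n + 1 ≤ j)
          linarith [hw.2]
        rw [this]
        exact @MeasurableSet.empty _ (MeasurableSpace.comap Subtype.val (past ξ n))
    exact fun s hs => hm hs
  obtain ⟨B', hB', he⟩ := hle B hB
  refine ⟨B', hB', fun ω hω => ?_⟩
  have := congrArg (fun s : Set E => (⟨ω, hω⟩ : E) ∈ s) he
  simp only [mem_preimage, eq_iff_iff] at this
  exact this.symm

/-- An event known after `n` explorations is, if there remains area to explore, determined by the
first `n` spacings. -/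
lemma measurableSet_past_of_stopped (h : IsPoissonArrivals P lam ξ) {x : ℝ} (hx : 0 ≤ x) (n : ℕ)
    {A : Set Ω} (hA : MeasurableSet[stopped ξ x n] A) :
    MeasurableSet[past ξ n] (A ∩ {ω | ξ n ω ≤ x}) := by
  rw [measurableSet_stopped_iff h] at hA
  have hB : ∀ v : ℝ, 0 ≤ v → ∃ B', MeasurableSet[past ξ n] B' ∧ ∀ ω, v < ξ (n + 1) ω →
      (ω ∈ A ∩ {ω | explored ξ x n ω ≤ v} ↔ ω ∈ B') := fun v hv =>
    h.exists_past_set n (hA v hv)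
  choose! B hBm hBe using hB
  have hnn : ∀ ω, 0 ≤ ξ n ω := fun ω => by
    have := (h.strictMono ω).monotone (Nat.zero_le n)
    simpa [h.zero] using this
  have hlt : ∀ ω, ξ n ω < ξ (n + 1) ω := fun ω => h.strictMono ω (Nat.lt_succ_self n)
  have hξ := h.measurable_past (le_refl n)
  -- The right-hand side must not involve `ξ (n + 1)`, although `B v` is reliable only for v below
  -- it. For ω in A with `ξ n < x`, every rational v strictly between `ξ n` and some u puts ω in `B
  -- v`; conversely, one such v below `ξ (n + 1)` suffices. If `ξ n = x`, take v = x, since the next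
  -- arrival is beyond x.
  have key : A ∩ {ω | ξ n ω ≤ x} = (B x ∩ {ω | ξ n ω = x}) ∪
      ⋃ u : ℚ, ({ω | ξ n ω < u} ∩ {ω | (u : ℝ) ≤ x}) ∩
        ⋂ v : ℚ, ({ω | (v : ℝ) ≤ ξ n ω} ∪ {ω | (u : ℝ) ≤ v}) ∪ B v := by
    ext ω
    simp only [mem_inter_iff, mem_ofPred_eq, mem_union, mem_iUnion, mem_iInter]
    constructor
    · rintro ⟨hωA, hωx⟩
      rcases eq_or_lt_of_le hωx with heq | hltx
      · refine Or.inl ⟨(hBe x hx ω (by linarith [hlt ω])).1 ⟨hωA, ?_⟩, heq⟩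
        simp [explored]
      · obtain ⟨u, hu1, hu2⟩ := exists_rat_btwn (lt_min (hlt ω) hltx)
        refine Or.inr ⟨u, ⟨hu1, (hu2.trans_le (min_le_right _ _)).le⟩, fun v => ?_⟩
        by_cases hv1 : (v : ℝ) ≤ ξ n ω
        · exact Or.inl (Or.inl hv1)
        by_cases hv2 : (u : ℝ) ≤ v
        · exact Or.inl (Or.inr hv2)
        push Not at hv1 hv2
        refine Or.inr ((hBe v ((hnn ω).trans hv1.le) ω
          ((hv2.trans hu2).trans_le (min_le_left _ _))).1 ⟨hωA, ?_⟩)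
        simp only [mem_ofPred_eq, explored]
        exact (min_le_left _ _).trans hv1.le
    · rintro (⟨hωB, heq⟩ | ⟨u, ⟨hu1, hu2⟩, hall⟩)
      · exact ⟨((hBe x hx ω (by linarith [hlt ω])).2 hωB).1, heq.le⟩
      · obtain ⟨v, hv1, hv2⟩ := exists_rat_btwn (lt_min hu1 (hlt ω))
        rcases hall v with (h1 | h1) | h1
        · linarith
        · linarith [hv2.trans_le (min_le_left _ _)]
        · exact ⟨((hBe v ((hnn ω).trans hv1.le) ω
            (hv2.trans_le (min_le_right _ _))).2 h1).1, hu1.le.trans hu2⟩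
  rw [key]
  have hconst : ∀ c : Prop, MeasurableSet[past ξ n] {_ω : Ω | c} := fun c =>
    @MeasurableSet.const _ (past ξ n) c
  have hBv : ∀ v : ℚ, ∀ u : ℚ, MeasurableSet[past ξ n]
      (({ω | (v : ℝ) ≤ ξ n ω} ∪ {ω | (u : ℝ) ≤ v}) ∪ B v) := by
    intro v u
    by_cases hv : (0:ℝ) ≤ v
    · exact @MeasurableSet.union _ (past ξ n) _ _ (@MeasurableSet.union _ (past ξ n) _ _
        (measurableSet_le (mδ := past ξ n) measurable_const hξ) (hconst _)) (hBm v hv)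
    · have : (({ω | (v : ℝ) ≤ ξ n ω} ∪ {ω | (u : ℝ) ≤ v}) ∪ B v) = univ := by
        rw [eq_univ_iff_forall]
        intro ω
        exact Or.inl (Or.inl ((not_le.1 hv).le.trans (hnn ω)))
      rw [this]
      exact @MeasurableSet.univ _ (past ξ n)
  refine @MeasurableSet.union _ (past ξ n) _ _ (@MeasurableSet.inter _ (past ξ n) _ _ (hBm x hx)
    (measurableSet_eq_fun (m := past ξ n) hξ measurable_const)) ?_
  refine @MeasurableSet.iUnion _ _ (past ξ n) _ _ fun u => ?_
  refine @MeasurableSet.inter _ (past ξ n) _ _ (@MeasurableSet.inter _ (past ξ n) _ _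
    (measurableSet_lt (mδ := past ξ n) hξ measurable_const) (hconst _)) ?_
  exact @MeasurableSet.iInter _ _ (past ξ n) _ _ fun v => hBv v u

/-- Variables known after `n` explorations have versions determined by the first `n` spacings. -/
lemma exists_past_version (h : IsPoissonArrivals P lam ξ) [Nonempty Ω] {x : ℝ} (hx : 0 ≤ x)
    (n : ℕ) {f : Ω → ℝ} (hf : Measurable[stopped ξ x n] f) :
    ∃ g, Measurable[past ξ n] g ∧ ∀ ω, ξ n ω ≤ x → g ω = f ω := by
  classical
  refine ⟨fun ω => if ξ n ω ≤ x then f ω else 0, ?_, fun ω hω => by simp [hω]⟩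
  intro s hs
  have hE : MeasurableSet[past ξ n] {ω | ξ n ω ≤ x} :=
    measurableSet_le (mδ := past ξ n) (h.measurable_past le_rfl) measurable_const
  have : (fun ω => if ξ n ω ≤ x then f ω else 0) ⁻¹' s
      = (f ⁻¹' s ∩ {ω | ξ n ω ≤ x}) ∪ ({ω | ξ n ω ≤ x}ᶜ ∩ {_ω : Ω | (0:ℝ) ∈ s}) := by
    ext ω
    by_cases hω : ξ n ω ≤ x <;> simp [hω]
  rw [this]
  exact @MeasurableSet.union _ (past ξ n) _ _ (h.measurableSet_past_of_stopped hx n (hf hs))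
    (@MeasurableSet.inter _ (past ξ n) _ _ (@MeasurableSet.compl _ _ (past ξ n) hE)
      (@MeasurableSet.const _ (past ξ n) _))

lemma natFiltration_le (h : IsPoissonArrivals P lam ξ) (v : ℝ) :
    natFiltration ξ v ≤ ‹MeasurableSpace Ω› := by
  refine iSup₂_le fun w hw => ?_
  have : Measurable (count ξ w) := by
    refine measurable_of_Ici fun j => ?_
    have : count ξ w ⁻¹' Ici j = {ω | ξ j ω ≤ w} := by
      ext ω; simp [le_count_iff h hw.1]
    rw [this]
    exact measurableSet_le (h.measurable j) measurable_const
  exact this.comap_le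

lemma stopped_le (h : IsPoissonArrivals P lam ξ) {x : ℝ} (hx : 0 ≤ x) (n : ℕ) :
    stopped ξ x n ≤ ‹MeasurableSpace Ω› := by
  intro A hA
  rw [measurableSet_stopped_iff h] at hA
  have := hA x hx
  rw [show {ω | explored ξ x n ω ≤ x} = univ by ext ω; simp [explored], inter_univ] at this
  exact h.natFiltration_le x _ this

lemma stopped_mono (h : IsPoissonArrivals P lam ξ) (x : ℝ) {m n : ℕ} (hmn : m ≤ n) :
    stopped ξ x m ≤ stopped ξ x n := by
  intro A hA
  rw [measurableSet_stopped_iff h] at hA ⊢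
  intro v hv
  have : A ∩ {ω | explored ξ x n ω ≤ v}
      = (A ∩ {ω | explored ξ x m ω ≤ v}) ∩ {ω | explored ξ x n ω ≤ v} := by
    ext ω
    simp only [mem_inter_iff, mem_ofPred_eq]
    refine ⟨fun ⟨h1, h2⟩ => ⟨⟨h1, le_trans ?_ h2⟩, h2⟩, fun ⟨⟨h1, _⟩, h2⟩ => ⟨h1, h2⟩⟩
    exact min_le_min_right x ((h.strictMono ω).monotone hmn)
  rw [this]
  exact @MeasurableSet.inter _ (natFiltration ξ v) _ _ (hA v hv)
    (measurableSet_explored_le h x n hv)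

lemma measurable_explored (h : IsPoissonArrivals P lam ξ) (x : ℝ) (n : ℕ) :
    Measurable[stopped ξ x n] (explored ξ x n) := by
  refine measurable_of_Iic (mδ := stopped ξ x n) fun t => ?_
  rw [measurableSet_stopped_iff h]
  intro v hv
  rcases le_or_gt v t with hvt | htv
  · have : explored ξ x n ⁻¹' Iic t ∩ {ω | explored ξ x n ω ≤ v} = {ω | explored ξ x n ω ≤ v} := by
      ext ω; simp only [mem_inter_iff, mem_preimage, mem_Iic, mem_ofPred_eq]
      exact ⟨fun h => h.2, fun h => ⟨h.trans hvt, h⟩⟩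
    rw [this]
    exact measurableSet_explored_le h x n hv
  · have : explored ξ x n ⁻¹' Iic t ∩ {ω | explored ξ x n ω ≤ v} = {ω | explored ξ x n ω ≤ t} := by
      ext ω; simp only [mem_inter_iff, mem_preimage, mem_Iic, mem_ofPred_eq]
      exact ⟨fun h => h.1, fun h => ⟨h, h.trans htv.le⟩⟩
    rw [this]
    rcases le_or_gt 0 t with ht | ht
    · exact (biSup_mono fun w hw => ⟨hw.1, hw.2.trans htv.le⟩ : natFiltration ξ t ≤
        natFiltration ξ v) _ (measurableSet_explored_le h x n ht)
    · rcases le_or_gt x t with hx | hx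
      · have : {ω | explored ξ x n ω ≤ t} = univ := by
          ext ω; simp [explored, hx]
        rw [this]; exact @MeasurableSet.univ _ (natFiltration ξ v)
      · have : {ω | explored ξ x n ω ≤ t} = ∅ := by
          ext ω
          have h1 : 0 ≤ ξ n ω := by
            have := (h.strictMono ω).monotone (Nat.zero_le n)
            simpa [h.zero] using this
          simp only [explored, mem_ofPred_eq, mem_empty_iff_false, iff_false, not_le, lt_min_iff]
          exact ⟨by linarith, hx⟩
        rw [this]; exact @MeasurableSet.empty _ (natFiltration ξ v)

lemma measurableSet_arrival_le (h : IsPoissonArrivals P lam ξ) {x : ℝ} (hx : 0 ≤ x) (n : ℕ) :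
    MeasurableSet[stopped ξ x n] {ω | ξ n ω ≤ x} := by
  rw [measurableSet_stopped_iff h]
  intro v hv
  have key : ∀ w, 0 ≤ w → w ≤ v → MeasurableSet[natFiltration ξ v] {ω | ξ n ω ≤ w} := by
    intro w hw hwv
    have : {ω | ξ n ω ≤ w} = count ξ w ⁻¹' {j | n ≤ j} := by
      ext ω; simp [le_count_iff h hw]
    rw [this]
    exact (le_iSup₂_of_le (f := fun w (_ : w ∈ Icc 0 v) => MeasurableSpace.comap (count ξ w) ⊤)
      w ⟨hw, hwv⟩ le_rfl) _ ⟨_, trivial, rfl⟩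
  rcases le_or_gt x v with hxv | hxv
  · have : {ω | ξ n ω ≤ x} ∩ {ω | explored ξ x n ω ≤ v} = {ω | ξ n ω ≤ x} := by
      ext ω; simp [explored, hxv]
    rw [this]; exact key x hx hxv
  · have : {ω | ξ n ω ≤ x} ∩ {ω | explored ξ x n ω ≤ v} = {ω | ξ n ω ≤ v} := by
      ext ω
      simp only [explored, mem_inter_iff, mem_ofPred_eq, min_le_iff]
      constructor
      · rintro ⟨_, h2 | h2⟩
        · exact h2
        · linarith
      · intro h1; exact ⟨by linarith, Or.inl h1⟩
    rw [this]; exact key v hv le_rfl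

end IsPoissonArrivals

end Filtration

/-! ### Integration over an independent exponential time -/

lemma IndepFun.lintegral_comp_prodMk {Ω β : Type*} [MeasurableSpace Ω] [MeasurableSpace β]
    {P : Measure Ω} [IsProbabilityMeasure P] {X : Ω → β} (hX : Measurable X) {T : Ω → ℝ}
    (hT : Measurable T) (hind : IndepFun X T P) {f : β × ℝ → ℝ≥0∞} (hf : Measurable f) :
    ∫⁻ ω, f (X ω, T ω) ∂P = ∫⁻ ω, ∫⁻ s, f (X ω, s) ∂(P.map T) ∂P := by
  have : IsProbabilityMeasure (P.map T) := Measure.isProbabilityMeasure_map hT.aemeasurable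
  have h1 := (indepFun_iff_map_prod_eq_prod_map_map hX.aemeasurable hT.aemeasurable).1 hind
  rw [← lintegral_map (f := f) hf (hX.prodMk hT), h1, lintegral_prod _ hf.aemeasurable,
    lintegral_map (f := fun y => ∫⁻ s, f (y, s) ∂(P.map T)) hf.lintegral_prod_right' hX]

/-- Freezing a sub-σ-field when integrating out an independent variable. -/
lemma lintegral_indep {Ω : Type*} {m m0 : MeasurableSpace Ω} {P : Measure[m0] Ω}
    [IsProbabilityMeasure P] (hm : m ≤ m0) {T : Ω → ℝ} (hT : Measurable[m0] T)
    (hind : Indep m (MeasurableSpace.comap T (borel ℝ)) P) {f : Ω × ℝ → ℝ≥0∞}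
    (hf : Measurable[m.prod (borel ℝ)] f) :
    ∫⁻ ω, f (ω, T ω) ∂P = ∫⁻ ω, ∫⁻ s, f (ω, s) ∂(P.map T) ∂P := by
  -- The σ-field m is generated by the identity from Ω with m0 to Ω with m, which reduces freezing m
  -- to the case of a random variable.
  refine @IndepFun.lintegral_comp_prodMk Ω Ω m0 m P _ id (measurable_id'' hm) T hT ?_ f hf
  refine (@IndepFun_iff_Indep Ω Ω ℝ m0 m _ id T P).2 ?_
  rw [MeasurableSpace.comap_id]
  exact hind


section Exponential

variable {lam : ℝ}

lemma lintegral_expMeasure {g : ℝ → ℝ≥0∞} (hg : Measurable g) :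
    ∫⁻ s, g s ∂(expMeasure lam)
      = ∫⁻ s in Ioi 0, g s * ENNReal.ofReal (lam * Real.exp (-lam * s)) := by
  have hm : Measurable (exponentialPDF lam) := (measurable_exponentialPDFReal lam).ennreal_ofReal
  have h1 : expMeasure lam = volume.withDensity (exponentialPDF lam) := rfl
  rw [h1, lintegral_withDensity_eq_lintegral_mul _ hm hg, ← lintegral_indicator measurableSet_Ioi]
  refine lintegral_congr_ae ?_
  have h0 : ∀ᵐ s : ℝ, s ≠ 0 := by simp [ae_iff]
  filter_upwards [h0] with s hs
  rcases lt_or_gt_of_ne hs with hs | hs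
  · simp [exponentialPDF_of_neg hs, indicator, not_lt.2 hs.le]
  · simp [exponentialPDF_of_nonneg hs.le, indicator, hs, mul_comm]

lemma lintegral_Ioi_density (hl : 0 < lam) (y : ℝ) :
    ∫⁻ s in Ioi y, ENNReal.ofReal (lam * Real.exp (-lam * s))
      = ENNReal.ofReal (Real.exp (-lam * y)) := by
  have hi := (integrableOn_exp_mul_Ioi (a := -lam) (by linarith) y).const_mul lam
  rw [← ofReal_integral_eq_lintegral_ofReal hi (ae_of_all _ fun s => by positivity),
    integral_const_mul, integral_exp_mul_Ioi (by linarith)]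
  congr 1
  field_simp

/-- Expectation of a function of an exponential time, which is constant beyond the horizon `y`. -/
lemma lintegral_expMeasure_horizon (hl : 0 < lam) {y d K : ℝ} (hy : 0 ≤ y) (hd : 0 ≤ d)
    (hK : 0 ≤ K) {φ : ℝ → ℝ} (hφ : Continuous φ) (hφ0 : ∀ s ∈ Icc 0 y, 0 ≤ φ s) :
    ∫⁻ s, (if s ≤ y then ENNReal.ofReal (d * φ s) else ENNReal.ofReal (d * K)) ∂(expMeasure lam)
      = ENNReal.ofReal (d * ((∫ s in (0 : ℝ)..y, φ s * (lam * Real.exp (-lam * s)))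
          + K * Real.exp (-lam * y))) := by
  rw [lintegral_expMeasure (Measurable.ite measurableSet_Iic
    (by fun_prop : Measurable fun s => ENNReal.ofReal (d * φ s)) measurable_const),
    ← Ioc_union_Ioi_eq_Ioi hy, lintegral_union measurableSet_Ioi (Ioc_disjoint_Ioi le_rfl)]
  have h1 : ∫⁻ s in Ioc 0 y, (if s ≤ y then ENNReal.ofReal (d * φ s) else ENNReal.ofReal (d * K))
      * ENNReal.ofReal (lam * Real.exp (-lam * s))
      = ENNReal.ofReal (d * ∫ s in (0 : ℝ)..y, φ s * (lam * Real.exp (-lam * s))) := by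
    rw [← intervalIntegral.integral_const_mul, intervalIntegral.integral_of_le hy,
      ofReal_integral_eq_lintegral_ofReal]
    · refine setLIntegral_congr_fun measurableSet_Ioc fun s hs => ?_
      simp only [hs.2, if_true]
      rw [← ENNReal.ofReal_mul (mul_nonneg hd (hφ0 s ⟨hs.1.le, hs.2⟩)), mul_assoc]
    · exact (Continuous.integrableOn_Icc (by fun_prop)).mono_set Ioc_subset_Icc_self
    · filter_upwards [ae_restrict_mem measurableSet_Ioc] with s hs
      have := hφ0 s ⟨hs.1.le, hs.2⟩
      simp only [Pi.zero_apply]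
      positivity
  have h2 : ∫⁻ s in Ioi y, (if s ≤ y then ENNReal.ofReal (d * φ s) else ENNReal.ofReal (d * K))
      * ENNReal.ofReal (lam * Real.exp (-lam * s))
      = ENNReal.ofReal (d * (K * Real.exp (-lam * y))) := by
    rw [← mul_assoc, ENNReal.ofReal_mul (mul_nonneg hd hK), ← lintegral_Ioi_density hl,
      ← lintegral_const_mul' _ _ ENNReal.ofReal_ne_top]
    refine setLIntegral_congr_fun measurableSet_Ioi fun s hs => ?_
    simp only [not_le.2 (mem_Ioi.1 hs), if_false]
  have h3 : 0 ≤ ∫ s in (0 : ℝ)..y, φ s * (lam * Real.exp (-lam * s)) :=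
    intervalIntegral.integral_nonneg hy fun s hs => by have := hφ0 s hs; positivity
  rw [h1, h2, ← ENNReal.ofReal_add (by positivity) (by positivity), mul_add]

lemma integral_mul_density (hl : 0 < lam) (y : ℝ) :
    (∫ s in (0 : ℝ)..y, s * (lam * Real.exp (-lam * s))) + y * Real.exp (-lam * y)
      = (1 - Real.exp (-lam * y)) / lam := by
  have hd : ∀ s ∈ uIcc 0 y, HasDerivAt (fun s => -(s + 1 / lam) * Real.exp (-lam * s))
      (s * (lam * Real.exp (-lam * s))) s := by
    intro s _
    have h1 := ((hasDerivAt_id s).const_mul (-lam)).exp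
    have h2 := ((hasDerivAt_id s).add_const (1 / lam)).neg
    refine (h2.mul h1).congr_deriv ?_
    simp only [id, mul_one, Pi.neg_apply]
    field_simp
    ring
  rw [intervalIntegral.integral_eq_sub_of_hasDerivAt hd
    (Continuous.intervalIntegrable (by fun_prop) _ _)]
  simp
  field_simp
  ring

lemma lintegral_expMeasure_min (hl : 0 < lam) {y d : ℝ} (hy : 0 ≤ y) (hd : 0 ≤ d) :
    ∫⁻ s, ENNReal.ofReal (d * min s y) ∂(expMeasure lam)
      = ENNReal.ofReal (d * ((1 - Real.exp (-lam * y)) / lam)) := by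
  rw [← integral_mul_density hl]
  refine Eq.trans ?_ (lintegral_expMeasure_horizon hl hy hd hy continuous_id fun s hs => hs.1)
  refine lintegral_congr fun s => ?_
  split_ifs with hs
  · simp [min_eq_left hs]
  · simp [min_eq_right (not_le.1 hs).le]

end Exponential

/-! ### One exploration episode -/

namespace IsPoissonArrivals

variable {Ω : Type*} [m0 : MeasurableSpace Ω] {P : Measure Ω} {lam : ℝ} {ξ : ℕ → Ω → ℝ}

/-- Given the first `n` spacings, the next one is exponential. -/
lemma lintegral_next [IsProbabilityMeasure P] (h : IsPoissonArrivals P lam ξ) (n : ℕ) (x : ℝ) {f : Ω × ℝ → ℝ≥0∞}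
    (hf : Measurable[(past ξ n).prod (borel ℝ)] f) :
    ∫⁻ ω in {ω | ξ n ω ≤ x}, f (ω, ξ (n + 1) ω - ξ n ω) ∂P
      = ∫⁻ ω in {ω | ξ n ω ≤ x}, ∫⁻ s, f (ω, s) ∂(expMeasure lam) ∂P := by
  have hE : MeasurableSet[past ξ n] {ω | ξ n ω ≤ x} :=
    measurableSet_le (mδ := past ξ n) (h.measurable_past le_rfl) measurable_const
  have hE' := h.past_le n _ hE
  have hg : Measurable[(past ξ n).prod (borel ℝ)] (indicator ({ω | ξ n ω ≤ x} ×ˢ univ) f) := by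
    let _ : MeasurableSpace (Ω × ℝ) := (past ξ n).prod (borel ℝ)
    exact Measurable.indicator hf
      (@MeasurableSet.prod _ _ (past ξ n) (borel ℝ) _ _ hE MeasurableSet.univ)
  have := lintegral_indep (T := fun ω => ξ (n + 1) ω - ξ n ω) (h.past_le n) ((h.measurable (n + 1)).sub (h.measurable n))
    (h.indep_past n) hg
  rw [← lintegral_indicator hE', ← lintegral_indicator hE', ← h.law n]
  have e1 : ∀ ω s, indicator ({ω | ξ n ω ≤ x} ×ˢ (univ : Set ℝ)) f (ω, s)
      = indicator {ω | ξ n ω ≤ x} (fun ω => f (ω, s)) ω := by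
    intro ω s; by_cases hω : ξ n ω ≤ x <;> simp [indicator, hω]
  simp only [e1] at this
  refine (lintegral_congr fun ω => ?_).trans (this.trans (lintegral_congr fun ω => ?_)) <;>
  by_cases hω : ξ n ω ≤ x <;> simp [indicator, hω]

lemma nonneg (h : IsPoissonArrivals P lam ξ) (n : ℕ) (ω : Ω) : 0 ≤ ξ n ω := by
  have := (h.strictMono ω).monotone (Nat.zero_le n)
  simpa [h.zero] using this

lemma measurableSet_le_level (h : IsPoissonArrivals P lam ξ) (n : ℕ) (x : ℝ) :
    MeasurableSet {ω | ξ n ω ≤ x} := measurableSet_le (h.measurable n) measurable_const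

lemma arrival_subset (h : IsPoissonArrivals P lam ξ) (n : ℕ) (x : ℝ) :
    {ω | ξ (n + 1) ω ≤ x} ⊆ {ω | ξ n ω ≤ x} := fun ω hω =>
  ((h.strictMono ω).monotone (Nat.le_succ n)).trans hω

end IsPoissonArrivals

variable {Ω : Type*} [m0 : MeasurableSpace Ω] {P : Measure Ω} [IsProbabilityMeasure P]
  {p : Params} {ξ : ℕ → Ω → ℝ}

/-- The power j makes an induction on n possible: integrating out the last spacing trades one
arrival for one more power, as in the iteration of M. The case j = 0 bounds the probability of n
arrivals within x. -/
lemma lintegral_arrival_pow_le (h : p.Regular) (hξ : IsPoissonArrivals P p.lam ξ) {x : ℝ}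
    (n j : ℕ) :
    ∫⁻ ω in {ω | ξ n ω ≤ x}, ENNReal.ofReal ((p.lam * (x - ξ n ω)) ^ j / j.factorial) ∂P
      ≤ ENNReal.ofReal ((p.lam * x) ^ (n + j) / (n + j).factorial) := by
  have hl := h.lam_pos
  induction n generalizing j with
  | zero =>
    simp only [hξ.zero, sub_zero, lintegral_const, zero_add]
    refine mul_le_of_le_one_right' ?_
    rw [Measure.restrict_apply_univ]
    exact prob_le_one
  | succ n ih =>
    refine le_trans ?_ ((ih (j + 1)).trans_eq (by rw [show n + (j + 1) = n + 1 + j by ring]))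
    let f : Ω × ℝ → ℝ≥0∞ := fun q => if q.2 ≤ x - ξ n q.1 then
      ENNReal.ofReal (1 * ((p.lam * ((x - ξ n q.1) - q.2)) ^ j / j.factorial))
      else ENNReal.ofReal (1 * 0)
    have hξn : Measurable[(past ξ n).prod (borel ℝ)] (fun q : Ω × ℝ => ξ n q.1) :=
      (hξ.measurable_past le_rfl).comp (@measurable_fst _ _ (past ξ n) (borel ℝ))
    have hs : Measurable[(past ξ n).prod (borel ℝ)] (fun q : Ω × ℝ => q.2) :=
      @measurable_snd _ _ (past ξ n) (borel ℝ)
    have hf : Measurable[(past ξ n).prod (borel ℝ)] f := by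
      let _ : MeasurableSpace (Ω × ℝ) := (past ξ n).prod (borel ℝ)
      refine Measurable.ite (measurableSet_le hs (measurable_const.sub hξn)) ?_ measurable_const
      exact (((measurable_const.mul ((measurable_const.sub hξn).sub hs)).pow_const j).div_const
        _).const_mul 1 |>.ennreal_ofReal
    have e1 : ∫⁻ ω in {ω | ξ (n + 1) ω ≤ x},
        ENNReal.ofReal ((p.lam * (x - ξ (n + 1) ω)) ^ j / j.factorial) ∂P
        = ∫⁻ ω in {ω | ξ n ω ≤ x}, f (ω, ξ (n + 1) ω - ξ n ω) ∂P := by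
      rw [← lintegral_indicator (hξ.measurableSet_le_level _ _),
        ← lintegral_indicator (hξ.measurableSet_le_level _ _)]
      refine lintegral_congr fun ω => ?_
      by_cases h1 : ξ (n + 1) ω ≤ x
      · have h0 : ξ n ω ≤ x := hξ.arrival_subset n x h1
        simp [indicator, h1, h0, f]
      · simp [indicator, h1, f]
    rw [e1, hξ.lintegral_next n x hf]
    refine setLIntegral_mono' (hξ.measurableSet_le_level _ _) fun ω hω => ?_
    have hy : 0 ≤ x - ξ n ω := sub_nonneg.2 hω
    rw [lintegral_expMeasure_horizon hl hy zero_le_one le_rfl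
      (φ := fun s => (p.lam * ((x - ξ n ω) - s)) ^ j / j.factorial) (by fun_prop)
      (fun s hs => by have := sub_nonneg.2 hs.2; positivity)]
    refine ENNReal.ofReal_le_ofReal ?_
    have := h.abs_integral_density_le (C := 1) hy j
      (f := fun s => (p.lam * ((x - ξ n ω) - s)) ^ j / j.factorial) (fun s hs => by
        have := sub_nonneg.2 hs.2
        rw [abs_of_nonneg (by positivity), one_mul])
    linarith [le_abs_self (∫ s in (0:ℝ)..(x - ξ n ω),
      (p.lam * ((x - ξ n ω) - s)) ^ j / j.factorial * (p.lam * Real.exp (-p.lam * s)))]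

lemma measure_arrival_le (h : p.Regular) (hξ : IsPoissonArrivals P p.lam ξ) (x : ℝ) (n : ℕ) :
    P {ω | ξ n ω ≤ x} ≤ ENNReal.ofReal ((p.lam * x) ^ n / n.factorial) := by
  simpa using lintegral_arrival_pow_le h hξ (x := x) n 0

/-- One exploration episode: its expected outcome is given by the operator `M`. -/
lemma lintegral_exploration (h : p.Regular) (hξ : IsPoissonArrivals P p.lam ξ) {x : ℝ}
    (hx : 0 ≤ x) (n : ℕ) {V q : ℝ → ℝ → ℝ} (hV : Candidate p V q) {d ρ : Ω → ℝ}
    (hd : Measurable[stopped ξ x n] d) (hρ : Measurable[stopped ξ x n] ρ)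
    (hd0 : ∀ᵐ ω ∂P, ξ n ω ≤ x → 0 ≤ d ω) (hρ0 : ∀ᵐ ω ∂P, ξ n ω ≤ x → 0 ≤ ρ ω) :
    (∫⁻ ω in {ω | ξ n ω ≤ x}, ENNReal.ofReal (d ω * p.M V (x - ξ n ω) (ρ ω)) ∂P)
      + ∫⁻ ω in {ω | ξ n ω ≤ x},
          ENNReal.ofReal (d ω * p.k * (explored ξ x (n + 1) ω - explored ξ x n ω)) ∂P
    = (∫⁻ ω in {ω | ξ (n + 1) ω ≤ x},
          ENNReal.ofReal (d ω * V (x - ξ (n + 1) ω) (ρ ω + p.a)) ∂P)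
      + ∫⁻ ω in {ω | ξ n ω ≤ x} \ {ω | ξ (n + 1) ω ≤ x},
          ENNReal.ofReal (d ω * p.hotelling (ρ ω)) ∂P := by
  have hl := h.lam_pos
  have hk := h.k_pos
  have : Nonempty Ω := P.nonempty_of_neZero
  obtain ⟨d', hd', hdd⟩ := hξ.exists_past_version hx n hd
  obtain ⟨ρ', hρ', hρρ⟩ := hξ.exists_past_version hx n hρ
  have hE := hξ.measurableSet_le_level
  let mp : MeasurableSpace (Ω × ℝ) := (past ξ n).prod (borel ℝ)
  have hξn : Measurable (fun q : Ω × ℝ => ξ n q.1) :=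
    (hξ.measurable_past le_rfl).comp (@measurable_fst _ _ (past ξ n) (borel ℝ))
  have hs : Measurable (fun q : Ω × ℝ => q.2) := @measurable_snd _ _ (past ξ n) (borel ℝ)
  have hd1 : Measurable (fun q : Ω × ℝ => d' q.1) :=
    hd'.comp (@measurable_fst _ _ (past ξ n) (borel ℝ))
  have hρ1 : Measurable (fun q : Ω × ℝ => ρ' q.1) :=
    hρ'.comp (@measurable_fst _ _ (past ξ n) (borel ℝ))
  let f : Ω × ℝ → ℝ≥0∞ := fun q => if q.2 ≤ x - ξ n q.1 then
      ENNReal.ofReal (d' q.1 * V (x - ξ n q.1 - q.2) (ρ' q.1 + p.a))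
      else ENNReal.ofReal (d' q.1 * p.hotelling (ρ' q.1))
  let g : Ω × ℝ → ℝ≥0∞ := fun q => ENNReal.ofReal (d' q.1 * p.k * min q.2 (x - ξ n q.1))
  have hf : Measurable f := by
    refine Measurable.ite (measurableSet_le hs (measurable_const.sub hξn)) ?_ ?_
    · refine (hd1.mul ?_).ennreal_ofReal
      exact hV.continuous.measurable.comp
        (((measurable_const.sub hξn).sub hs).prodMk (hρ1.add_const p.a))
    · exact (hd1.mul (h.continuous_hotelling.measurable.comp hρ1)).ennreal_ofReal
  have hg : Measurable g := by
    exact ((hd1.mul measurable_const).mul (hs.min (measurable_const.sub hξn))).ennreal_ofReal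
  have e1 := hξ.lintegral_next n x hf
  have e2 := hξ.lintegral_next n x hg
  have hmc : Measurable fun ω =>
      ENNReal.ofReal (d ω * p.k * ((1 - Real.exp (-p.lam * (x - ξ n ω))) / p.lam)) := by
    have h1 : Measurable d := hd.mono (hξ.stopped_le hx n) le_rfl
    have h2 := hξ.measurable n
    fun_prop
  -- M contains the expected cost with a minus sign. Adding the cost back, here and in the
  -- statement, leaves an identity between nonnegative integrals. The expected explored area with y
  -- left is that of the minimum of an exponential time and y.
  have a1 : ∫⁻ ω in {ω | ξ n ω ≤ x}, (ENNReal.ofReal (d ω * p.M V (x - ξ n ω) (ρ ω)) +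
      ENNReal.ofReal (d ω * p.k * ((1 - Real.exp (-p.lam * (x - ξ n ω))) / p.lam))) ∂P
      = ∫⁻ ω in {ω | ξ n ω ≤ x}, ∫⁻ s, f (ω, s) ∂(expMeasure p.lam) ∂P := by
    refine setLIntegral_congr_fun_ae (hE n x) ?_
    filter_upwards [hd0, hρ0] with ω hdω hρω hω
    have hω' : ξ n ω ≤ x := hω
    have hy : 0 ≤ x - ξ n ω := sub_nonneg.2 hω
    have hM := hV.M_nonneg h hy (hρω hω)
    have hexp : Real.exp (-p.lam * (x - ξ n ω)) ≤ 1 := h.exp_le_one hy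
    have hd2 := hdω hω
    have hρ2 := hρω hω
    have hexp' : 0 ≤ (1 - Real.exp (-p.lam * (x - ξ n ω))) / p.lam :=
      div_nonneg (by linarith) hl.le
    simp only [f, hdd ω hω, hρρ ω hω]
    rw [lintegral_expMeasure_horizon hl hy hd2 (h.hotelling_nonneg hρ2)
      (φ := fun s => V (x - ξ n ω - s) (ρ ω + p.a))
      (hV.continuous.comp (f := fun s => (x - ξ n ω - s, ρ ω + p.a)) (by fun_prop))
      (fun s hs => (h.hotelling_nonneg (by linarith [h.a_pos])).trans
        (hV.hotelling_le _ _ (by linarith [hs.2]) (by linarith [h.a_pos]))),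
      ← ENNReal.ofReal_add (by positivity) (by positivity)]
    congr 1
    unfold Params.M
    ring
  have a2 : ∫⁻ ω in {ω | ξ n ω ≤ x},
        ENNReal.ofReal (d ω * p.k * (explored ξ x (n + 1) ω - explored ξ x n ω)) ∂P
      = ∫⁻ ω in {ω | ξ n ω ≤ x},
        ENNReal.ofReal (d ω * p.k * ((1 - Real.exp (-p.lam * (x - ξ n ω))) / p.lam)) ∂P := by
    refine Eq.trans (b := ∫⁻ ω in {ω | ξ n ω ≤ x}, g (ω, ξ (n + 1) ω - ξ n ω) ∂P) ?_
      (e2.trans ?_)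
    · refine setLIntegral_congr_fun (hE n x) fun ω hω => ?_
      have hω' : ξ n ω ≤ x := hω
      simp only [g, hdd ω hω, explored, min_eq_left hω', min_sub_sub_right]
    · refine setLIntegral_congr_fun_ae (hE n x) ?_
      filter_upwards [hd0] with ω hdω hω
      have hω' : ξ n ω ≤ x := hω
      simp only [g, hdd ω hω]
      exact lintegral_expMeasure_min hl (sub_nonneg.2 hω') (mul_nonneg (hdω hω) hk.le)
  have a3 : ∫⁻ ω in {ω | ξ n ω ≤ x}, f (ω, ξ (n + 1) ω - ξ n ω) ∂P
      = (∫⁻ ω in {ω | ξ (n + 1) ω ≤ x},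
          ENNReal.ofReal (d ω * V (x - ξ (n + 1) ω) (ρ ω + p.a)) ∂P)
      + ∫⁻ ω in {ω | ξ n ω ≤ x} \ {ω | ξ (n + 1) ω ≤ x},
          ENNReal.ofReal (d ω * p.hotelling (ρ ω)) ∂P := by
    rw [← lintegral_inter_add_sdiff _ _ (hE (n + 1) x),
      inter_eq_self_of_subset_right (hξ.arrival_subset n x)]
    congr 1
    · refine setLIntegral_congr_fun (hE (n + 1) x) fun ω hω => ?_
      have hω0 := hξ.arrival_subset n x hω
      have hω' : ξ (n + 1) ω ≤ x := hω
      simp only [f, hdd ω hω0, hρρ ω hω0, sub_le_sub_iff_right, hω', if_true]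
      congr 3
      ring
    · refine setLIntegral_congr_fun ((hE n x).diff (hE (n + 1) x)) fun ω hω => ?_
      have hω' : ¬ ξ (n + 1) ω ≤ x := hω.2
      simp only [f, hdd ω hω.1, hρρ ω hω.1, sub_le_sub_iff_right, hω', if_false]
  rw [a2, ← lintegral_add_right _ hmc, a1, ← e1, a3]


/-! ### A single consumption stage -/

/-- The dates `t > 0` with `τ ≤ t < τ'`. -/
def stage (τ τ' : ℝ≥0∞) : Set ℝ := {t | 0 < t ∧ τ ≤ ENNReal.ofReal t ∧ ENNReal.ofReal t < τ'}

lemma measurableSet_stage (τ τ' : ℝ≥0∞) : MeasurableSet (stage τ τ') :=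
  measurableSet_Ioi.inter ((measurableSet_le measurable_const ENNReal.measurable_ofReal).inter
    (measurableSet_lt ENNReal.measurable_ofReal measurable_const))

lemma stage_zero_top : stage 0 ∞ = Ioi 0 := by
  ext t; simp [stage]

lemma stage_top (τ' : ℝ≥0∞) : stage ∞ τ' = ∅ := by
  ext t; simp [stage]

lemma stage_union {τ τ' τ'' : ℝ≥0∞} (h : τ ≤ τ') (h' : τ' ≤ τ'') :
    stage τ τ'' = stage τ τ' ∪ stage τ' τ'' := by
  ext t
  simp only [stage, mem_ofPred_eq, mem_union]
  constructor
  · rintro ⟨h0, h1, h2⟩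
    rcases lt_or_ge (ENNReal.ofReal t) τ' with h3 | h3
    · exact Or.inl ⟨h0, h1, h3⟩
    · exact Or.inr ⟨h0, h3, h2⟩
  · rintro (⟨h0, h1, h2⟩ | ⟨h0, h1, h2⟩)
    · exact ⟨h0, h1, h2.trans_le h'⟩
    · exact ⟨h0, h.trans h1, h2⟩

lemma disjoint_stage (τ τ' τ'' : ℝ≥0∞) : Disjoint (stage τ τ') (stage τ' τ'') :=
  disjoint_left.2 fun _ h1 h2 => absurd h1.2.2 (not_lt.2 h2.2.1)

lemma lintegral_stage_add {τ τ' τ'' : ℝ≥0∞} (h : τ ≤ τ') (h' : τ' ≤ τ'') (f : ℝ → ℝ≥0∞) :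
    ∫⁻ t in stage τ τ'', f t = (∫⁻ t in stage τ τ', f t) + ∫⁻ t in stage τ' τ'', f t := by
  rw [stage_union h h', lintegral_union (measurableSet_stage _ _) (disjoint_stage _ _ _)]

lemma measurable_lintegral_stage {Ω : Type*} {m : MeasurableSpace Ω} {τ τ' : Ω → ℝ≥0∞}
    (hτ : Measurable τ) (hτ' : Measurable τ') {f : Ω × ℝ → ℝ≥0∞} (hf : Measurable f) :
    Measurable fun ω => ∫⁻ t in stage (τ ω) (τ' ω), f (ω, t) := by
  have hs : MeasurableSet {q : Ω × ℝ | q.2 ∈ stage (τ q.1) (τ' q.1)} := by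
    have h2 : Measurable fun q : Ω × ℝ => ENNReal.ofReal q.2 := by fun_prop
    exact (measurableSet_lt measurable_const measurable_snd).inter
      ((measurableSet_le (hτ.comp measurable_fst) h2).inter
        (measurableSet_lt h2 (hτ'.comp measurable_fst)))
  have := (hf.indicator hs).lintegral_prod_right' (ν := volume)
  convert this using 2 with ω
  rw [← lintegral_indicator (measurableSet_stage _ _)]
  rfl

/-- The fraction of the reserves that is left at the date `τ'` when they have been depleted at the
rate `(1 - α)⁻¹ r` since the date `τ`. -/
def Params.remaining (p : Params) (τ τ' : ℝ≥0∞) : ℝ :=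
  if τ' = ∞ then 0 else Real.exp (-p.rate * (τ'.toReal - τ.toReal))

lemma Params.discount_nonneg (p : Params) (τ : ℝ≥0∞) : 0 ≤ p.discount τ := by
  unfold Params.discount; split_ifs <;> positivity

lemma Params.measurable_discount (p : Params) : Measurable p.discount :=
  Measurable.ite (measurableSet_singleton _) measurable_const (by fun_prop)

/-- Reserves at the date `t`, when reserves `S` at the date `τ` are depleted at the constant rate
`(1 - α)⁻¹ r`. -/
def Params.reserves (p : Params) (S : ℝ) (τ : ℝ≥0∞) (t : ℝ) : ℝ :=
  S * Real.exp (-p.rate * (t - τ.toReal))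

namespace Params.Regular

variable {p : Params} {τ τ' : ℝ≥0∞} {S : ℝ}

lemma rate_mul (h : p.Regular) : p.rate * (1 - p.α) = p.r := by
  unfold Params.rate; exact div_mul_cancel₀ _ h.one_sub_pos.ne'

lemma hotelling_eq_marginal (h : p.Regular) (hS : 0 < S) :
    p.hotelling S = p.marginal S * S / p.α := by
  unfold Params.marginal
  rw [hotelling_eq, h.hotelling_one_eq, Real.mul_rpow h.rate_pos.le hS.le, Real.rpow_sub_one hS.ne']
  have := hS.ne'
  field_simp

lemma u_eq_hotelling (h : p.Regular) {c : ℝ} (hc : 0 ≤ c) :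
    p.u c = p.rate * p.hotelling (c / p.rate) := by
  have hb := h.rate_pos
  unfold Params.u
  rw [hotelling_eq, h.hotelling_one_eq, Real.div_rpow hc hb.le, Real.rpow_sub_one hb.ne']
  have := (Real.rpow_pos_of_pos hb p.α).ne'
  field_simp

lemma discount_of_ne_top (hτ : τ ≠ ∞) : p.discount τ = Real.exp (-p.r * τ.toReal) := by
  simp [Params.discount, hτ]

/-- Hotelling's rule: as rate · (1 - α) = r, the marginal value of reserves depleted at this rate
grows exactly at the interest rate. -/
lemma discount_mul_marginal (h : p.Regular) (hS : 0 < S) (hτ : τ ≠ ∞) (t : ℝ) :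
    Real.exp (-p.r * t) * p.marginal (p.reserves S τ t) = p.discount τ * p.marginal S := by
  unfold Params.marginal Params.reserves
  rw [← mul_assoc, Real.mul_rpow (mul_pos h.rate_pos hS).le (Real.exp_pos _).le, ← Real.exp_mul,
    discount_of_ne_top hτ, mul_comm, mul_assoc, ← Real.exp_add, mul_comm]
  congr 2
  rw [← h.rate_mul]
  ring

lemma discount_eq_remaining (h : p.Regular) (hττ : τ ≤ τ') :
    p.discount τ' = p.discount τ * p.remaining τ τ' ^ (1 - p.α) := by
  unfold Params.remaining
  by_cases hτ' : τ' = ∞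
  · simp [hτ', Params.discount, Real.zero_rpow h.one_sub_pos.ne']
  · have hτ : τ ≠ ∞ := ne_top_of_le_ne_top hτ' hττ
    rw [if_neg hτ', discount_of_ne_top hτ, discount_of_ne_top hτ', ← Real.exp_mul, ← Real.exp_add,
      ← h.rate_mul]
    congr 1
    ring

lemma remaining_nonneg : 0 ≤ p.remaining τ τ' := by
  unfold Params.remaining; split_ifs <;> positivity

lemma remaining_le_one (h : p.Regular) (hττ : τ ≤ τ') : p.remaining τ τ' ≤ 1 := by
  unfold Params.remaining
  split_ifs with hτ'
  · exact zero_le_one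
  · have := ENNReal.toReal_mono hτ' hττ
    have := h.rate_pos
    rw [Real.exp_le_one_iff]
    nlinarith

/-- Depletion at a constant rate exhausts all but the remaining fraction. -/
lemma lintegral_reserves (h : p.Regular) (hS : 0 ≤ S) (hττ : τ ≤ τ') (hτ : τ ≠ ∞) :
    ∫⁻ t in stage τ τ', ENNReal.ofReal (p.rate * p.reserves S τ t)
      = ENNReal.ofReal (S * (1 - p.remaining τ τ')) := by
  have hb := h.rate_pos
  set T := τ.toReal with hT
  have hT0 : 0 ≤ T := ENNReal.toReal_nonneg
  have hle : ∀ t : ℝ, 0 < t → (τ ≤ ENNReal.ofReal t ↔ T ≤ t) := fun t ht =>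
    (ENNReal.toReal_le_toReal hτ ENNReal.ofReal_ne_top).symm.trans
      (by rw [ENNReal.toReal_ofReal ht.le])
  -- The depletion over a half-line is explicit. A stage is, up to null sets, a half-line or a
  -- difference of two.
  have hIoi : ∀ y : ℝ, ∫⁻ t in Ioi y, ENNReal.ofReal (p.rate * p.reserves S τ t)
      = ENNReal.ofReal (S * Real.exp (-p.rate * (y - T))) := by
    intro y
    have : S * Real.exp (-p.rate * (y - T))
        = (S * Real.exp (p.rate * T)) * Real.exp (-p.rate * y) := by
      rw [mul_assoc, ← Real.exp_add]; congr 2; ring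
    rw [this, ENNReal.ofReal_mul (by positivity), ← lintegral_Ioi_density hb,
      ← lintegral_const_mul' _ _ ENNReal.ofReal_ne_top]
    refine lintegral_congr fun t => ?_
    rw [← ENNReal.ofReal_mul (by positivity)]
    congr 1
    unfold Params.reserves
    rw [show -p.rate * (t - τ.toReal) = p.rate * T + -p.rate * t by rw [hT]; ring, Real.exp_add]
    ring
  have hne : ∀ y : ℝ, ∀ᵐ t : ℝ, t ≠ y := fun y => by simp [ae_iff]
  unfold Params.remaining
  by_cases hτ' : τ' = ∞
  · have hset : stage τ τ' =ᵐ[volume] Ioi T := by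
      filter_upwards [hne T] with t ht
      refine propext ⟨fun hh => ?_, fun hh => ?_⟩
      · exact lt_of_le_of_ne ((hle t hh.1).1 hh.2.1) ht.symm
      · have h0 : 0 < t := hT0.trans_lt hh
        exact ⟨h0, (hle t h0).2 (le_of_lt hh), by simp [hτ']⟩
    rw [setLIntegral_congr hset, hIoi, if_pos hτ']
    simp
  · have hTT : T ≤ τ'.toReal := ENNReal.toReal_mono hτ' hττ
    have hset : stage τ τ' =ᵐ[volume] Ioc T τ'.toReal := by
      filter_upwards [hne T, hne τ'.toReal] with t ht ht'
      have hlt : 0 < t → (ENNReal.ofReal t < τ' ↔ t < τ'.toReal) := fun ht0 =>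
        (ENNReal.toReal_lt_toReal ENNReal.ofReal_ne_top hτ').symm.trans
          (by rw [ENNReal.toReal_ofReal ht0.le])
      refine propext ⟨fun hh => ?_, fun hh => ?_⟩
      · exact ⟨lt_of_le_of_ne ((hle t hh.1).1 hh.2.1) ht.symm, ((hlt hh.1).1 hh.2.2).le⟩
      · have h0 : 0 < t := hT0.trans_lt hh.1
        exact ⟨h0, (hle t h0).2 (le_of_lt hh.1), (hlt h0).2 (lt_of_le_of_ne hh.2 ht')⟩
    have hadd := hIoi T
    rw [← Ioc_union_Ioi_eq_Ioi hTT, lintegral_union measurableSet_Ioi (Ioc_disjoint_Ioi le_rfl),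
      hIoi] at hadd
    rw [setLIntegral_congr hset, if_neg hτ',
      ENNReal.eq_sub_of_add_eq ENNReal.ofReal_ne_top hadd,
      ← ENNReal.ofReal_sub _ (by positivity)]
    congr 1
    simp
    ring

/-- No consumption plan during a stage does better than Hotelling's. -/
lemma stage_le (h : p.Regular) (hττ : τ ≤ τ') {z : ℝ} (hz : 0 ≤ z) {c : ℝ → ℝ≥0}
    (hc : Measurable c) (hC : ∫⁻ t in stage τ τ', (c t : ℝ≥0∞) ≠ ∞) :
    (∫⁻ t in stage τ τ', ENNReal.ofReal (Real.exp (-p.r * t) * p.u (c t)))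
        + ENNReal.ofReal (p.discount τ' * p.hotelling z)
      ≤ ENNReal.ofReal (p.discount τ *
          p.hotelling ((∫⁻ t in stage τ τ', (c t : ℝ≥0∞)).toReal + z)) := by
  have hb := h.rate_pos
  have hα := h.α_pos
  rcases eq_or_ne τ ∞ with hτ | hτ
  · have hτ' : τ' = ∞ := top_le_iff.1 (hτ ▸ hττ)
    simp [hτ, hτ', stage_top, Params.discount]
  set C := (∫⁻ t in stage τ τ', (c t : ℝ≥0∞)).toReal with hCdef
  have hC0 : 0 ≤ C := ENNReal.toReal_nonneg
  rcases eq_or_lt_of_le (add_nonneg hC0 hz) with hS | hS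
  -- Zero total reserves are treated apart, since the tangent argument needs a finite marginal
  -- value.
  · have hz' : z = 0 := by linarith
    have hC' : C = 0 := by linarith
    have hc0 : ∫⁻ t in stage τ τ', (c t : ℝ≥0∞) = 0 := by
      rcases (ENNReal.toReal_eq_zero_iff _).1 hC' with h0 | h0
      · exact h0
      · exact absurd h0 hC
    rw [lintegral_eq_zero_iff hc.coe_nnreal_ennreal] at hc0
    have hu : ∫⁻ t in stage τ τ', ENNReal.ofReal (Real.exp (-p.r * t) * p.u (c t)) = 0 := by
      rw [lintegral_congr_ae (g := fun _ => 0)]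
      · simp
      · filter_upwards [hc0] with t ht
        have : c t = 0 := by simpa using ht
        simp [this, Params.u, Real.zero_rpow hα.ne']
    rw [hu, hz', h.hotelling_zero]
    simp
  set S := C + z with hSdef
  -- The multiplier of the resource constraint: the discounted marginal value, constant along the
  -- Hotelling path from total resources S.
  set κ := p.discount τ * p.marginal S with hκ
  have hκ0 : 0 ≤ κ := mul_nonneg (p.discount_nonneg _) (h.marginal_pos hS).le
  have hα1 : 0 ≤ 1 / p.α - 1 := by
    rw [sub_nonneg, le_div_iff₀ hα]; linarith [h.α_lt_one]
  set ε := p.remaining τ τ' with hε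
  have hε0 : 0 ≤ ε := remaining_nonneg
  have hε1 : ε ≤ 1 := h.remaining_le_one hττ
  -- Tangent inequality for the utility at the Hotelling path. Every tangent has discounted slope κ,
  -- so integration brings in only the total consumption C.
  have hpt : ∀ t, ENNReal.ofReal (Real.exp (-p.r * t) * p.u (c t))
      ≤ ENNReal.ofReal κ * c t
        + ENNReal.ofReal (κ * (1 / p.α - 1)) * ENNReal.ofReal (p.rate * p.reserves S τ t) := by
    intro t
    have hs : 0 < p.reserves S τ t := mul_pos hS (Real.exp_pos _)
    have hc0 : (0:ℝ) ≤ c t := (c t).2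
    rw [← ENNReal.ofReal_coe_nnreal, ← ENNReal.ofReal_mul hκ0,
      ← ENNReal.ofReal_mul (by positivity), ← ENNReal.ofReal_add (by positivity) (by positivity)]
    refine ENNReal.ofReal_le_ofReal ?_
    have ht := h.hotelling_le_tangent (z := c t / p.rate) (by positivity) hs
    rw [h.u_eq_hotelling hc0, hκ, ← h.discount_mul_marginal hS hτ t]
    rw [h.hotelling_eq_marginal hs] at ht
    have h1 := mul_le_mul_of_nonneg_left ht (mul_pos (Real.exp_pos (-p.r * t)) hb).le
    calc _ = Real.exp (-p.r * t) * p.rate * p.hotelling (c t / p.rate) := by ring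
      _ ≤ _ := h1
      _ = _ := by field_simp; ring
  have hint : ∫⁻ t in stage τ τ', ENNReal.ofReal (Real.exp (-p.r * t) * p.u (c t))
      ≤ ENNReal.ofReal (κ * C + κ * (1 / p.α - 1) * (S * (1 - ε))) := by
    refine (lintegral_mono hpt).trans_eq ?_
    rw [lintegral_add_left (hc.coe_nnreal_ennreal.const_mul _),
      lintegral_const_mul' _ _ ENNReal.ofReal_ne_top, lintegral_const_mul' _ _ ENNReal.ofReal_ne_top,
      h.lintegral_reserves hS.le hττ hτ, ← ENNReal.ofReal_toReal hC, ← hCdef,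
      ← ENNReal.ofReal_mul hκ0, ← ENNReal.ofReal_mul (by positivity),
      ← ENNReal.ofReal_add (by positivity)
        (mul_nonneg (by positivity) (mul_nonneg hS.le (by linarith)))]
  -- The same tangent inequality for the terminal value, at the reserves εS which the Hotelling path
  -- has left at τ'. Again the slope is κ, so consumption and terminal reserves add up to S.
  have hfin : p.discount τ' * p.hotelling z ≤ κ * (z + (1 / p.α - 1) * (ε * S)) := by
    rw [h.discount_eq_remaining hττ, ← hε]
    rcases eq_or_lt_of_le hε0 with h0 | h0
    · rw [← h0, Real.zero_rpow h.one_sub_pos.ne']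
      simp only [mul_zero, zero_mul, add_zero]
      positivity
    · have hεS : 0 < ε * S := mul_pos h0 hS
      have ht := h.hotelling_le_tangent hz hεS
      rw [h.hotelling_eq_marginal hεS] at ht
      have hm : ε ^ (1 - p.α) * p.marginal (ε * S) = p.marginal S := by
        unfold Params.marginal
        rw [mul_left_comm, Real.mul_rpow h0.le (by positivity), ← mul_assoc,
          ← Real.rpow_add h0]
        simp
      have h1 := mul_le_mul_of_nonneg_left ht
        (mul_nonneg (p.discount_nonneg τ) (Real.rpow_nonneg h0.le (1 - p.α)))
      refine h1.trans_eq ?_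
      rw [hκ, ← hm]
      field_simp
      ring
  refine (add_le_add_left hint _).trans ?_
  rw [← ENNReal.ofReal_add (add_nonneg (by positivity)
    (mul_nonneg (by positivity) (mul_nonneg hS.le (by linarith))))
    (mul_nonneg (p.discount_nonneg _) (h.hotelling_nonneg hz))]
  refine ENNReal.ofReal_le_ofReal ?_
  have hU : p.discount τ * p.hotelling S = κ * S / p.α := by
    rw [h.hotelling_eq_marginal hS, hκ]; ring
  rw [hU]
  calc _ ≤ κ * C + κ * (1 / p.α - 1) * (S * (1 - ε)) + κ * (z + (1 / p.α - 1) * (ε * S)) := by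
        linarith
    _ = _ := by rw [hSdef]; field_simp; ring

/-- The utility of depleting reserves at the constant rate `(1 - α)⁻¹ r`. -/
lemma lintegral_u_reserves (h : p.Regular) (hS : 0 ≤ S) (hττ : τ ≤ τ') :
    ∫⁻ t in stage τ τ', ENNReal.ofReal
        (Real.exp (-p.r * t) * p.u (Real.toNNReal (p.rate * p.reserves S τ t)))
      = ENNReal.ofReal (p.discount τ * p.hotelling S * (1 - p.remaining τ τ')) := by
  have hb := h.rate_pos
  have hα := h.α_pos
  rcases eq_or_ne τ ∞ with hτ | hτ
  · simp [hτ, stage_top, Params.discount]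
  rcases eq_or_lt_of_le hS with hS' | hS'
  · simp [← hS', Params.reserves, Params.u, Real.zero_rpow hα.ne', h.hotelling_zero]
  set κ := p.discount τ * p.marginal S with hκ
  have hκ0 : 0 ≤ κ := mul_nonneg (p.discount_nonneg _) (h.marginal_pos hS').le
  have : p.discount τ * p.hotelling S * (1 - p.remaining τ τ')
      = κ / p.α * (S * (1 - p.remaining τ τ')) := by
    rw [h.hotelling_eq_marginal hS', hκ]; ring
  rw [this, ENNReal.ofReal_mul (by positivity), ← h.lintegral_reserves hS hττ hτ,
    ← lintegral_const_mul' _ _ ENNReal.ofReal_ne_top]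
  refine lintegral_congr fun t => ?_
  have hs : 0 < p.reserves S τ t := mul_pos hS' (Real.exp_pos _)
  rw [← ENNReal.ofReal_mul (by positivity), Real.coe_toNNReal _ (by positivity),
    h.u_eq_hotelling (by positivity), mul_div_cancel_left₀ _ hb.ne', h.hotelling_eq_marginal hs,
    hκ, ← h.discount_mul_marginal hS' hτ t]
  congr 1
  ring

end Params.Regular

/-! ### Decomposition of a strategy into episodes -/

variable {Ω : Type*}

/-- The date at which the `n`-th consumption episode starts. -/
def stageStart (θ : ℕ → Ω → ℝ≥0∞) : ℕ → Ω → ℝ≥0∞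
  | 0 => fun _ => 0
  | n + 1 => θ n

lemma stageStart_le {θ : ℕ → Ω → ℝ≥0∞} {ω : Ω} (hθ : Monotone fun n => θ n ω) (n : ℕ) :
    stageStart θ n ω ≤ θ n ω := by
  cases n with
  | zero => exact zero_le
  | succ n => exact hθ (Nat.le_succ n)

section Path

variable {ξ : ℕ → Ω → ℝ} {x : ℝ} {θ : ℕ → Ω → ℝ≥0∞} {c : ℕ → Ω → ℝ → ℝ≥0} {ω : Ω}

lemma consumption_eq_of_mem_stage (hθ : Monotone fun n => θ n ω) {n : ℕ} (hn : n ≤ count ξ x ω)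
    {t : ℝ} (ht : t ∈ stage (stageStart θ n ω) (θ n ω)) : consumption ξ x θ c ω t = c n ω t := by
  obtain ⟨-, h1, h2⟩ := ht
  have hB : ¬ θ (count ξ x ω) ω ≤ ENNReal.ofReal t := not_le.2 (h2.trans_le (hθ hn))
  unfold consumption
  rw [if_neg hB, add_zero]
  cases n with
  | zero =>
    rw [if_pos h2, Finset.sum_eq_zero, add_zero]
    intro j _
    exact if_neg fun hh => absurd hh.1 (not_le.2 (h2.trans_le (hθ (Nat.zero_le _))))
  | succ n =>
    have hA : ¬ ENNReal.ofReal t < θ 0 ω := not_lt.2 ((hθ (Nat.zero_le n)).trans h1)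
    rw [if_neg hA, zero_add, Finset.sum_eq_single (n + 1)]
    · exact if_pos ⟨h1, h2⟩
    · intro j hj hjn
      refine if_neg fun hh => ?_
      rcases lt_or_gt_of_ne hjn with hlt | hgt
      · exact absurd (hh.2.trans_le ((hθ (Nat.lt_succ_iff.1 hlt)).trans h1)) (lt_irrefl _)
      · exact absurd (hh.1.trans_lt (h2.trans_le (hθ (Nat.le_sub_one_of_lt hgt)))) (lt_irrefl _)
    · intro hj
      exact absurd (Finset.mem_Icc.2 ⟨Nat.succ_pos n, hn⟩) hj

lemma consumption_eq_of_mem_last (hθ : Monotone fun n => θ n ω)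
    {t : ℝ} (ht : t ∈ stage (θ (count ξ x ω) ω) ∞) :
    consumption ξ x θ c ω t = c (count ξ x ω + 1) ω t := by
  obtain ⟨-, h1, -⟩ := ht
  have hA : ¬ ENNReal.ofReal t < θ 0 ω := not_lt.2 ((hθ (Nat.zero_le _)).trans h1)
  unfold consumption
  rw [if_neg hA, if_pos h1, Finset.sum_eq_zero, zero_add, zero_add]
  intro j hj
  exact if_neg fun hh => absurd (hh.2.trans_le (hθ (Finset.mem_Icc.1 hj).2)) (not_lt.2 h1)

lemma lintegral_stage_zero (hθ : Monotone fun n => θ n ω) (n : ℕ) (f : ℝ → ℝ≥0∞) :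
    ∫⁻ t in stage 0 (θ n ω), f t
      = ∑ j ∈ Finset.range (n + 1), ∫⁻ t in stage (stageStart θ j ω) (θ j ω), f t := by
  induction n with
  | zero => simp [stageStart]
  | succ n ih =>
    rw [Finset.sum_range_succ, ← ih]
    exact lintegral_stage_add zero_le (hθ (Nat.le_succ n)) f

lemma lintegral_consumption_stages (hθ : Monotone fun n => θ n ω) {n : ℕ}
    (hn : n ≤ count ξ x ω) (F : ℝ → ℝ≥0 → ℝ≥0∞) :
    ∫⁻ t in stage 0 (θ n ω), F t (consumption ξ x θ c ω t)
      = ∑ j ∈ Finset.range (n + 1), ∫⁻ t in stage (stageStart θ j ω) (θ j ω), F t (c j ω t) := by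
  rw [lintegral_stage_zero hθ]
  refine Finset.sum_congr rfl fun j hj => ?_
  refine setLIntegral_congr_fun (measurableSet_stage _ _) fun t ht => ?_
  simp only [consumption_eq_of_mem_stage hθ
    ((Nat.lt_succ_iff.1 (Finset.mem_range.1 hj)).trans hn) ht]

lemma lintegral_consumption (hθ : Monotone fun n => θ n ω) (F : ℝ → ℝ≥0 → ℝ≥0∞) :
    ∫⁻ t in Ioi 0, F t (consumption ξ x θ c ω t)
      = (∑ j ∈ Finset.range (count ξ x ω + 1),
          ∫⁻ t in stage (stageStart θ j ω) (θ j ω), F t (c j ω t))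
        + ∫⁻ t in stage (θ (count ξ x ω) ω) ∞, F t (c (count ξ x ω + 1) ω t) := by
  rw [← stage_zero_top, lintegral_stage_add zero_le (le_top (a := θ (count ξ x ω) ω)),
    lintegral_consumption_stages hθ le_rfl]
  congr 1
  refine setLIntegral_congr_fun (measurableSet_stage _ _) fun t ht => ?_
  simp only [consumption_eq_of_mem_last hθ ht]

end Path

/-- Consumption during the `n`-th episode. -/
def stageUse (θ : ℕ → Ω → ℝ≥0∞) (c : ℕ → Ω → ℝ → ℝ≥0) (n : ℕ) (ω : Ω) : ℝ≥0∞ :=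
  ∫⁻ t in stage (stageStart θ n ω) (θ n ω), c n ω t

/-- Discounted utility of the `n`-th episode. -/
def stageUtility (p : Params) (θ : ℕ → Ω → ℝ≥0∞) (c : ℕ → Ω → ℝ → ℝ≥0) (n : ℕ) (ω : Ω) : ℝ≥0∞ :=
  ∫⁻ t in stage (stageStart θ n ω) (θ n ω), ENNReal.ofReal (Real.exp (-p.r * t) * p.u (c n ω t))

/-- Discounted utility after the date `θ n`, if the exploration that starts then is fruitless. -/
def lastUtility (p : Params) (θ : ℕ → Ω → ℝ≥0∞) (c : ℕ → Ω → ℝ → ℝ≥0) (n : ℕ) (ω : Ω) : ℝ≥0∞ :=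
  ∫⁻ t in stage (θ n ω) ∞, ENNReal.ofReal (Real.exp (-p.r * t) * p.u (c (n + 1) ω t))

section Gain

variable [m0 : MeasurableSpace Ω] {P : Measure Ω} {p : Params} {ξ : ℕ → Ω → ℝ} {x : ℝ}
  {θ : ℕ → Ω → ℝ≥0∞} {c : ℕ → Ω → ℝ → ℝ≥0}

lemma mem_diff_iff_count (hξ : IsPoissonArrivals P p.lam ξ) (hx : 0 ≤ x) (n : ℕ) (ω : Ω) :
    ω ∈ {ω | ξ n ω ≤ x} \ {ω | ξ (n + 1) ω ≤ x} ↔ n = count ξ x ω := by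
  simp only [mem_sdiff, mem_ofPred_eq, ← le_count_iff hξ hx]
  omega

lemma measurable_stageUtility (hθ : ∀ n, Measurable (θ n))
    (hc : ∀ n, Measurable fun q : Ω × ℝ => c n q.1 q.2) (n : ℕ) :
    Measurable (stageUtility p θ c n) := by
  have h1 : Measurable (stageStart θ n) := by
    cases n with
    | zero => exact measurable_const
    | succ n => exact hθ n
  refine measurable_lintegral_stage h1 (hθ n) (f := fun q =>
    ENNReal.ofReal (Real.exp (-p.r * q.2) * p.u (c n q.1 q.2))) ?_
  unfold Params.u
  have := hc n
  fun_prop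

lemma measurable_lastUtility (hθ : ∀ n, Measurable (θ n))
    (hc : ∀ n, Measurable fun q : Ω × ℝ => c n q.1 q.2) (n : ℕ) :
    Measurable (lastUtility p θ c n) := by
  refine measurable_lintegral_stage (hθ n) measurable_const (f := fun q =>
    ENNReal.ofReal (Real.exp (-p.r * q.2) * p.u (c (n + 1) q.1 q.2))) ?_
  unfold Params.u
  have := hc (n + 1)
  fun_prop

/-- Summing over all n with the event {ξ_n ≤ x}, instead of over n ≤ N_x along each path, allows
expectation and sum to be exchanged. -/
lemma lintegral_utility_eq_tsum (hξ : IsPoissonArrivals P p.lam ξ) (hx : 0 ≤ x)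
    (hmono : ∀ ω, Monotone fun n => θ n ω) (hθ : ∀ n, Measurable (θ n))
    (hc : ∀ n, Measurable fun q : Ω × ℝ => c n q.1 q.2) :
    ∫⁻ ω, (∫⁻ t in Ioi (0 : ℝ),
        ENNReal.ofReal (Real.exp (-p.r * t) * p.u (consumption ξ x θ c ω t))) ∂P
      = ∑' n, ((∫⁻ ω in {ω | ξ n ω ≤ x}, stageUtility p θ c n ω ∂P)
        + ∫⁻ ω in {ω | ξ n ω ≤ x} \ {ω | ξ (n + 1) ω ≤ x}, lastUtility p θ c n ω ∂P) := by
  have hE := hξ.measurableSet_le_level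
  have hm1 := measurable_stageUtility (p := p) hθ hc
  have hm2 := measurable_lastUtility (p := p) hθ hc
  have e : ∀ n, (∫⁻ ω in {ω | ξ n ω ≤ x}, stageUtility p θ c n ω ∂P)
        + ∫⁻ ω in {ω | ξ n ω ≤ x} \ {ω | ξ (n + 1) ω ≤ x}, lastUtility p θ c n ω ∂P
      = ∫⁻ ω, (indicator {ω | ξ n ω ≤ x} (stageUtility p θ c n) ω
        + indicator ({ω | ξ n ω ≤ x} \ {ω | ξ (n + 1) ω ≤ x}) (lastUtility p θ c n) ω) ∂P := by
    intro n
    rw [lintegral_add_left ((hm1 n).indicator (hE n x)), lintegral_indicator (hE n x),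
      lintegral_indicator ((hE n x).diff (hE (n + 1) x))]
  simp_rw [e]
  rw [← lintegral_tsum (f := fun n ω => indicator {ω | ξ n ω ≤ x} (stageUtility p θ c n) ω
        + indicator ({ω | ξ n ω ≤ x} \ {ω | ξ (n + 1) ω ≤ x}) (lastUtility p θ c n) ω)
      fun n => (((hm1 n).indicator (hE n x)).add
    ((hm2 n).indicator ((hE n x).diff (hE (n + 1) x)))).aemeasurable]
  refine lintegral_congr fun ω => ?_
  rw [ENNReal.tsum_add, lintegral_consumption (hmono ω)
    (fun t y => ENNReal.ofReal (Real.exp (-p.r * t) * p.u y))]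
  congr 1
  · rw [tsum_eq_sum (s := Finset.range (count ξ x ω + 1))]
    · refine Finset.sum_congr rfl fun n hn => ?_
      have : ξ n ω ≤ x := (le_count_iff hξ hx n ω).1 (Nat.lt_succ_iff.1 (Finset.mem_range.1 hn))
      rw [indicator_of_mem (by exact this)]
      rfl
    · intro n hn
      refine indicator_of_notMem (fun hh => hn ?_) _
      exact Finset.mem_range.2 (Nat.lt_succ_iff.2 ((le_count_iff hξ hx n ω).2 hh))
  · rw [tsum_eq_single (count ξ x ω)]
    · rw [indicator_of_mem ((mem_diff_iff_count hξ hx _ ω).2 rfl)]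
      rfl
    · intro n hn
      exact indicator_of_notMem (fun hh => hn ((mem_diff_iff_count hξ hx _ ω).1 hh)) _

lemma explored_mono (hξ : IsPoissonArrivals P p.lam ξ) (x : ℝ) (ω : Ω) :
    Monotone fun n => explored ξ x n ω := fun _ _ hmn =>
  min_le_min_right x ((hξ.strictMono ω).monotone hmn)

lemma lintegral_cost_eq_tsum (h : p.Regular) (hξ : IsPoissonArrivals P p.lam ξ) (hx : 0 ≤ x)
    (hθ : ∀ n, Measurable (θ n)) :
    ∫⁻ ω, ENNReal.ofReal (p.k * ∑ n ∈ Finset.range (count ξ x ω + 1),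
        p.discount (θ n ω) * (explored ξ x (n + 1) ω - explored ξ x n ω)) ∂P
      = ∑' n, ∫⁻ ω in {ω | ξ n ω ≤ x}, ENNReal.ofReal
        (p.discount (θ n ω) * p.k * (explored ξ x (n + 1) ω - explored ξ x n ω)) ∂P := by
  have hE := hξ.measurableSet_le_level
  have hm : ∀ n, Measurable fun ω => ENNReal.ofReal
      (p.discount (θ n ω) * p.k * (explored ξ x (n + 1) ω - explored ξ x n ω)) := by
    intro n
    have h1 := p.measurable_discount.comp (hθ n)
    have h2 : ∀ j, Measurable (explored ξ x j) := fun j => (hξ.measurable j).min measurable_const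
    exact ((h1.mul_const p.k).mul ((h2 (n + 1)).sub (h2 n))).ennreal_ofReal
  have hk := h.k_pos
  simp_rw [← lintegral_indicator (hE _ x)]
  rw [← lintegral_tsum fun n => ((hm n).indicator (hE n x)).aemeasurable]
  refine lintegral_congr fun ω => ?_
  have hd : ∀ n, 0 ≤ explored ξ x (n + 1) ω - explored ξ x n ω := fun n =>
    sub_nonneg.2 (explored_mono hξ x ω (Nat.le_succ n))
  have hd' := fun n => p.discount_nonneg (θ n ω)
  rw [Finset.mul_sum, ENNReal.ofReal_sum_of_nonneg fun n _ =>
      mul_nonneg hk.le (mul_nonneg (hd' n) (hd n)),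
    tsum_eq_sum (s := Finset.range (count ξ x ω + 1))]
  · refine Finset.sum_congr rfl fun n hn => ?_
    have : ξ n ω ≤ x := (le_count_iff hξ hx n ω).1 (Nat.lt_succ_iff.1 (Finset.mem_range.1 hn))
    rw [indicator_of_mem (by exact this)]
    congr 1
    ring
  · intro n hn
    refine indicator_of_notMem (fun hh => hn ?_) _
    exact Finset.mem_range.2 (Nat.lt_succ_iff.2 ((le_count_iff hξ hx n ω).2 hh))

lemma discount_le_one (h : p.Regular) (τ : ℝ≥0∞) : p.discount τ ≤ 1 := by
  have := h.r_pos
  have := ENNReal.toReal_nonneg (a := τ)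
  unfold Params.discount
  split_ifs
  · exact zero_le_one
  · rw [Real.exp_le_one_iff]; nlinarith

lemma lintegral_cost_ne_top [IsProbabilityMeasure P] (h : p.Regular)
    (hξ : IsPoissonArrivals P p.lam ξ) (hx : 0 ≤ x) :
    ∫⁻ ω, ENNReal.ofReal (p.k * ∑ n ∈ Finset.range (count ξ x ω + 1),
        p.discount (θ n ω) * (explored ξ x (n + 1) ω - explored ξ x n ω)) ∂P ≠ ∞ := by
  have hk := h.k_pos
  refine ne_top_of_le_ne_top (b := ENNReal.ofReal (p.k * x)) ENNReal.ofReal_ne_top ?_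
  refine (lintegral_mono (g := fun _ => ENNReal.ofReal (p.k * x)) fun ω => ?_).trans_eq (by simp)
  refine ENNReal.ofReal_le_ofReal (mul_le_mul_of_nonneg_left ?_ hk.le)
  have hd : ∀ n, 0 ≤ explored ξ x (n + 1) ω - explored ξ x n ω := fun n =>
    sub_nonneg.2 (explored_mono hξ x ω (Nat.le_succ n))
  calc _ ≤ ∑ n ∈ Finset.range (count ξ x ω + 1),
        (explored ξ x (n + 1) ω - explored ξ x n ω) :=
      Finset.sum_le_sum fun n _ => mul_le_of_le_one_left (hd n) (discount_le_one h _)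
    _ = explored ξ x (count ξ x ω + 1) ω - explored ξ x 0 ω :=
      Finset.sum_range_sub (fun n => explored ξ x n ω) _
    _ ≤ x := by
      have h0 : explored ξ x 0 ω = 0 := by simp [explored, hξ.zero, hx]
      rw [h0, sub_zero]
      exact min_le_right _ _

end Gain

/-! ### Upper bound for admissible strategies -/

lemma lintegral_stage_zero_le {f : ℝ → ℝ≥0∞} {τ B : ℝ≥0∞}
    (hf : ∀ t : ℝ, 0 ≤ t → ENNReal.ofReal t < τ → ∫⁻ s in Ioc 0 t, f s ≤ B) :
    ∫⁻ t in stage 0 τ, f t ≤ B := by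
  rcases eq_or_ne τ 0 with h0 | h0
  · have : stage 0 τ = ∅ := by ext t; simp [stage, h0]
    simp [this]
  -- The stage is exhausted from inside by dates strictly before τ: at τ itself the budget may
  -- already include a new deposit.
  obtain ⟨u, hu, hlt, hlim⟩ := exists_seq_strictMono_tendsto' (bot_lt_iff_ne_bot.2 h0)
  have hne : ∀ n, u n ≠ ∞ := fun n => ((hlt n).2.trans_le le_top).ne
  have hset : stage 0 τ ⊆ ⋃ n, Ioc 0 (u n).toReal := by
    intro t ht
    obtain ⟨n, hn⟩ := (((tendsto_order.1 hlim).1 _ ht.2.2)).exists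
    refine mem_iUnion.2 ⟨n, ht.1, ?_⟩
    rw [← ENNReal.toReal_ofReal ht.1.le]
    exact ENNReal.toReal_mono (hne n) hn.le
  refine (lintegral_mono_set hset).trans ?_
  rw [setLIntegral_iUnion_of_directed]
  · refine iSup_le fun n => hf _ ENNReal.toReal_nonneg ?_
    rw [ENNReal.ofReal_toReal (hne n)]
    exact (hlt n).2
  · refine Monotone.directed_le fun m n hmn => Ioc_subset_Ioc_right ?_
    exact ENNReal.toReal_mono (hne n) (hu.monotone hmn)

/-- Reserves at the beginning of the `n`-th consumption episode. -/
def stock (p : Params) {Ω : Type*} (R : ℝ) (θ : ℕ → Ω → ℝ≥0∞) (c : ℕ → Ω → ℝ → ℝ≥0) (n : ℕ)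
    (ω : Ω) : ℝ :=
  R + n * p.a - ∑ j ∈ Finset.range n, (stageUse θ c j ω).toReal

variable {Ω : Type*} {p : Params} {R : ℝ} {θ : ℕ → Ω → ℝ≥0∞} {c : ℕ → Ω → ℝ → ℝ≥0}

lemma stock_succ (n : ℕ) (ω : Ω) :
    stock p R θ c (n + 1) ω = stock p R θ c n ω - (stageUse θ c n ω).toReal + p.a := by
  unfold stock
  rw [Finset.sum_range_succ]
  push_cast
  ring

variable [m0 : MeasurableSpace Ω] {P : Measure Ω} {ξ : ℕ → Ω → ℝ} {x : ℝ}

namespace IsAdmissible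

lemma measurable_stageStart (hξ : IsPoissonArrivals P p.lam ξ)
    (hs : IsAdmissible P ξ p x R θ c) (n : ℕ) : Measurable[stopped ξ x n] (stageStart θ n) := by
  cases n with
  | zero => exact measurable_const
  | succ n => exact (hs.measurable_θ n).mono (hξ.stopped_mono x (Nat.le_succ n)) le_rfl

lemma measurable_stageUse (hξ : IsPoissonArrivals P p.lam ξ) (hs : IsAdmissible P ξ p x R θ c)
    (n : ℕ) : Measurable[stopped ξ x n] (stageUse θ c n) :=
  measurable_lintegral_stage (m := stopped ξ x n) (f := fun q => (c n q.1 q.2 : ℝ≥0∞))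
    (hs.measurable_stageStart hξ n) (hs.measurable_θ n)
    (measurable_coe_nnreal_ennreal.comp (hs.measurable_c n))

lemma measurable_stock (hξ : IsPoissonArrivals P p.lam ξ) (hs : IsAdmissible P ξ p x R θ c)
    (n : ℕ) : Measurable[stopped ξ x n] (stock p R θ c n) := by
  have hj : ∀ j ∈ Finset.range n,
      Measurable[stopped ξ x n] fun ω => (stageUse θ c j ω).toReal := fun j hj =>
    ENNReal.measurable_toReal.comp ((hs.measurable_stageUse hξ j).mono
      (hξ.stopped_mono x (Finset.mem_range.1 hj).le) le_rfl)
  exact Measurable.sub (m := stopped ξ x n) measurable_const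
    (Finset.measurable_fun_sum (m := stopped ξ x n) _ hj)

lemma measurable_rate (hξ : IsPoissonArrivals P p.lam ξ) (hx : 0 ≤ x)
    (hs : IsAdmissible P ξ p x R θ c) (n : ℕ) : Measurable fun q : Ω × ℝ => c n q.1 q.2 :=
  (hs.measurable_c n).mono (sup_le_sup (MeasurableSpace.comap_mono (hξ.stopped_le hx n)) le_rfl)
    le_rfl

lemma measurable_date (hξ : IsPoissonArrivals P p.lam ξ) (hx : 0 ≤ x)
    (hs : IsAdmissible P ξ p x R θ c) (n : ℕ) : Measurable (θ n) :=
  (hs.measurable_θ n).mono (hξ.stopped_le hx n) le_rfl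

/-- The resources available for the first `n + 1` consumption episodes, and for all of them. -/
lemma sum_stageUse_le (ha : 0 ≤ p.a) (hs : IsAdmissible P ξ p x R θ c) : ∀ᵐ ω ∂P,
    (∀ n ≤ count ξ x ω, ∑ j ∈ Finset.range (n + 1), stageUse θ c j ω
      ≤ ENNReal.ofReal (R + n * p.a)) ∧
    (∑ j ∈ Finset.range (count ξ x ω + 1), stageUse θ c j ω)
        + ∫⁻ t in stage (θ (count ξ x ω) ω) ∞, (c (count ξ x ω + 1) ω t : ℝ≥0∞)
      ≤ ENNReal.ofReal (R + count ξ x ω * p.a) := by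
  filter_upwards [hs.budget] with ω hω
  have hmono := hs.mono ω
  refine ⟨fun n hn => ?_, ?_⟩
  · have := lintegral_consumption_stages (c := c) hmono hn fun _ y => (y : ℝ≥0∞)
    unfold stageUse
    rw [← this]
    refine lintegral_stage_zero_le fun t ht hlt => (hω t ht).trans (ENNReal.ofReal_le_ofReal ?_)
    rw [mul_comm (n : ℝ)]
    refine add_le_add_right (mul_le_mul_of_nonneg_left ?_ ha) R
    rw [Finset.sum_boole]
    -- Before the date `θ n`, only the deposits with index below n can have been collected.
    refine Nat.cast_le.2 ((Finset.card_le_card (t := Finset.range n) fun j hj => ?_).trans_eq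
      (Finset.card_range n))
    rw [Finset.mem_range]
    by_contra! hc
    exact absurd ((hmono hc).trans (Finset.mem_filter.1 hj).2) (not_le.2 hlt)
  · have := lintegral_consumption (ξ := ξ) (x := x) (c := c) hmono fun _ y => (y : ℝ≥0∞)
    unfold stageUse
    rw [← this, ← stage_zero_top]
    refine lintegral_stage_zero_le fun t ht _ => (hω t ht).trans (ENNReal.ofReal_le_ofReal ?_)
    rw [mul_comm (count ξ x ω : ℝ)]
    refine add_le_add_right (mul_le_mul_of_nonneg_left ?_ ha) R
    rw [Finset.sum_boole]
    exact Nat.cast_le.2 ((Finset.card_filter_le _ _).trans_eq (Finset.card_range _))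

lemma stock_bounds (hR : 0 ≤ R) (ha : 0 ≤ p.a) (hξ : IsPoissonArrivals P p.lam ξ) (hx : 0 ≤ x)
    (hs : IsAdmissible P ξ p x R θ c) : ∀ᵐ ω ∂P, ∀ n, ξ n ω ≤ x →
      stageUse θ c n ω ≠ ∞ ∧ (stageUse θ c n ω).toReal ≤ stock p R θ c n ω ∧
      (ω ∉ {ω | ξ (n + 1) ω ≤ x} → ∫⁻ t in stage (θ n ω) ∞, (c (n + 1) ω t : ℝ≥0∞)
        ≤ ENNReal.ofReal (stock p R θ c n ω - (stageUse θ c n ω).toReal)) := by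
  filter_upwards [hs.sum_stageUse_le ha] with ω hω n hn
  have hn' := (le_count_iff hξ hx n ω).2 hn
  have h1 := hω.1 n hn'
  have hfin : ∀ j ∈ Finset.range (n + 1), stageUse θ c j ω ≠ ∞ := fun j hj =>
    ne_top_of_le_ne_top ENNReal.ofReal_ne_top
      ((Finset.single_le_sum (f := fun j => stageUse θ c j ω) (fun _ _ => zero_le) hj).trans h1)
  have hnn : 0 ≤ R + n * p.a := by positivity
  have hsum : ∑ j ∈ Finset.range (n + 1), stageUse θ c j ω
      = ENNReal.ofReal (∑ j ∈ Finset.range (n + 1), (stageUse θ c j ω).toReal) := by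
    rw [ENNReal.ofReal_sum_of_nonneg fun _ _ => ENNReal.toReal_nonneg]
    exact Finset.sum_congr rfl fun j hj => (ENNReal.ofReal_toReal (hfin j hj)).symm
  have hstock : stock p R θ c n ω - (stageUse θ c n ω).toReal
      = R + n * p.a - ∑ j ∈ Finset.range (n + 1), (stageUse θ c j ω).toReal := by
    unfold stock; rw [Finset.sum_range_succ]; ring
  refine ⟨hfin n (Finset.self_mem_range_succ n), ?_, fun hω' => ?_⟩
  · rw [hsum, ENNReal.ofReal_le_ofReal_iff hnn] at h1
    linarith
  · have hc : n = count ξ x ω := (mem_diff_iff_count hξ hx n ω).1 ⟨hn, hω'⟩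
    have h2 := hω.2
    rw [← hc, hsum] at h2
    rw [hstock, ENNReal.ofReal_sub _ (Finset.sum_nonneg fun _ _ => ENNReal.toReal_nonneg)]
    exact ENNReal.le_sub_of_add_le_left ENNReal.ofReal_ne_top h2

end IsAdmissible

/-- Expected discounted value of the problem faced at the beginning of the `n`-th episode, with
reserves `S n`. -/
def continuation (P : Measure Ω) (ξ : ℕ → Ω → ℝ) (p : Params) (x : ℝ) (θ : ℕ → Ω → ℝ≥0∞)
    (S : ℕ → Ω → ℝ) (n : ℕ) : ℝ≥0∞ :=
  ∫⁻ ω in {ω | ξ n ω ≤ x},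
    ENNReal.ofReal (p.discount (stageStart θ n ω) * p.limitValue (x - ξ n ω) (S n ω)) ∂P

lemma continuation_zero [IsProbabilityMeasure P] (hξ : IsPoissonArrivals P p.lam ξ) (hx : 0 ≤ x)
    {S : ℕ → Ω → ℝ} (hS : ∀ ω, S 0 ω = R) :
    continuation P ξ p x θ S 0 = ENNReal.ofReal (p.limitValue x R) := by
  have : p.discount 0 = 1 := by simp [Params.discount]
  simp [continuation, hξ.zero, stageStart, this, hS, hx]

/-- Bookkeeping without subtraction: u and b are the utilities of an episode and of a fruitless end,
v and v' successive continuation values, f the cost, w the outcome of exploring, z the Hotelling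
value kept after a fruitless exploration. -/
lemma add_le_of_balance {u b v v' w z f : ℝ≥0∞} (h : w + f = v' + z) (hu : u + w ≤ v)
    (hb : b ≤ z) : u + b + v' ≤ v + f :=
  calc u + b + v' ≤ u + z + v' := by gcongr
    _ = u + (v' + z) := by ring
    _ = u + w + f := by rw [← h, add_assoc]
    _ ≤ v + f := by gcongr

namespace IsAdmissible

/-- Consuming and then exploring does not beat the continuation value. -/
lemma stageUtility_add_le (h : p.Regular) (hR : 0 ≤ R) (hξ : IsPoissonArrivals P p.lam ξ)
    (hx : 0 ≤ x) (hs : IsAdmissible P ξ p x R θ c) : ∀ᵐ ω ∂P, ∀ n, ξ n ω ≤ x →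
      stageUtility p θ c n ω + ENNReal.ofReal (p.discount (θ n ω) *
          p.M p.limitValue (x - ξ n ω) (stock p R θ c n ω - (stageUse θ c n ω).toReal))
        ≤ ENNReal.ofReal (p.discount (stageStart θ n ω) *
          p.limitValue (x - ξ n ω) (stock p R θ c n ω)) := by
  filter_upwards [hs.stock_bounds hR h.a_pos.le hξ hx] with ω hω n hn
  obtain ⟨hfin, hle, -⟩ := hω n hn
  have hy : 0 ≤ x - ξ n ω := sub_nonneg.2 hn
  set C := (stageUse θ c n ω).toReal with hC
  set S := stock p R θ c n ω with hS
  have hC0 : 0 ≤ C := ENNReal.toReal_nonneg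
  have hρ : 0 ≤ S - C := sub_nonneg.2 hle
  have hM := h.candidate_limit.M_nonneg h hy hρ
  have hc : Measurable (c n ω) :=
    (hs.measurable_rate hξ hx n).comp (measurable_const.prodMk measurable_id)
  -- The outcome of exploring is replaced by certain reserves of the same value, which reduces the
  -- episode to a Hotelling problem. What remains is the definition of the maximal surplus.
  have := h.stage_le (stageStart_le (hs.mono ω) n) (h.certain_nonneg hM) hc hfin
  rw [h.hotelling_certain hM] at this
  refine this.trans (ENNReal.ofReal_le_ofReal (mul_le_mul_of_nonneg_left ?_
    (p.discount_nonneg _)))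
  rw [h.limitValue_eq_stopValue hy (hC0.trans hle), Params.stopValue]
  have hsur := h.surplus_le_maxSurplus (h.candidate_limit.continuous_M_slice h (x - ξ n ω)) hρ
    (sub_le_self S hC0)
  unfold Params.surplus at hsur
  have := h.certain_nonneg hM
  refine h.hotelling_mono (add_nonneg hC0 this) ?_
  change C + _ ≤ _
  linarith

lemma lastUtility_le (h : p.Regular) (hR : 0 ≤ R) (hξ : IsPoissonArrivals P p.lam ξ)
    (hx : 0 ≤ x) (hs : IsAdmissible P ξ p x R θ c) : ∀ᵐ ω ∂P, ∀ n,
      ω ∈ {ω | ξ n ω ≤ x} \ {ω | ξ (n + 1) ω ≤ x} →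
      lastUtility p θ c n ω ≤ ENNReal.ofReal (p.discount (θ n ω) *
          p.hotelling (stock p R θ c n ω - (stageUse θ c n ω).toReal)) := by
  filter_upwards [hs.stock_bounds hR h.a_pos.le hξ hx] with ω hω n hn
  obtain ⟨-, hle, hlast⟩ := hω n hn.1
  have hl := hlast hn.2
  have hfin := ne_top_of_le_ne_top ENNReal.ofReal_ne_top hl
  have hc : Measurable (c (n + 1) ω) :=
    (hs.measurable_rate hξ hx (n + 1)).comp (measurable_const.prodMk measurable_id)
  have := h.stage_le (le_top (a := θ n ω)) le_rfl hc hfin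
  rw [h.hotelling_zero, mul_zero, ENNReal.ofReal_zero, add_zero, add_zero] at this
  refine this.trans (ENNReal.ofReal_le_ofReal (mul_le_mul_of_nonneg_left ?_
    (p.discount_nonneg _)))
  exact h.hotelling_mono ENNReal.toReal_nonneg
    (ENNReal.toReal_le_of_le_ofReal (sub_nonneg.2 hle) hl)

/-- Utility, continuation value and cost of each episode satisfy one inequality; summed over n the
continuation values telescope, and the remainder is dropped since it is nonnegative. The total cost
is finite and may be subtracted at the end. -/
lemma gain_le [IsProbabilityMeasure P] (h : p.Regular) (hR : 0 ≤ R)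
    (hξ : IsPoissonArrivals P p.lam ξ) (hx : 0 ≤ x) (hs : IsAdmissible P ξ p x R θ c) :
    gain P ξ p x θ c ≤ (p.limitValue x R : EReal) := by
  have hE := hξ.measurableSet_le_level
  have hθ := hs.measurable_date hξ hx
  have hcm := hs.measurable_rate hξ hx
  set u : ℕ → ℝ≥0∞ := fun n => ∫⁻ ω in {ω | ξ n ω ≤ x}, stageUtility p θ c n ω ∂P with hu
  set b : ℕ → ℝ≥0∞ := fun n => ∫⁻ ω in {ω | ξ n ω ≤ x} \ {ω | ξ (n + 1) ω ≤ x},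
    lastUtility p θ c n ω ∂P with hb
  set f : ℕ → ℝ≥0∞ := fun n => ∫⁻ ω in {ω | ξ n ω ≤ x}, ENNReal.ofReal
        (p.discount (θ n ω) * p.k * (explored ξ x (n + 1) ω - explored ξ x n ω)) ∂P with hf
  set v := continuation P ξ p x θ (stock p R θ c) with hv
  set ρ : ℕ → Ω → ℝ := fun n ω => stock p R θ c n ω - (stageUse θ c n ω).toReal with hρ
  have hρm : ∀ n, Measurable[stopped ξ x n] (ρ n) := fun n =>
    Measurable.sub (m := stopped ξ x n) (hs.measurable_stock hξ n)
      (ENNReal.measurable_toReal.comp (hs.measurable_stageUse hξ n))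
  have hstep : ∀ n, u n + b n + v (n + 1) ≤ v n + f n := by
    intro n
    have hρ0 : ∀ᵐ ω ∂P, ξ n ω ≤ x → 0 ≤ ρ n ω := by
      filter_upwards [hs.stock_bounds hR h.a_pos.le hξ hx] with ω hω hn
      exact sub_nonneg.2 (hω n hn).2.1
    have hexp := lintegral_exploration h hξ hx n h.candidate_limit (d := fun ω => p.discount (θ n ω))
      (p.measurable_discount.comp (hs.measurable_θ n)) (hρm n)
      (ae_of_all _ fun ω _ => p.discount_nonneg _) hρ0
    have h1 : u n + ∫⁻ ω in {ω | ξ n ω ≤ x}, ENNReal.ofReal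
        (p.discount (θ n ω) * p.M p.limitValue (x - ξ n ω) (ρ n ω)) ∂P ≤ v n := by
      rw [hu, hv, ← lintegral_add_left (measurable_stageUtility hθ hcm n)]
      refine setLIntegral_mono_ae' (hE n x) ?_
      filter_upwards [hs.stageUtility_add_le h hR hξ hx] with ω hω hn
      exact hω n hn
    have h2 : b n ≤ ∫⁻ ω in {ω | ξ n ω ≤ x} \ {ω | ξ (n + 1) ω ≤ x},
        ENNReal.ofReal (p.discount (θ n ω) * p.hotelling (ρ n ω)) ∂P := by
      refine setLIntegral_mono_ae' ((hE n x).diff (hE (n + 1) x)) ?_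
      filter_upwards [hs.lastUtility_le h hR hξ hx] with ω hω hn
      exact hω n hn
    have h3 : v (n + 1) = ∫⁻ ω in {ω | ξ (n + 1) ω ≤ x}, ENNReal.ofReal
        (p.discount (θ n ω) * p.limitValue (x - ξ (n + 1) ω) (ρ n ω + p.a)) ∂P := by
      refine setLIntegral_congr_fun (hE (n + 1) x) fun ω _ => ?_
      simp only [stock_succ, stageStart, hρ]
    rw [← h3] at hexp
    exact add_le_of_balance hexp h1 h2
  have hpart : ∀ m, ∑ n ∈ Finset.range m, (u n + b n) + v m
      ≤ ENNReal.ofReal (p.limitValue x R) + ∑ n ∈ Finset.range m, f n := by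
    intro m
    induction m with
    | zero =>
      have : v 0 = ENNReal.ofReal (p.limitValue x R) :=
        continuation_zero hξ hx fun ω => by simp [stock]
      simp [this]
    | succ m ih =>
      rw [Finset.sum_range_succ, Finset.sum_range_succ]
      calc _ = ∑ n ∈ Finset.range m, (u n + b n) + (u m + b m + v (m + 1)) := by ring
        _ ≤ ∑ n ∈ Finset.range m, (u n + b n) + (v m + f m) := add_le_add_right (hstep m) _
        _ = (∑ n ∈ Finset.range m, (u n + b n) + v m) + f m := by ring
        _ ≤ _ := by rw [← add_assoc]; gcongr
  have htot : ∑' n, (u n + b n) ≤ ENNReal.ofReal (p.limitValue x R) + ∑' n, f n := by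
    refine ENNReal.tsum_le_of_sum_range_le fun m => ?_
    refine le_self_add.trans ((hpart m).trans ?_)
    gcongr
    exact ENNReal.sum_le_tsum _
  have hV : 0 ≤ p.limitValue x R :=
    (h.hotelling_nonneg hR).trans (h.candidate_limit.hotelling_le x R hx hR)
  have hcost := lintegral_cost_ne_top (θ := θ) h hξ hx
  unfold gain
  rw [lintegral_utility_eq_tsum hξ hx hs.mono hθ hcm]
  rw [lintegral_cost_eq_tsum h hξ hx hθ] at hcost ⊢
  change ((∑' n, (u n + b n) : ℝ≥0∞) : EReal) - ((∑' n, f n : ℝ≥0∞) : EReal) ≤ _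
  change ∑' n, f n ≠ ∞ at hcost
  generalize ∑' n, (u n + b n) = A at htot ⊢
  generalize ∑' n, f n = B at htot hcost ⊢
  have hA : A ≠ ∞ := ne_top_of_le_ne_top (by simp [hcost]) htot
  lift B to ℝ≥0 using hcost
  lift A to ℝ≥0 using hA
  have h1 := ENNReal.toReal_mono (by simp) htot
  rw [ENNReal.toReal_add (by simp) (by simp), ENNReal.toReal_ofReal hV] at h1
  simp only [ENNReal.coe_toReal] at h1
  have : ((A : ℝ) - B : ℝ) ≤ p.limitValue x R := by linarith
  exact EReal.coe_le_coe_iff.2 this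

end IsAdmissible

/-! ### The optimal strategy -/

/-- The gain in certain reserves offered by optimally timed exploration, with unexplored area `y`
and reserves `S`. -/
def Params.premium (p : Params) (y S : ℝ) : ℝ := p.maxSurplus (p.M p.limitValue y) S

/-- The level of reserves at which to explore, with unexplored area `y` and reserves `S`. -/
def Params.cutoff (p : Params) (y S : ℝ) : ℝ :=
  sInf {t | t ∈ Icc 0 S ∧ p.premium y t = p.premium y S}

namespace Params.Regular

variable {p : Params} {y S : ℝ}

lemma continuous_premium (h : p.Regular) : Continuous fun z : ℝ × ℝ => p.premium z.1 z.2 :=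
  h.continuous_maxSurplus (h.continuous_M h.continuous_limitValue)

lemma continuous_M_limitValue (h : p.Regular) (y : ℝ) : Continuous (p.M p.limitValue y) :=
  h.candidate_limit.continuous_M_slice h y

lemma premium_nonneg (h : p.Regular) (hy : 0 ≤ y) (hS : 0 ≤ S) : 0 ≤ p.premium y S :=
  h.maxSurplus_nonneg (h.continuous_M_limitValue y) (h.candidate_limit.M_nonneg h hy le_rfl) hS

lemma premium_zero (h : p.Regular) (hS : 0 ≤ S) : p.premium 0 S = 0 := by
  unfold Params.premium
  have : p.M p.limitValue 0 = p.hotelling := funext fun R => M_zero _ R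
  rw [this, h.maxSurplus_hotelling hS]

lemma limitValue_eq_premium (h : p.Regular) (hy : 0 ≤ y) (hS : 0 ≤ S) :
    p.limitValue y S = p.hotelling (S + p.premium y S) := h.limitValue_eq_stopValue hy hS

lemma cutoff_mem (h : p.Regular) (hS : 0 ≤ S) :
    p.cutoff y S ∈ Icc 0 S ∧ p.premium y (p.cutoff y S) = p.premium y S := by
  have hc : Continuous (p.premium y) := h.continuous_maxSurplus_single (h.continuous_M_limitValue y)
  have hcl : IsClosed {t | t ∈ Icc 0 S ∧ p.premium y t = p.premium y S} :=
    isClosed_Icc.inter (isClosed_eq hc continuous_const)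
  exact hcl.csInf_mem ⟨S, ⟨hS, le_rfl⟩, rfl⟩ ⟨0, fun t ht => ht.1.1⟩

/-- A maximizer R' of the surplus over the levels up to the cutoff already has the full premium, so
it cannot lie below the cutoff, which is minimal: the two coincide. -/
lemma surplus_cutoff (h : p.Regular) (hS : 0 ≤ S) :
    p.surplus (p.M p.limitValue y) (p.cutoff y S) = p.premium y S := by
  obtain ⟨hm, he⟩ := h.cutoff_mem (y := y) hS
  have hG := h.continuous_M_limitValue y
  obtain ⟨R', hR', hmax⟩ := h.exists_maxSurplus hG hm.1
  have h1 : p.premium y S = p.surplus (p.M p.limitValue y) R' := he.symm.trans hmax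
  have hle : R' ≤ S := hR'.2.trans hm.2
  have h2 : p.premium y R' = p.premium y S := by
    refine le_antisymm (h.maxSurplus_mono hG hR'.1 hle) ?_
    rw [h1]
    exact h.surplus_le_maxSurplus hG hR'.1 le_rfl
  have h3 : p.cutoff y S ≤ R' := csInf_le ⟨0, fun t ht => ht.1.1⟩ ⟨⟨hR'.1, hle⟩, h2⟩
  rw [h1, le_antisymm h3 hR'.2]

lemma M_cutoff (h : p.Regular) (hy : 0 ≤ y) (hS : 0 ≤ S) :
    p.M p.limitValue y (p.cutoff y S) = p.hotelling (p.cutoff y S + p.premium y S) := by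
  have h0 := (h.cutoff_mem (y := y) hS).1.1
  rw [← h.surplus_cutoff hS, Params.surplus, add_sub_cancel,
    h.hotelling_certain (h.candidate_limit.M_nonneg h hy h0)]

/-- The premium is monotone in the reserves, so for 0 ≤ t < S the cutoff is at most t exactly when
the premium at t equals the one at S: no infimum remains. For S < 0 the set is empty and its infimum
is 0 by convention. -/
lemma measurable_cutoff (h : p.Regular) : Measurable fun z : ℝ × ℝ => p.cutoff z.1 z.2 := by
  refine measurable_of_Iic fun t => ?_
  have hset : (fun z : ℝ × ℝ => p.cutoff z.1 z.2) ⁻¹' Iic t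
      = ({z | z.2 < 0} ∩ {_z | 0 ≤ t}) ∪ ({z | 0 ≤ z.2} ∩
        ({z | z.2 ≤ t} ∪ ({_z | 0 ≤ t} ∩ {z | p.premium z.1 t = p.premium z.1 z.2}))) := by
    ext ⟨y, S⟩
    simp only [mem_preimage, mem_Iic, mem_union, mem_inter_iff, mem_ofPred_eq]
    rcases lt_or_ge S 0 with hS | hS
    · have : p.cutoff y S = 0 := by
        have : {t | t ∈ Icc 0 S ∧ p.premium y t = p.premium y S} = ∅ := by
          ext u
          simp only [mem_ofPred_eq, mem_empty_iff_false, iff_false]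
          intro hu
          linarith [hu.1.1, hu.1.2]
        rw [Params.cutoff, this, Real.sInf_empty]
      simp [this, hS, not_le.2 hS]
    · obtain ⟨hm, he⟩ := h.cutoff_mem (y := y) hS
      have hG := h.continuous_M_limitValue y
      constructor
      · intro hle
        refine Or.inr ⟨hS, ?_⟩
        rcases le_or_gt S t with h1 | h1
        · exact Or.inl h1
        · refine Or.inr ⟨hm.1.trans hle, le_antisymm
            (h.maxSurplus_mono hG (hm.1.trans hle) h1.le) ?_⟩
          rw [← he]
          exact h.maxSurplus_mono hG hm.1 hle
      · rintro (⟨h1, -⟩ | ⟨-, h1 | ⟨h1, h2⟩⟩)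
        · linarith
        · exact hm.2.trans h1
        · rcases le_or_gt S t with h3 | h3
          · exact hm.2.trans h3
          · exact csInf_le ⟨0, fun t ht => ht.1.1⟩ ⟨⟨h1, h3.le⟩, h2⟩
  rw [hset]
  have hp := h.continuous_premium
  have hp' : Continuous fun z : ℝ × ℝ => p.premium z.1 t :=
    hp.comp (f := fun z : ℝ × ℝ => (z.1, t)) (by fun_prop)
  refine ((measurableSet_lt measurable_snd measurable_const).inter (MeasurableSet.const _)).union
    ((measurableSet_le measurable_const measurable_snd).inter
      ((measurableSet_le measurable_snd measurable_const).union ((MeasurableSet.const _).inter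
        (measurableSet_eq_fun hp'.measurable hp.measurable))))

end Params.Regular

/-- The optimal date of the next exploration, when the current episode starts at `τ` with
unexplored area `y` and reserves `S`. -/
def Params.nextDate (p : Params) (τ : ℝ≥0∞) (y S : ℝ) : ℝ≥0∞ :=
  if p.cutoff y S + p.premium y S = 0 then ∞ else
    τ + ENNReal.ofReal (Real.log ((S + p.premium y S) / (p.cutoff y S + p.premium y S)) / p.rate)

namespace Params.Regular

variable {p : Params} {y S : ℝ} {τ : ℝ≥0∞}

lemma measurable_nextDate (h : p.Regular) :
    Measurable fun z : ℝ≥0∞ × ℝ × ℝ => p.nextDate z.1 z.2.1 z.2.2 := by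
  have h1 : Measurable fun z : ℝ≥0∞ × ℝ × ℝ => p.cutoff z.2.1 z.2.2 :=
    h.measurable_cutoff.comp measurable_snd
  have h2 : Measurable fun z : ℝ≥0∞ × ℝ × ℝ => p.premium z.2.1 z.2.2 :=
    h.continuous_premium.measurable.comp measurable_snd
  unfold Params.nextDate
  refine Measurable.ite (measurableSet_eq_fun (h1.add h2) measurable_const) measurable_const ?_
  fun_prop

lemma le_nextDate : τ ≤ p.nextDate τ y S := by
  unfold Params.nextDate
  split_ifs
  · exact le_top
  · exact le_self_add

/-- The logarithm in `nextDate` is the time needed for `S + premium` to decay to `cutoff + premium`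
at the Hotelling rate. If the latter is 0 it is never reached, whence the date ∞. -/
lemma remaining_nextDate (h : p.Regular) (hy : 0 ≤ y) (hS : 0 ≤ S) (hτ : τ ≠ ∞) :
    p.remaining τ (p.nextDate τ y S) * (S + p.premium y S)
      = p.cutoff y S + p.premium y S := by
  have hm := h.premium_nonneg hy hS
  obtain ⟨hc0, hc1⟩ := (h.cutoff_mem (y := y) hS).1
  unfold Params.nextDate Params.remaining
  split_ifs with h0 h1 h1
  · rw [h0, zero_mul]
  · exact absurd rfl h1
  · exact absurd h1 (by simp [hτ])
  · have hpos : 0 < p.cutoff y S + p.premium y S := lt_of_le_of_ne (by positivity) (Ne.symm h0)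
    have hpos' : 0 < S + p.premium y S := by linarith
    have hlog : 0 ≤ Real.log ((S + p.premium y S) / (p.cutoff y S + p.premium y S)) :=
      Real.log_nonneg ((one_le_div hpos).2 (by linarith))
    have hb := h.rate_pos
    rw [ENNReal.toReal_add hτ ENNReal.ofReal_ne_top, ENNReal.toReal_ofReal (by positivity),
      add_sub_cancel_left, neg_mul, mul_div_cancel₀ _ hb.ne', Real.exp_neg,
      Real.exp_log (by positivity)]
    field_simp

lemma lintegral_optimal_use_le (h : p.Regular) (hy : 0 ≤ y) (hS : 0 ≤ S) :
    ∫⁻ t in stage τ (p.nextDate τ y S),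
        (Real.toNNReal (p.rate * p.reserves (S + p.premium y S) τ t) : ℝ≥0∞)
      ≤ ENNReal.ofReal (S - p.cutoff y S) := by
  rcases eq_or_ne τ ∞ with hτ | hτ
  · simp [hτ, stage_top]
  have hm := h.premium_nonneg hy hS
  have := h.lintegral_reserves (add_nonneg hS hm) (le_nextDate (p := p) (y := y) (S := S)) hτ
  refine this.trans_le (ENNReal.ofReal_le_ofReal ?_)
  have := h.remaining_nextDate hy hS hτ
  linarith

/-- The case of equality in `stage_le`. With ε the remaining fraction, the discount factor shrinks
by ε^(1 - α) and the Hotelling value by ε^α, so consumption and the reward take the shares 1 - ε and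
ε of the total. -/
lemma lintegral_optimal_u_add (h : p.Regular) (hy : 0 ≤ y) (hS : 0 ≤ S) :
    (∫⁻ t in stage τ (p.nextDate τ y S), ENNReal.ofReal (Real.exp (-p.r * t) *
        p.u (Real.toNNReal (p.rate * p.reserves (S + p.premium y S) τ t))))
      + ENNReal.ofReal (p.discount (p.nextDate τ y S) * p.M p.limitValue y (p.cutoff y S))
      = ENNReal.ofReal (p.discount τ * p.limitValue y S) := by
  have hm := h.premium_nonneg hy hS
  have hSm := add_nonneg hS hm
  have hle := le_nextDate (p := p) (y := y) (S := S) (τ := τ)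
  rcases eq_or_ne τ ∞ with hτ | hτ
  · have h1 : p.nextDate τ y S = ∞ := top_le_iff.1 (hτ ▸ hle)
    rw [h1, hτ]
    simp [stage_top, Params.discount]
  have hU := h.hotelling_nonneg hSm
  have hε0 := remaining_nonneg (p := p) (τ := τ) (τ' := p.nextDate τ y S)
  have hε1 := h.remaining_le_one hle
  rw [h.lintegral_u_reserves hSm hle, h.M_cutoff hy hS, h.limitValue_eq_premium hy hS,
    ← h.remaining_nextDate hy hS hτ, hotelling_mul hε0 hSm, h.discount_eq_remaining hle]
  have hd := p.discount_nonneg τ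
  have hpow : p.remaining τ (p.nextDate τ y S) ^ (1 - p.α)
      * p.remaining τ (p.nextDate τ y S) ^ p.α = p.remaining τ (p.nextDate τ y S) := by
    rw [← Real.rpow_add' hε0 (by simp)]
    simp
  rw [← ENNReal.ofReal_add (mul_nonneg (mul_nonneg hd hU) (sub_nonneg.2 hε1)) (by positivity)]
  congr 1
  calc _ = p.discount τ * p.hotelling (S + p.premium y S) * (1 - p.remaining τ (p.nextDate τ y S)
          + p.remaining τ (p.nextDate τ y S) ^ (1 - p.α)
            * p.remaining τ (p.nextDate τ y S) ^ p.α) := by ring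
    _ = _ := by rw [hpow]; ring

end Params.Regular


variable {Ω : Type*}

/-- Starting date and initial reserves of the consumption episodes under the optimal strategy. -/
def optimalState (p : Params) (ξ : ℕ → Ω → ℝ) (x R : ℝ) : ℕ → Ω → ℝ≥0∞ × ℝ
  | 0 => fun _ => (0, R)
  | n + 1 => fun ω =>
    (p.nextDate (optimalState p ξ x R n ω).1 (x - explored ξ x n ω) (optimalState p ξ x R n ω).2,
      p.cutoff (x - explored ξ x n ω) (optimalState p ξ x R n ω).2
        + if ξ (n + 1) ω ≤ x then p.a else 0)

/-- Reserves at the beginning of the `n`-th consumption episode under the optimal strategy. -/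
def optimalStock (p : Params) (ξ : ℕ → Ω → ℝ) (x R : ℝ) (n : ℕ) (ω : Ω) : ℝ :=
  (optimalState p ξ x R n ω).2

/-- Optimal exploration dates. -/
def optimalDate (p : Params) (ξ : ℕ → Ω → ℝ) (x R : ℝ) (n : ℕ) (ω : Ω) : ℝ≥0∞ :=
  (optimalState p ξ x R (n + 1) ω).1

/-- Optimal consumption rates. -/
def optimalRate (p : Params) (ξ : ℕ → Ω → ℝ) (x R : ℝ) (n : ℕ) (ω : Ω) (t : ℝ) : ℝ≥0 :=
  Real.toNNReal (p.rate * p.reserves (optimalStock p ξ x R n ω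
    + p.premium (x - explored ξ x n ω) (optimalStock p ξ x R n ω))
    (stageStart (optimalDate p ξ x R) n ω) t)

section Path

variable {p : Params} {ξ : ℕ → Ω → ℝ} {x R : ℝ}

lemma stageStart_optimalDate (n : ℕ) (ω : Ω) :
    stageStart (optimalDate p ξ x R) n ω = (optimalState p ξ x R n ω).1 := by
  cases n <;> rfl

lemma optimalDate_eq (n : ℕ) (ω : Ω) : optimalDate p ξ x R n ω
    = p.nextDate (stageStart (optimalDate p ξ x R) n ω) (x - explored ξ x n ω)
      (optimalStock p ξ x R n ω) := by
  rw [stageStart_optimalDate]; rfl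

lemma optimalStock_succ (n : ℕ) (ω : Ω) : optimalStock p ξ x R (n + 1) ω
    = p.cutoff (x - explored ξ x n ω) (optimalStock p ξ x R n ω)
      + if ξ (n + 1) ω ≤ x then p.a else 0 := rfl

lemma area_nonneg (ξ : ℕ → Ω → ℝ) (x : ℝ) (n : ℕ) (ω : Ω) : 0 ≤ x - explored ξ x n ω :=
  sub_nonneg.2 (min_le_right _ _)

lemma optimalStock_nonneg (h : p.Regular) (hR : 0 ≤ R) (n : ℕ) (ω : Ω) :
    0 ≤ optimalStock p ξ x R n ω := by
  induction n with
  | zero => exact hR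
  | succ n ih =>
    rw [optimalStock_succ]
    refine add_nonneg (h.cutoff_mem ih).1.1 ?_
    split_ifs
    exacts [h.a_pos.le, le_rfl]

lemma optimalStock_le (h : p.Regular) (hR : 0 ≤ R) (n : ℕ) (ω : Ω) :
    optimalStock p ξ x R n ω ≤ R + n * p.a := by
  induction n with
  | zero => simp [optimalStock, optimalState]
  | succ n ih =>
    rw [optimalStock_succ]
    have h1 := (h.cutoff_mem (y := x - explored ξ x n ω)
      (optimalStock_nonneg (ξ := ξ) (x := x) h hR n ω)).1.2
    have h2 : (if ξ (n + 1) ω ≤ x then p.a else 0) ≤ p.a := by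
      split_ifs
      exacts [le_rfl, h.a_pos.le]
    push_cast
    linarith

lemma optimalDate_mono (p : Params) (ξ : ℕ → Ω → ℝ) (x R : ℝ) (ω : Ω) :
    Monotone fun n => optimalDate p ξ x R n ω := by
  refine monotone_nat_of_le_succ fun n => ?_
  rw [optimalDate_eq (n + 1)]
  exact Params.Regular.le_nextDate

lemma stageUse_optimal_le (h : p.Regular) (hR : 0 ≤ R) (n : ℕ) (ω : Ω) :
    stageUse (optimalDate p ξ x R) (optimalRate p ξ x R) n ω
      ≤ ENNReal.ofReal (optimalStock p ξ x R n ω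
        - p.cutoff (x - explored ξ x n ω) (optimalStock p ξ x R n ω)) := by
  unfold stageUse
  rw [optimalDate_eq]
  exact h.lintegral_optimal_use_le (area_nonneg ξ x n ω) (optimalStock_nonneg h hR n ω)

lemma stageUtility_optimal_add (h : p.Regular) (hR : 0 ≤ R) (n : ℕ) (ω : Ω) :
    stageUtility p (optimalDate p ξ x R) (optimalRate p ξ x R) n ω
        + ENNReal.ofReal (p.discount (optimalDate p ξ x R n ω) *
          p.M p.limitValue (x - explored ξ x n ω)
            (p.cutoff (x - explored ξ x n ω) (optimalStock p ξ x R n ω)))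
      = ENNReal.ofReal (p.discount (stageStart (optimalDate p ξ x R) n ω) *
        p.limitValue (x - explored ξ x n ω) (optimalStock p ξ x R n ω)) := by
  unfold stageUtility
  rw [optimalDate_eq]
  exact h.lintegral_optimal_u_add (area_nonneg ξ x n ω) (optimalStock_nonneg h hR n ω)

/-- After a fruitless exploration the reserves are depleted as in the Hotelling problem. -/
lemma optimalRate_last (h : p.Regular) (hR : 0 ≤ R) {n : ℕ} {ω : Ω} (hn : x < ξ (n + 1) ω)
    (t : ℝ) : optimalRate p ξ x R (n + 1) ω t = Real.toNNReal (p.rate * p.reserves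
      (p.cutoff (x - explored ξ x n ω) (optimalStock p ξ x R n ω)) (optimalDate p ξ x R n ω) t) := by
  have h0 : x - explored ξ x (n + 1) ω = 0 := by simp [explored, hn.le]
  unfold optimalRate
  rw [h0, h.premium_zero (optimalStock_nonneg h hR _ _), add_zero, optimalStock_succ,
    if_neg (not_le.2 hn), add_zero]
  rfl

lemma lintegral_optimalRate_last_le (h : p.Regular) (hR : 0 ≤ R) {n : ℕ} {ω : Ω}
    (hn : x < ξ (n + 1) ω) :
    ∫⁻ t in stage (optimalDate p ξ x R n ω) ∞, (optimalRate p ξ x R (n + 1) ω t : ℝ≥0∞)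
      ≤ ENNReal.ofReal (p.cutoff (x - explored ξ x n ω) (optimalStock p ξ x R n ω)) := by
  simp_rw [optimalRate_last h hR hn]
  rcases eq_or_ne (optimalDate p ξ x R n ω) ∞ with hτ | hτ
  · simp [hτ, stage_top]
  refine (h.lintegral_reserves (h.cutoff_mem (optimalStock_nonneg h hR n ω)).1.1
    le_top hτ).trans_le (by simp [Params.remaining])

lemma lastUtility_optimal (h : p.Regular) (hR : 0 ≤ R) {n : ℕ} {ω : Ω} (hn : x < ξ (n + 1) ω) :
    lastUtility p (optimalDate p ξ x R) (optimalRate p ξ x R) n ω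
      = ENNReal.ofReal (p.discount (optimalDate p ξ x R n ω) *
        p.hotelling (p.cutoff (x - explored ξ x n ω) (optimalStock p ξ x R n ω))) := by
  unfold lastUtility
  simp_rw [optimalRate_last h hR hn]
  rw [h.lintegral_u_reserves (h.cutoff_mem (optimalStock_nonneg h hR n ω)).1.1 le_top]
  simp [Params.remaining]

lemma sum_stageUse_optimal_le (h : p.Regular) (hR : 0 ≤ R) {n : ℕ} {ω : Ω}
    (hn : ∀ j < n, ξ (j + 1) ω ≤ x) :
    ∑ j ∈ Finset.range (n + 1), stageUse (optimalDate p ξ x R) (optimalRate p ξ x R) j ω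
      ≤ ENNReal.ofReal (R + n * p.a
        - p.cutoff (x - explored ξ x n ω) (optimalStock p ξ x R n ω)) := by
  induction n with
  | zero => simpa [optimalStock, optimalState] using stageUse_optimal_le (x := x) (ξ := ξ) h hR 0 ω
  | succ n ih =>
    rw [Finset.sum_range_succ]
    have hmem := fun j => (h.cutoff_mem (y := x - explored ξ x j ω)
      (optimalStock_nonneg (ξ := ξ) (x := x) h hR j ω)).1.2
    refine (add_le_add (ih fun j hj => hn j (Nat.lt_succ_of_lt hj))
      (stageUse_optimal_le h hR (n + 1) ω)).trans_eq ?_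
    rw [← ENNReal.ofReal_add]
    · rw [optimalStock_succ, if_pos (hn n (Nat.lt_succ_self n))]
      congr 1
      push_cast
      ring
    · have := hmem n
      have := optimalStock_le (ξ := ξ) (x := x) h hR n ω
      linarith
    · exact sub_nonneg.2 (hmem (n + 1))

end Path

section Measurability

variable {m : MeasurableSpace Ω} {p : Params} {s : Ω → ℝ≥0∞ × ℝ} {y : Ω → ℝ}

lemma measurable_nextDate_comp (h : p.Regular) (hs : Measurable s) (hy : Measurable y) :
    Measurable fun ω => p.nextDate (s ω).1 (y ω) (s ω).2 := by
  have h1 : Measurable fun ω => ((s ω).1, y ω, (s ω).2) := hs.fst.prodMk (hy.prodMk hs.snd)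
  have h2 := h.measurable_nextDate.comp h1
  exact h2

lemma measurable_cutoff_comp (h : p.Regular) (hs : Measurable s) (hy : Measurable y) :
    Measurable fun ω => p.cutoff (y ω) (s ω).2 := by
  have h1 : Measurable fun ω => (y ω, (s ω).2) := hy.prodMk hs.snd
  have h2 := h.measurable_cutoff.comp h1
  exact h2

lemma measurable_premium_comp (h : p.Regular) (hs : Measurable s) (hy : Measurable y) :
    Measurable fun ω => p.premium (y ω) (s ω).2 := by
  have h1 : Measurable fun ω => (y ω, (s ω).2) := hy.prodMk hs.snd
  have h2 := h.continuous_premium.measurable.comp h1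
  exact h2

end Measurability

variable [m0 : MeasurableSpace Ω] {P : Measure Ω} {p : Params} {ξ : ℕ → Ω → ℝ} {x R : ℝ}

lemma measurable_area (hξ : IsPoissonArrivals P p.lam ξ) (x : ℝ) (n : ℕ) :
    Measurable[stopped ξ x n] fun ω => x - explored ξ x n ω :=
  Measurable.sub (m := stopped ξ x n) measurable_const (hξ.measurable_explored x n)

lemma measurable_optimalState (h : p.Regular) (hξ : IsPoissonArrivals P p.lam ξ) (hx : 0 ≤ x)
    (n : ℕ) : Measurable[stopped ξ x n] (optimalState p ξ x R n) := by
  induction n with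
  | zero => exact measurable_const
  | succ n ih =>
    have hm := hξ.stopped_mono x (Nat.le_succ n)
    have hA := hξ.measurableSet_arrival_le hx (n + 1)
    have hy := (measurable_area hξ x n).mono hm le_rfl
    have hst := ih.mono hm le_rfl
    exact Measurable.prodMk (m := stopped ξ x (n + 1)) (measurable_nextDate_comp h hst hy)
      (Measurable.add (m := stopped ξ x (n + 1)) (measurable_cutoff_comp h hst hy)
        (Measurable.ite (m := stopped ξ x (n + 1)) hA measurable_const measurable_const))

lemma measurable_optimalDate (h : p.Regular) (hξ : IsPoissonArrivals P p.lam ξ) (hx : 0 ≤ x)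
    (n : ℕ) : Measurable[stopped ξ x n] (optimalDate p ξ x R n) := by
  exact measurable_nextDate_comp h (measurable_optimalState h hξ hx n) (measurable_area hξ x n)

lemma measurable_optimalRate (h : p.Regular) (hξ : IsPoissonArrivals P p.lam ξ) (hx : 0 ≤ x)
    (n : ℕ) : Measurable[(stopped ξ x n).prod (borel ℝ)]
      fun q : Ω × ℝ => optimalRate p ξ x R n q.1 q.2 := by
  have hst := measurable_optimalState (R := R) h hξ hx n
  have h1 : Measurable[stopped ξ x n] fun ω => (((optimalState p ξ x R n ω).1).toReal,
      optimalStock p ξ x R n ω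
        + p.premium (x - explored ξ x n ω) (optimalStock p ξ x R n ω)) :=
    Measurable.prodMk (m := stopped ξ x n) hst.fst.ennreal_toReal
      (Measurable.add (m := stopped ξ x n) hst.snd
        (measurable_premium_comp h hst (measurable_area hξ x n)))
  let _ : MeasurableSpace (Ω × ℝ) := (stopped ξ x n).prod (borel ℝ)
  have h2 : Measurable fun q : Ω × ℝ => q.2 := @measurable_snd _ _ (stopped ξ x n) (borel ℝ)
  have h3 : Measurable fun q : Ω × ℝ => (((optimalState p ξ x R n q.1).1).toReal,
      optimalStock p ξ x R n q.1
        + p.premium (x - explored ξ x n q.1) (optimalStock p ξ x R n q.1)) :=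
    h1.comp (@measurable_fst _ _ (stopped ξ x n) (borel ℝ))
  have hF : Measurable fun z : (ℝ × ℝ) × ℝ =>
      Real.toNNReal (p.rate * (z.1.2 * Real.exp (-p.rate * (z.2 - z.1.1)))) := by fun_prop
  have h4 := hF.comp (h3.prodMk h2)
  convert h4 using 2 with q
  rw [optimalRate, stageStart_optimalDate]
  rfl

lemma isAdmissible_optimal (h : p.Regular) (hR : 0 ≤ R) (hξ : IsPoissonArrivals P p.lam ξ)
    (hx : 0 ≤ x) :
    IsAdmissible P ξ p x R (optimalDate p ξ x R) (optimalRate p ξ x R) where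
  mono := optimalDate_mono p ξ x R
  measurable_θ := measurable_optimalDate h hξ hx
  measurable_c := measurable_optimalRate h hξ hx
  budget := by
    refine ae_of_all _ fun ω t ht => ?_
    have hmono := optimalDate_mono p ξ x R ω
    set N := count ξ x ω with hN
    have hcut := fun j => (h.cutoff_mem (y := x - explored ξ x j ω)
      (optimalStock_nonneg (R := R) (ξ := ξ) (x := x) h hR j ω)).1.1
    have hξle : ∀ n ≤ N, ∀ j < n, ξ (j + 1) ω ≤ x := fun n hn j hj =>
      (le_count_iff hξ hx (j + 1) ω).1 (le_trans hj hn)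
    rw [Finset.sum_boole]
    -- If all N discoveries lie before t, the budget allows R + N a, which covers the consumption of
    -- all episodes, the last one included.
    by_cases hall : ∀ n < N, optimalDate p ξ x R n ω ≤ ENNReal.ofReal t
    · have hcard : (Finset.filter (fun n => optimalDate p ξ x R n ω ≤ ENNReal.ofReal t)
          (Finset.range N)).card = N := by
        rw [Finset.filter_true_of_mem fun n hn => hall n (Finset.mem_range.1 hn),
          Finset.card_range]
      rw [hcard]
      refine (lintegral_mono_set (Ioc_subset_Ioi_self)).trans ?_
      rw [lintegral_consumption hmono fun _ y => (y : ℝ≥0∞)]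
      have hlast : x < ξ (N + 1) ω := by
        by_contra! hc
        have := (le_count_iff hξ hx (N + 1) ω).2 hc
        omega
      refine (add_le_add (sum_stageUse_optimal_le h hR (hξle N le_rfl))
        (lintegral_optimalRate_last_le h hR hlast)).trans_eq ?_
      have hs := optimalStock_le (ξ := ξ) (x := x) h hR N ω
      have hc := (h.cutoff_mem (y := x - explored ξ x N ω)
        (optimalStock_nonneg (R := R) (ξ := ξ) (x := x) h hR N ω)).1.2
      rw [← ENNReal.ofReal_add (by linarith) (hcut N)]
      congr 1
      ring
    · push Not at hall
      classical
      -- With j the first exploration after t, j deposits are counted, and consumption up to t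
      -- belongs to the episodes 0, …, j.
      set j := Nat.find hall with hj
      obtain ⟨hjN, hlt⟩ := Nat.find_spec hall
      have hle : j ≤ (Finset.filter (fun n => optimalDate p ξ x R n ω ≤ ENNReal.ofReal t)
          (Finset.range N)).card := by
        refine (Finset.card_range j).symm.trans_le (Finset.card_le_card fun i hi => ?_)
        have hi' := Finset.mem_range.1 hi
        have hiN : i < N := hi'.trans hjN
        refine Finset.mem_filter.2 ⟨Finset.mem_range.2 hiN, ?_⟩
        have := Nat.find_min hall hi'
        push Not at this
        exact this hiN
      have hsub : Ioc 0 t ⊆ stage 0 (optimalDate p ξ x R j ω) := fun s hs =>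
        ⟨hs.1, zero_le, (ENNReal.ofReal_le_ofReal hs.2).trans_lt hlt⟩
      refine (lintegral_mono_set hsub).trans ?_
      rw [lintegral_consumption_stages hmono (le_of_lt hjN) fun _ y => (y : ℝ≥0∞)]
      refine (sum_stageUse_optimal_le h hR (hξle j (le_of_lt hjN))).trans
        (ENNReal.ofReal_le_ofReal ?_)
      have h1 : (j : ℝ) * p.a ≤ p.a * ((Finset.filter (fun n => optimalDate p ξ x R n ω
          ≤ ENNReal.ofReal t) (Finset.range N)).card : ℝ) := by
        rw [mul_comm]
        exact mul_le_mul_of_nonneg_left (Nat.cast_le.2 hle) h.a_pos.le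
      linarith [hcut j]

/-- The reserves are at most R + n a, the value grows no faster than a multiple of 1 + 𝒰, and n
arrivals within x have probability at most (λx)ⁿ/n!. -/
lemma tendsto_continuation_optimal [IsProbabilityMeasure P] (h : p.Regular) (hR : 0 ≤ R)
    (hξ : IsPoissonArrivals P p.lam ξ) (hx : 0 ≤ x) :
    Filter.Tendsto (continuation P ξ p x (optimalDate p ξ x R) (optimalStock p ξ x R))
      Filter.atTop (nhds 0) := by
  have hV0 : 0 ≤ p.limitValue x 0 := by
    have := h.candidate_limit.hotelling_le x 0 hx le_rfl
    rwa [h.hotelling_zero] at this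
  set C := 1 + p.limitValue x 0 with hC
  have hlim := ENNReal.tendsto_ofReal (h.tendsto_growth_bound hR hx (C := C) (by positivity))
  rw [ENNReal.ofReal_zero] at hlim
  refine tendsto_of_tendsto_of_tendsto_of_le_of_le tendsto_const_nhds hlim (fun _ => zero_le)
    fun n => ?_
  have hRn : 0 ≤ R + n * p.a := by have := h.a_pos; positivity
  have hUn := h.hotelling_nonneg hRn
  calc continuation P ξ p x (optimalDate p ξ x R) (optimalStock p ξ x R) n
      ≤ ∫⁻ _ω in {ω | ξ n ω ≤ x}, ENNReal.ofReal (C * (1 + p.hotelling (R + n * p.a))) ∂P := by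
        refine setLIntegral_mono' (hξ.measurableSet_le_level n x) fun ω hω =>
          ENNReal.ofReal_le_ofReal ?_
        have hy : 0 ≤ x - ξ n ω := sub_nonneg.2 hω
        have hS := optimalStock_nonneg (ξ := ξ) (x := x) h hR n ω
        have h1 := h.limitValue_le hy hS
        have h2 := h.hotelling_mono hS (optimalStock_le (ξ := ξ) (x := x) h hR n ω)
        have h3 := h.candidate_limit.mono 0 le_rfl hy hx
          (by linarith [hξ.nonneg n ω] : x - ξ n ω ≤ x)
        simp only at h3
        have h4 := (h.hotelling_nonneg hS).trans (h.candidate_limit.hotelling_le _ _ hy hS)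
        refine (mul_le_of_le_one_left h4 (discount_le_one h _)).trans ?_
        nlinarith
    _ = ENNReal.ofReal (C * (1 + p.hotelling (R + n * p.a))) * P {ω | ξ n ω ≤ x} := by
        rw [setLIntegral_const]
    _ ≤ _ := by
        exact (mul_le_mul' le_rfl (measure_arrival_le h hξ x n)).trans_eq
          (ENNReal.ofReal_mul (by positivity)).symm

/-- Each inequality behind `gain_le` is an equality for this strategy, and the remainder dropped
there tends to 0. -/
lemma gain_optimal [IsProbabilityMeasure P] (h : p.Regular) (hR : 0 ≤ R)
    (hξ : IsPoissonArrivals P p.lam ξ) (hx : 0 ≤ x) :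
    gain P ξ p x (optimalDate p ξ x R) (optimalRate p ξ x R) = (p.limitValue x R : EReal) := by
  have hs := isAdmissible_optimal h hR hξ hx
  have hE := hξ.measurableSet_le_level
  have hθ := hs.measurable_date hξ hx
  have hcm := hs.measurable_rate hξ hx
  set θ := optimalDate p ξ x R with hθdef
  set c := optimalRate p ξ x R with hcdef
  set u : ℕ → ℝ≥0∞ := fun n => ∫⁻ ω in {ω | ξ n ω ≤ x}, stageUtility p θ c n ω ∂P with hu
  set b : ℕ → ℝ≥0∞ := fun n => ∫⁻ ω in {ω | ξ n ω ≤ x} \ {ω | ξ (n + 1) ω ≤ x},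
    lastUtility p θ c n ω ∂P with hb
  set f : ℕ → ℝ≥0∞ := fun n => ∫⁻ ω in {ω | ξ n ω ≤ x}, ENNReal.ofReal
        (p.discount (θ n ω) * p.k * (explored ξ x (n + 1) ω - explored ξ x n ω)) ∂P with hf
  set v := continuation P ξ p x θ (optimalStock p ξ x R) with hv
  set ρ : ℕ → Ω → ℝ := fun n ω =>
    p.cutoff (x - explored ξ x n ω) (optimalStock p ξ x R n ω) with hρ
  have hρm : ∀ n, Measurable[stopped ξ x n] (ρ n) := fun n =>
    measurable_cutoff_comp h (measurable_optimalState h hξ hx n) (measurable_area hξ x n)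
  have hstep : ∀ n, u n + b n + v (n + 1) = v n + f n := by
    intro n
    have hexp := lintegral_exploration h hξ hx n h.candidate_limit (d := fun ω => p.discount (θ n ω))
      (p.measurable_discount.comp (hs.measurable_θ n)) (hρm n)
      (ae_of_all _ fun ω _ => p.discount_nonneg _)
      (ae_of_all _ fun ω _ => (h.cutoff_mem (optimalStock_nonneg h hR n ω)).1.1)
    have h1 : u n + ∫⁻ ω in {ω | ξ n ω ≤ x}, ENNReal.ofReal
        (p.discount (θ n ω) * p.M p.limitValue (x - ξ n ω) (ρ n ω)) ∂P = v n := by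
      rw [hu, hv, ← lintegral_add_left (measurable_stageUtility hθ hcm n)]
      refine setLIntegral_congr_fun (hE n x) fun ω hω => ?_
      have hexpl : explored ξ x n ω = ξ n ω := min_eq_left hω
      have := stageUtility_optimal_add (ξ := ξ) (x := x) h hR n ω
      simp only [hρ]
      rwa [hexpl] at this ⊢
    have h2 : b n = ∫⁻ ω in {ω | ξ n ω ≤ x} \ {ω | ξ (n + 1) ω ≤ x},
        ENNReal.ofReal (p.discount (θ n ω) * p.hotelling (ρ n ω)) ∂P :=
      setLIntegral_congr_fun ((hE n x).diff (hE (n + 1) x)) fun ω hω =>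
        lastUtility_optimal h hR (not_le.1 hω.2)
    have h3 : v (n + 1) = ∫⁻ ω in {ω | ξ (n + 1) ω ≤ x}, ENNReal.ofReal
        (p.discount (θ n ω) * p.limitValue (x - ξ (n + 1) ω) (ρ n ω + p.a)) ∂P := by
      refine setLIntegral_congr_fun (hE (n + 1) x) fun ω hω => ?_
      have hω' : ξ (n + 1) ω ≤ x := hω
      simp only [optimalStock_succ, stageStart, hρ, if_pos hω']
    rw [← h3, ← h2] at hexp
    rw [← h1, add_assoc, add_assoc, add_comm (b n), ← hexp]
  have hpart : ∀ m, ∑ n ∈ Finset.range m, (u n + b n) + v m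
      = ENNReal.ofReal (p.limitValue x R) + ∑ n ∈ Finset.range m, f n := by
    intro m
    induction m with
    | zero =>
      have : v 0 = ENNReal.ofReal (p.limitValue x R) := continuation_zero hξ hx fun ω => rfl
      simp [this]
    | succ m ih =>
      rw [Finset.sum_range_succ, Finset.sum_range_succ, add_assoc, hstep m, ← add_assoc, ih,
        add_assoc]
  have htot : ∑' n, (u n + b n) = ENNReal.ofReal (p.limitValue x R) + ∑' n, f n := by
    have h1 := (ENNReal.tendsto_nat_tsum fun n => u n + b n).add
      (tendsto_continuation_optimal h hR hξ hx)
    rw [add_zero] at h1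
    have h2 := (tendsto_const_nhds (x := ENNReal.ofReal (p.limitValue x R))).add
      (ENNReal.tendsto_nat_tsum f)
    exact tendsto_nhds_unique (h1.congr hpart) h2
  have hV : 0 ≤ p.limitValue x R :=
    (h.hotelling_nonneg hR).trans (h.candidate_limit.hotelling_le x R hx hR)
  have hcost := lintegral_cost_ne_top (θ := θ) h hξ hx
  unfold gain
  rw [lintegral_utility_eq_tsum hξ hx hs.mono hθ hcm]
  rw [lintegral_cost_eq_tsum h hξ hx hθ] at hcost ⊢
  change ((∑' n, (u n + b n) : ℝ≥0∞) : EReal) - ((∑' n, f n : ℝ≥0∞) : EReal) = _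
  change ∑' n, f n ≠ ∞ at hcost
  rw [htot]
  generalize ∑' n, f n = B at hcost ⊢
  lift B to ℝ≥0 using hcost
  rw [← ENNReal.ofReal_coe_nnreal, ← ENNReal.ofReal_add hV B.coe_nonneg,
    EReal.coe_ennreal_ofReal, EReal.coe_ennreal_ofReal, max_eq_left (add_nonneg hV B.coe_nonneg),
    max_eq_left B.coe_nonneg, ← EReal.coe_sub, add_sub_cancel_right]


/-! ### The value function is the fixed point -/

lemma SolvesHJB.congr {p : Params} {V W : ℝ → ℝ → ℝ} (ha : 0 ≤ p.a) (hV : SolvesHJB p V)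
    (hWV : ∀ x R, 0 ≤ x → 0 ≤ R → W x R = V x R) : SolvesHJB p W := by
  have hint : ∀ x R, 0 ≤ x → 0 ≤ R → EqOn
      (fun s => W (x - s) (R + p.a) * (p.lam * Real.exp (-p.lam * s)))
      (fun s => V (x - s) (R + p.a) * (p.lam * Real.exp (-p.lam * s))) (uIcc 0 x) := by
    intro x R hx hR s hs
    rw [uIcc_of_le hx] at hs
    simp only [hWV (x - s) (R + p.a) (sub_nonneg.2 hs.2) (by linarith)]
  have hM : ∀ x R, 0 ≤ x → 0 ≤ R → p.M W x R = p.M V x R := by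
    intro x R hx hR
    unfold Params.M
    rw [intervalIntegral.integral_congr (hint x R hx hR)]
  have hloc : ∀ x R, 0 ≤ x → 0 < R → W x =ᶠ[nhds R] V x := fun x R hx hR => by
    filter_upwards [Ioi_mem_nhds hR] with S hS using hWV x S hx (le_of_lt hS)
  exact
    { continuousOn x hx := (hV.continuousOn x hx).congr fun R hR => hWV x R hx hR
      differentiableAt x R hx hR :=
        (hV.differentiableAt x R hx hR).congr_of_eventuallyEq (hloc x R hx hR)
      integrable x R hx hR :=
        (hV.integrable x R hx hR).congr fun s hs => (hint x R hx hR (uIoc_subset_uIcc hs)).symm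
      interior x R hx hR := by
        rw [(hloc x R hx hR).deriv_eq, hM x R hx hR.le, hWV x R hx hR.le]
        exact hV.interior x R hx hR
      boundary x hx := by
        rw [hM x 0 hx le_rfl, hWV x 0 hx le_rfl]
        exact hV.boundary x hx
      initial R hR := by rw [hWV 0 R le_rfl hR, hV.initial R hR] }

variable {Ω : Type*} [MeasurableSpace Ω] {P : Measure Ω} [IsProbabilityMeasure P] {p : Params}
  {ξ : ℕ → Ω → ℝ} {x R : ℝ}

lemma valueE_eq (h : p.Regular) (hξ : IsPoissonArrivals P p.lam ξ) (hx : 0 ≤ x) (hR : 0 ≤ R) :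
    valueE P ξ p x R = (p.limitValue x R : EReal) := by
  refine le_antisymm (iSup_le fun θ => iSup_le fun c => iSup_le fun hs => hs.gain_le h hR hξ hx) ?_
  rw [← gain_optimal h hR hξ hx]
  exact le_iSup_of_le _ (le_iSup_of_le _ (le_iSup_of_le (isAdmissible_optimal h hR hξ hx) le_rfl))

lemma value_eq (h : p.Regular) (hξ : IsPoissonArrivals P p.lam ξ) (hx : 0 ≤ x) (hR : 0 ≤ R) :
    value P ξ p x R = p.limitValue x R := by
  rw [value, valueE_eq h hξ hx hR, EReal.toReal_coe]

lemma isLUB_gain (h : p.Regular) (hξ : IsPoissonArrivals P p.lam ξ) (hx : 0 ≤ x) (hR : 0 ≤ R) :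
    IsLUB {g : EReal | ∃ θ c, IsAdmissible P ξ p x R θ c ∧ g = gain P ξ p x θ c}
      ((value P ξ p x R : ℝ) : EReal) := by
  rw [value_eq h hξ hx hR]
  constructor
  · rintro g ⟨θ, c, hs, rfl⟩
    exact hs.gain_le h hR hξ hx
  · intro B hB
    exact hB ⟨_, _, isAdmissible_optimal h hR hξ hx, (gain_optimal h hR hξ hx).symm⟩

lemma hasDerivAt_value (h : p.Regular) (hξ : IsPoissonArrivals P p.lam ξ) (hx : 0 ≤ x)
    (hR : 0 < R) : HasDerivAt (value P ξ p x) (p.limitDeriv x R) R := by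
  refine (h.hasDerivAt_limitValue hx hR).congr_of_eventuallyEq ?_
  filter_upwards [Ioi_mem_nhds hR] with S hS using value_eq h hξ hx (le_of_lt hS)

end Exploration

end

theorem theorem1 {Ω : Type*} [MeasurableSpace Ω] (P : MeasureTheory.Measure Ω)
    [MeasureTheory.IsProbabilityMeasure P] (p : Exploration.Params)
    (hα0 : 0 < p.α) (hα1 : p.α < 1) (hr : 0 < p.r) (hlam : 0 < p.lam) (hk : 0 < p.k)
    (ha : 0 < p.a) (hka : p.k / p.lam ≤ p.hotelling p.a)
    (ξ : ℕ → Ω → ℝ) (hξ : Exploration.IsPoissonArrivals P p.lam ξ) :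
    -- the supremum defining the value function is finite
    (∀ x R, 0 ≤ x → 0 ≤ R → IsLUB
      {g : EReal | ∃ θ c, Exploration.IsAdmissible P ξ p x R θ c ∧
        g = Exploration.gain P ξ p x θ c}
      ((Exploration.value P ξ p x R : ℝ) : EReal)) ∧
    -- concave and continuously differentiable in the reserves
    (∀ x, 0 ≤ x → ConcaveOn ℝ (Set.Ici 0) (Exploration.value P ξ p x)) ∧
    (∀ x R, 0 ≤ x → 0 < R → DifferentiableAt ℝ (Exploration.value P ξ p x) R) ∧
    ContinuousOn (fun q : ℝ × ℝ => deriv (Exploration.value P ξ p q.1) q.2)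
      (Set.Ici 0 ×ˢ Set.Ioi 0) ∧
    -- increasing and continuously differentiable in the unexplored area
    (∀ R, 0 ≤ R → MonotoneOn (fun x => Exploration.value P ξ p x R) (Set.Ici 0)) ∧
    (∀ R, 0 ≤ R → DifferentiableOn ℝ (fun x => Exploration.value P ξ p x R) (Set.Ici 0)) ∧
    ContinuousOn (fun q : ℝ × ℝ =>
        derivWithin (fun x => Exploration.value P ξ p x q.2) (Set.Ici 0) q.1)
      (Set.Ici 0 ×ˢ Set.Ici 0) ∧
    -- the HJB equation
    Exploration.SolvesHJB p (Exploration.value P ξ p) ∧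
    -- verification
    (∀ W : ℝ → ℝ → ℝ,
      (∀ x R, 0 ≤ x → 0 ≤ R → 0 ≤ W x R) →
      (∀ x, 0 ≤ x → ContDiffOn ℝ 1 (W x) (Set.Ioi 0)) →
      Exploration.SolvesHJB p W →
      (∀ x, 0 ≤ x → ∃ C : ℝ, ∀ y R, 0 ≤ y → y ≤ x → 0 ≤ R →
        W y R ≤ C * (1 + p.hotelling R)) →
      ∀ x R, 0 ≤ x → 0 ≤ R → W x R = Exploration.value P ξ p x R) := by
  have h : p.Regular := ⟨hα0, hα1, hr, hlam, hk, ha, hka⟩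
  have heq : ∀ x R, 0 ≤ x → 0 ≤ R → Exploration.value P ξ p x R = p.limitValue x R :=
    fun x R hx hR => Exploration.value_eq h hξ hx hR
  have heqx : ∀ R, 0 ≤ R → Set.EqOn (fun x => Exploration.value P ξ p x R)
      (fun x => p.limitValue x R) (Set.Ici 0) := fun R hR x hx => heq x R hx hR
  refine ⟨fun x R hx hR => Exploration.isLUB_gain h hξ hx hR, fun x hx => ?_,
    fun x R hx hR => (Exploration.hasDerivAt_value h hξ hx hR).differentiableAt, ?_,
    fun R hR => ?_, fun R hR => (h.differentiableOn_limitValue_left hR).congr (heqx R hR), ?_,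
    h.solvesHJB_limitValue.congr ha.le heq, fun W hnn _ hW hgrowth x R hx hR => ?_⟩
  · exact (h.concaveOn_limitValue hx).congr fun R hR => (heq x R hx hR).symm
  · exact h.continuousOn_limitDeriv.congr fun z hz =>
      (Exploration.hasDerivAt_value h hξ hz.1 hz.2).deriv
  · exact (h.candidate_limit.mono R hR).congr (heqx R hR).symm
  · exact h.continuousOn_derivWithin_limitValue.congr fun z hz =>
      derivWithin_congr (heqx z.2 hz.2) (heqx z.2 hz.2 hz.1)
  · rw [heq x R hx hR]
    exact h.eq_limitValue_of_solvesHJB hnn hW hgrowth hx hR
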